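/- Let $U\subset\mathbb R^n$ be a domain (open, connected, non-empty) and $V=(V^1,\dots,V^n)$ smooth on $U$. The conservative system $u^i_t=(V^i(\mathbf u))_x$ is said to possess a third-order Hamiltonian structure if there are smooth functions $g^{ij}(\mathbf u)$, $c^{ij}_k(\mathbf u)$ on $U$ with $\det g^{ij}\neq0$ such that the operator $P^{ij}=\partial_x\,(g^{ij}\partial_x+c^{ij}_ku^k_x)\,\partial_x$ is Hamiltonian (its Poisson bracket $\{F,G\}=\int\frac{\delta F}{\delta u^i}P^{ij}\frac{\delta G}{\delta u^j}\,dx$ is skew-symmetric and satisfies the Jacobi identity) and $u^i_t=(V^i)_x=P^{ij}\frac{\delta H}{\delta u^j}$ for some functional $H=\int h\,dx$ whose density $h$ is a smooth function of $x$, the potential $b$ (where $\mathbf u=b_x$) and finitely many derivatives of $b$. The matrix $g=(g_{ij})$ inverse to $(g^{ij})$ is called the metric. A reciprocal transformation with real constants $a_i,b_i,a,b,c,d$ is the change of independent variables $$d\tilde x=(a_iu^i+a)\,dx+(a_iV^i+b)\,dt,\qquad d\tilde t=(b_iu^i+c)\,dx+(b_iV^i+d)\,dt;$$ the new densities $\tilde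 u^i$ and fluxes $\tilde V^i$ are defined by $u^i\,dx+V^i\,dt=\tilde u^i\,d\tilde x+\tilde V^i\,d\tilde t$. It is assumed that $d\tilde x,d\tilde t$ are independent on $U$ and that $\mathbf u\mapsto\tilde{\mathbf u}$ is a diffeomorphism of $U$ onto its image $\tilde U$, so that the $\tilde V^i$ are functions of $\tilde{\mathbf u}\in\tilde U$. **Theorem.** (i) The transformed system $\tilde u^i_{\tilde t}=(\tilde V^i(\tilde{\mathbf u}))_{\tilde x}$ is again a conservative system on a domain with smooth fluxes; it is strictly hyperbolic (the eigenvalues of the Jacobian matrix of the fluxes are real and distinct) if and only if the original system is; and it possesses a third-order Hamiltonian structure if and only if the original system does. The transformation carries each line $y^i=u^iy^{n+1}+V^iy^{n+2}$, $i=1,\dots,n$, of the congruence associated with the original system in $\mathbb P^{n+1}$ to the corresponding line $y^i=\tilde u^iy^{n+1}+\tilde V^iy^{n+2}$ of the congruence of the transformed system by the projective transformation $$y^i\mapsto y^i,\quad y^{n+1}\mapsto a_iy^i+a\,y^{n+1}+b\,y^{n+2},\quad y^{n+2}\mapsto b_iy^i+c\,y^{n+1}+d\,y^{n+2},$$ which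 is invertible and can be rescaled to have determinant $\pm1$, and determinant $1$ if $n$ is odd. (ii) Consider the inversion $d\tilde x=dt$, $d\tilde t=dx$, for which $\tilde u^i=V^i$, $\tilde V^i=u^i$. For every third-order Hamiltonian structure of the original system, with metric $g$, the inverted system possesses a third-order Hamiltonian structure with metric $$\tilde g_{ij}=V^m_i\,g_{mp}\,V^p_j,\qquad V^m_i=\partial V^m/\partial u^i,$$ that is, $\tilde g=(\partial V)^{T}g\,(\partial V)$. There exist constants $\phi_{\beta\gamma},\psi^\gamma_{km},\omega^\gamma_k,\eta^\gamma_k,\xi^\gamma$ (all indices from $1$ to $n$), with $\phi$ symmetric and non-degenerate and $\psi^\gamma_{km}=-\psi^\gamma_{mk}$, such that on $U$, with $\psi^\gamma_k=\psi^\gamma_{km}u^m+\omega^\gamma_k$, $$g_{ij}=\phi_{\beta\gamma}\psi^\beta_i\psi^\gamma_j,\qquad \psi^\gamma_kV^k=\eta^\gamma_mu^m+\xi^\gamma,$$ and such that for all values of the free indices $$\phi_{\beta\gamma}(\psi^\beta_{is}\psi^\gamma_{jk}+\psi^\beta_{js}\psi^\gamma_{ki}+\psi^\beta_{ks}\psi^\gamma_{ij})=0,\qquad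 \phi_{\beta\gamma}(\omega^\beta_i\psi^\gamma_{jk}+\omega^\beta_j\psi^\gamma_{ki}+\omega^\beta_k\psi^\gamma_{ij})=0,$$ $$\phi_{\beta\gamma}(\psi^\beta_{ij}\eta^\gamma_k+\psi^\beta_{jk}\eta^\gamma_i+\psi^\beta_{ki}\eta^\gamma_j)=0,\qquad \phi_{\beta\gamma}(\psi^\beta_{ik}\xi^\gamma+\omega^\beta_k\eta^\gamma_i-\omega^\beta_i\eta^\gamma_k)=0.$$ For every such choice of constants, the metric $\tilde g$ and the fluxes $\tilde V$ of the inverted system satisfy the same relations on $\tilde U$ in the variables $\tilde{\mathbf u}$ with the constants $$\tilde\phi_{\beta\gamma}=\phi_{\beta\gamma},\quad\tilde\psi^\gamma_{km}=\psi^\gamma_{km},\quad\tilde\omega^\gamma_k=\eta^\gamma_k,\quad\tilde\eta^\gamma_k=\omega^\gamma_k,\quad\tilde\xi^\gamma=-\xi^\gamma.$$ -/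

import Mathlib

open scoped ContDiff

noncomputable section

/-- A system of conservation laws `u^i_t = (V^i(u))_x` with smooth fluxes `V` on a domain `U`. -/
structure IsConservativeSystem {n : ℕ} (U : Set (Fin n → ℝ))
    (V : (Fin n → ℝ) → (Fin n → ℝ)) : Prop where
  isOpen : IsOpen U
  isConnected : IsConnected U
  smooth : ContDiffOn ℝ ∞ V U

/-- The eigenvalues of the Jacobian matrix of the fluxes are real and distinct on `U`. -/
def IsStrictlyHyperbolic {n : ℕ} (U : Set (Fin n → ℝ))
    (V : (Fin n → ℝ) → (Fin n → ℝ)) : Prop :=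
  ∀ u ∈ U, ∃ ev : Fin n → ℝ, Function.Injective ev ∧
    ∀ i, Module.End.HasEigenvalue
      ((fderiv ℝ V u : (Fin n → ℝ) →L[ℝ] (Fin n → ℝ)) : (Fin n → ℝ) →ₗ[ℝ] (Fin n → ℝ)) (ev i)

/-! ### Third-order Hamiltonian operators -/

/-- The operator `P^{ij} = ∂ (G^{ij} ∂ + c^{ij}_k u^k_x) ∂` along the curve `u = u(x)`,
applied to the covector field `q = q(x)`; here `c i j k` stands for `c^{ij}_k`. -/
def thirdOrderOp {n : ℕ} (G : (Fin n → ℝ) → Matrix (Fin n) (Fin n) ℝ)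
    (c : (Fin n → ℝ) → Fin n → Fin n → Fin n → ℝ)
    (u q : ℝ → Fin n → ℝ) (x : ℝ) (i : Fin n) : ℝ :=
  deriv (fun y => ∑ j, (G (u y) i j * deriv (deriv q) y j
    + (∑ k, c (u y) i j k * deriv u y k) * deriv q y j)) x

/-- A smooth compactly supported covector field on the line. -/
def IsTestField {n : ℕ} (p : ℝ → Fin n → ℝ) : Prop :=
  ContDiff ℝ ∞ p ∧ HasCompactSupport p

/-- A smooth curve `u = u(x)` on the line with values in `U`. -/
def IsCurveIn {n : ℕ} (U : Set (Fin n → ℝ)) (u : ℝ → Fin n → ℝ) : Prop :=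
  ContDiff ℝ ∞ u ∧ ∀ x, u x ∈ U

/-- One cyclic term of the Schouten bracket `[P, P]`: the integral of `p · P'[P q] r`, where
`P'[v]` is the derivative of the operator `P` (which depends on `u`) in the direction `v`.
For the linear functionals `F_p = ∫ p · u dx` this is the iterated Poisson bracket
`{{F_p, F_r}, F_q}` of `{F, G} = ∫ (δF/δu) · P (δG/δu) dx`. -/
def schoutenTerm {n : ℕ} (G : (Fin n → ℝ) → Matrix (Fin n) (Fin n) ℝ)
    (c : (Fin n → ℝ) → Fin n → Fin n → Fin n → ℝ)
    (u p q r : ℝ → Fin n → ℝ) : ℝ :=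
  ∫ x, ∑ i, p x i *
    deriv (fun ε : ℝ => thirdOrderOp G c (fun y => u y + ε • thirdOrderOp G c u q y) r x i) 0

/-- `P^{ij} = ∂ (G^{ij} ∂ + c^{ij}_k u^k_x) ∂` is a non-degenerate Hamiltonian operator on `U`:
the Poisson bracket it defines is skew-symmetric and satisfies the Jacobi identity. -/
structure IsHamiltonianOp {n : ℕ} (U : Set (Fin n → ℝ))
    (G : (Fin n → ℝ) → Matrix (Fin n) (Fin n) ℝ)
    (c : (Fin n → ℝ) → Fin n → Fin n → Fin n → ℝ) : Prop where
  smooth_G : ∀ i j, ContDiffOn ℝ ∞ (fun u => G u i j) U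
  smooth_c : ∀ i j k, ContDiffOn ℝ ∞ (fun u => c u i j k) U
  nondegenerate : ∀ u ∈ U, (G u).det ≠ 0
  skew : ∀ u p q : ℝ → Fin n → ℝ, IsCurveIn U u → IsTestField p → IsTestField q →
    ∫ x, ∑ i, p x i * thirdOrderOp G c u q x i
      = - ∫ x, ∑ i, q x i * thirdOrderOp G c u p x i
  jacobi : ∀ u p q r : ℝ → Fin n → ℝ, IsCurveIn U u →
    IsTestField p → IsTestField q → IsTestField r →
    schoutenTerm G c u p q r + schoutenTerm G c u q r p + schoutenTerm G c u r p q = 0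

/-! ### Hamiltonians

The Hamiltonian functionals are nonlocal in `u`: they are `∫ h dx` with a density
`h(x, b, b_x, b_xx, …)` of arbitrary finite order, where `b` is the potential, `u = b_x`. -/

/-- The variational derivative `δH/δb^i = ∑_k (-d/dx)^k (∂h/∂b^i_k)`, `H = ∫ h dx`,
along the curve `b = b(x)`; the density `h` depends on `x` and on `b` and its derivatives
`b_k = d^k b/dx^k` up to order `N + 1`. -/
def variationalDeriv {n N : ℕ} (h : ℝ × (Fin (N + 2) → Fin n → ℝ) → ℝ)
    (b : ℝ → Fin n → ℝ) (x : ℝ) (i : Fin n) : ℝ :=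
  ∑ k : Fin (N + 2), (-1 : ℝ) ^ (k : ℕ) *
    iteratedDeriv (k : ℕ)
      (fun y => fderiv ℝ h (y, fun l : Fin (N + 2) => iteratedDeriv (l : ℕ) b y)
        (0, Pi.single k (Pi.single i 1))) x

/-- The system `u_t = V(u)_x` has the form `u_t = P (δH/δu)` for some Hamiltonian `H`.
Since `u = b_x`, the covector field `θ = δH/δu` is given by `θ_x = - δH/δb`. -/
def HasHamiltonian {n : ℕ} (U : Set (Fin n → ℝ)) (V : (Fin n → ℝ) → (Fin n → ℝ))
    (G : (Fin n → ℝ) → Matrix (Fin n) (Fin n) ℝ)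
    (c : (Fin n → ℝ) → Fin n → Fin n → Fin n → ℝ) : Prop :=
  ∃ (N : ℕ) (h : ℝ × (Fin (N + 2) → Fin n → ℝ) → ℝ),
    ContDiffOn ℝ ∞ h {z | z.2 1 ∈ U} ∧
    ∀ b θ : ℝ → Fin n → ℝ, ContDiff ℝ ∞ b → ContDiff ℝ ∞ θ → (∀ x, deriv b x ∈ U) →
      (∀ x i, deriv θ x i = - variationalDeriv h b x i) →
      ∀ x i, deriv (fun y => V (deriv b y)) x i = thirdOrderOp G c (deriv b) θ x i

/-- `P = ∂ (G ∂ + c u_x) ∂` is a third-order Hamiltonian structure of `u_t = V(u)_x` on `U`. -/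
def IsHamiltonianStructure {n : ℕ} (U : Set (Fin n → ℝ)) (V : (Fin n → ℝ) → (Fin n → ℝ))
    (G : (Fin n → ℝ) → Matrix (Fin n) (Fin n) ℝ)
    (c : (Fin n → ℝ) → Fin n → Fin n → Fin n → ℝ) : Prop :=
  IsHamiltonianOp U G c ∧ HasHamiltonian U V G c

/-- The system `u_t = V(u)_x` on `U` possesses a third-order Hamiltonian structure. -/
def IsThirdOrderHamiltonian {n : ℕ} (U : Set (Fin n → ℝ))
    (V : (Fin n → ℝ) → (Fin n → ℝ)) : Prop :=
  ∃ G c, IsHamiltonianStructure U V G c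

/-! ### Reciprocal transformations -/

/-- The constants of a reciprocal transformation
`dX = (α_i u^i + a) dx + (α_i V^i + b) dt`, `dT = (β_i u^i + c) dx + (β_i V^i + d) dt`. -/
structure Reciprocal (n : ℕ) where
  α : Fin n → ℝ
  β : Fin n → ℝ
  a : ℝ
  b : ℝ
  c : ℝ
  d : ℝ

namespace Reciprocal

variable {n : ℕ} (R : Reciprocal n)

/-- The coefficient of `dx` in `dX`, at densities `u`. -/
def Xx (u : Fin n → ℝ) : ℝ := ∑ i, R.α i * u i + R.a

/-- The coefficient of `dt` in `dX`, at fluxes `v`. -/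
def Xt (v : Fin n → ℝ) : ℝ := ∑ i, R.α i * v i + R.b

/-- The coefficient of `dx` in `dT`, at densities `u`. -/
def Tx (u : Fin n → ℝ) : ℝ := ∑ i, R.β i * u i + R.c

/-- The coefficient of `dt` in `dT`, at fluxes `v`. -/
def Tt (v : Fin n → ℝ) : ℝ := ∑ i, R.β i * v i + R.d

/-- The Jacobian of the change of independent variables. -/
def jac (u v : Fin n → ℝ) : ℝ := R.Xx u * R.Tt v - R.Xt v * R.Tx u

/-- The new densities. -/
def newDensity (u v : Fin n → ℝ) : Fin n → ℝ :=
  fun i => (R.Tt v * u i - R.Tx u * v i) / R.jac u v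

/-- The new fluxes. -/
def newFlux (u v : Fin n → ℝ) : Fin n → ℝ :=
  fun i => (R.Xx u * v i - R.Xt v * u i) / R.jac u v

/-- The new densities and fluxes are determined by the equality of 1-forms
`u^i dx + v^i dt = (new density)^i dX + (new flux)^i dT`. -/
theorem form_eq (u v : Fin n → ℝ) (h : R.jac u v ≠ 0) (i : Fin n) :
    u i = R.newDensity u v i * R.Xx u + R.newFlux u v i * R.Tx u ∧
    v i = R.newDensity u v i * R.Xt v + R.newFlux u v i * R.Tt v := by
  unfold newDensity newFlux
  constructor <;> field_simp <;> unfold jac <;> ring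

/-- The linear map of homogeneous coordinates `(y^1, …, y^n, y^{n+1}, y^{n+2})`
by which a reciprocal transformation acts. -/
def projMap : (Fin n ⊕ Fin 2 → ℝ) →ₗ[ℝ] (Fin n ⊕ Fin 2 → ℝ) :=
  Matrix.toLin' (Matrix.fromBlocks (1 : Matrix (Fin n) (Fin n) ℝ) 0
    (Matrix.of ![R.α, R.β]) !![R.a, R.b; R.c, R.d])

/-- The reciprocal transformation `R` takes the system `u_t = V(u)_x` on `U` to the system
with fluxes `V₁` on `U₁`: it is non-degenerate on `U`, the new densities are coordinates on `U`
with range `U₁`, and the new fluxes, as functions of the new densities, are `V₁`. -/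
structure Transforms (U : Set (Fin n → ℝ)) (V : (Fin n → ℝ) → (Fin n → ℝ))
    (U₁ : Set (Fin n → ℝ)) (V₁ : (Fin n → ℝ) → (Fin n → ℝ)) : Prop where
  jac_ne_zero : ∀ u ∈ U, R.jac u (V u) ≠ 0
  injOn : Set.InjOn (fun u => R.newDensity u (V u)) U
  regular : ∀ u ∈ U, (fderiv ℝ (fun w => R.newDensity w (V w)) u).det ≠ 0
  range_eq : U₁ = (fun u => R.newDensity u (V u)) '' U
  flux_eq : ∀ u ∈ U, V₁ (R.newDensity u (V u)) = R.newFlux u (V u)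

/-- The inversion `dX = dt`, `dT = dx`. -/
def inversion (n : ℕ) : Reciprocal n := ⟨0, 0, 0, 1, 1, 0⟩

end Reciprocal

/-- The line `y^i = u^i y^{n+1} + v^i y^{n+2}` in projective space, as a subspace. -/
def congruenceLine {n : ℕ} (u v : Fin n → ℝ) : Submodule ℝ (Fin n ⊕ Fin 2 → ℝ) where
  carrier := {y | ∀ i, y (Sum.inl i) = u i * y (Sum.inr 0) + v i * y (Sum.inr 1)}
  add_mem' := by
    intro y z hy hz i
    simp only [Pi.add_apply, hy i, hz i]
    ring
  zero_mem' := by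
    intro i
    simp
  smul_mem' := by
    intro r y hy i
    simp only [Pi.smul_apply, smul_eq_mul, hy i]
    ring

/-! ### The constants of a Hamiltonian system -/

/-- Constants `φ_{βγ}`, `ψ^γ_{km}`, `ω^γ_k`, `η^γ_k`, `ξ^γ`
(written `φ β γ`, `ψ γ k m`, `om γ k`, `η γ k`, `ξ γ`). -/
structure MongeData (n : ℕ) where
  φ : Matrix (Fin n) (Fin n) ℝ
  ψ : Fin n → Fin n → Fin n → ℝ
  om : Fin n → Fin n → ℝ
  η : Fin n → Fin n → ℝ
  ξ : Fin n → ℝ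

namespace MongeData

variable {n : ℕ} (D : MongeData n)

/-- The functions `ψ^γ_k(u) = ψ^γ_{km} u^m + ω^γ_k`. -/
def psi (γ k : Fin n) (u : Fin n → ℝ) : ℝ := ∑ m, D.ψ γ k m * u m + D.om γ k

/-- The constants `D` describe a system with fluxes `V` and metric `g` on `U`:
`g_{ij} = φ_{βγ} ψ^β_i ψ^γ_j` and `ψ^γ_k V^k = η^γ_m u^m + ξ^γ` on `U`, where `φ` is symmetric and
non-degenerate, `ψ^γ_{km}` is skew-symmetric, and the quadratic relations hold. -/
structure Describes (U : Set (Fin n → ℝ)) (V : (Fin n → ℝ) → (Fin n → ℝ))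
    (g : (Fin n → ℝ) → Matrix (Fin n) (Fin n) ℝ) : Prop where
  symm : D.φ.IsSymm
  nondegenerate : D.φ.det ≠ 0
  skew : ∀ γ k m, D.ψ γ k m = - D.ψ γ m k
  psi_psi : ∀ i j k s, ∑ β, ∑ γ, D.φ β γ *
    (D.ψ β i s * D.ψ γ j k + D.ψ β j s * D.ψ γ k i + D.ψ β k s * D.ψ γ i j) = 0
  omega_psi : ∀ i j k, ∑ β, ∑ γ, D.φ β γ *
    (D.om β i * D.ψ γ j k + D.om β j * D.ψ γ k i + D.om β k * D.ψ γ i j) = 0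
  psi_eta : ∀ i j k, ∑ β, ∑ γ, D.φ β γ *
    (D.ψ β i j * D.η γ k + D.ψ β j k * D.η γ i + D.ψ β k i * D.η γ j) = 0
  psi_xi : ∀ i k, ∑ β, ∑ γ, D.φ β γ *
    (D.ψ β i k * D.ξ γ + D.om β k * D.η γ i - D.om β i * D.η γ k) = 0
  metric_eq : ∀ u ∈ U, ∀ i j, g u i j = ∑ β, ∑ γ, D.φ β γ * D.psi β i u * D.psi γ j u
  flux_eq : ∀ u ∈ U, ∀ γ, ∑ k, D.psi γ k u * V u k = ∑ m, D.η γ m * u m + D.ξ γ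

/-- The constants with `ω` and `η` swapped and `ξ` replaced by `-ξ`. -/
def swap : MongeData n := ⟨D.φ, D.ψ, D.η, D.om, fun γ => - D.ξ γ⟩

end MongeData

/-- The Jacobian matrix `V^m_i = ∂V^m/∂u^i` (row `m`, column `i`). -/
def jacobianMatrix {n : ℕ} (V : (Fin n → ℝ) → (Fin n → ℝ)) (u : Fin n → ℝ) :
    Matrix (Fin n) (Fin n) ℝ :=
  LinearMap.toMatrix' ((fderiv ℝ V u : (Fin n → ℝ) →L[ℝ] (Fin n → ℝ)) :
    (Fin n → ℝ) →ₗ[ℝ] (Fin n → ℝ))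

end

open scoped ContDiff

noncomputable section

namespace ThirdOrder

open MeasureTheory Filter Topology Set

section

/-! ### Integrals over the line -/

/-! A third-order Hamiltonian system is encoded by finitely many constants, and in that encoding a
reciprocal transformation is a linear change of homogeneous coordinates in $\mathbb P^{n+1}$.

Write $P=\partial A\partial$ with $A=G\partial+c\,u_x$. Integrating by parts, skew-symmetry and the
Jacobi identity become integral identities for $A$. Testing them with bump functions, on constant
curves and on small perturbations of these, gives pointwise conditions: $G$ is symmetric and
$A\alpha=\nabla_x(G\alpha)$ for a connection $\nabla_w y=\partial_w y+h(y,w)$ that preserves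
$g=G^{-1}$; $h$ is skew and satisfies a cyclic identity; for constant $y,z$ the field $h(y,z)$ is
parallel. These conditions are also sufficient (`isFlatOp_of_isHamiltonianOp`,
`isHamiltonianOp_of_isFlatOp`).

For fixed $y,w$ the field $u\mapsto y+h_u(y,w-u)$ is then parallel. It equals $y$ at $w$ and
$y+h_v(y,w-v)$ at a base point $v$, so parallel transport from $w$ to $v$ is affine in $w$. Parallel
fields have constant inner products, whence $g_{ij}=\phi_{\beta\gamma}\psi^\beta_i\psi^\gamma_j$
with affine $\psi$ (`exists_flatFrame`).

If $u_t=P\,\delta H/\delta u$, then $\psi^\gamma_kV^k$ is, along each curve, the total derivative of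
an expression local in the potential $b$. Its integral does not change under compactly supported
perturbations of $b$. A function of $b_x$ with this property is affine (`exists_flux_affine`), which
gives $\eta,\xi$. The relations involving $\eta,\xi$ express the symmetry of the second variation of
$H$ (`eta_relation`). Conversely, constants with all these relations and an invertible metric
produce an operator and an explicit Hamiltonian (`isHamiltonianStructure_monge`).

The constants $\psi,\omega,\eta,\xi$ assemble into alternating forms $B^\gamma$ on $\mathbb R^{n+2}$
(`hatB`). The quadratic relations together say $\phi_{\beta\gamma}B^\beta\wedge B^\gamma=0$
(`hatB_cyclic`). The flux relation says that the plane spanned by $(u,1,0)$ and $(V,0,1)$, which is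
the line of the congruence, is isotropic for every $B^\gamma$ (`hatB_flux`). A reciprocal
transformation moves these planes by a fixed invertible linear map, so pulling back $B^\gamma$
carries constants of the new system to constants of the old one
(`isThirdOrderHamiltonian_of_transforms`); the inverse transformation gives the other direction.
Strict hyperbolicity is preserved because the eigenvalues undergo a Möbius transformation. The
inversion exchanges the last two coordinates, hence exchanges $\omega$ with $\eta$ and changes the
sign of $\xi$. Its metric formula comes from differentiating the flux relation
(`frame_fderiv_flux`). -/

theorem integral_eq_zero_of_hasDerivAt {f f' : ℝ → ℝ} (h : ∀ x, HasDerivAt f (f' x) x)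
    (hf : HasCompactSupport f) (hf' : Continuous f') : ∫ x, f' x = 0 := by
  have hd : f' = deriv f := funext fun x => (h x).deriv.symm
  have hc : HasCompactSupport f' := hd ▸ hf.deriv
  have hcont : Continuous f := continuous_iff_continuousAt.2 fun x => (h x).continuousAt
  exact integral_eq_zero_of_hasDerivAt_of_integrable h (hf'.integrable_of_hasCompactSupport hc)
    (hcont.integrable_of_hasCompactSupport hf)

theorem integral_mul_deriv_eq_neg {f g : ℝ → ℝ} (hf : ContDiff ℝ ∞ f) (hg : ContDiff ℝ ∞ g)
    (hc : HasCompactSupport f ∨ HasCompactSupport g) :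
    ∫ x, f x * deriv g x = -∫ x, deriv f x * g x := by
  have hf' : ContDiff ℝ ∞ (deriv f) := (contDiff_infty_iff_deriv.1 hf).2
  have hg' : ContDiff ℝ ∞ (deriv g) := (contDiff_infty_iff_deriv.1 hg).2
  have hd : ∀ x, HasDerivAt (fun x => f x * g x) (deriv f x * g x + f x * deriv g x) x := fun x =>
    ((hf.differentiable (by simp)) x).hasDerivAt.mul ((hg.differentiable (by simp)) x).hasDerivAt
  have c1 : HasCompactSupport fun x => deriv f x * g x := by
    rcases hc with hc | hc
    · exact hc.deriv.mul_right
    · exact hc.mul_left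
  have c2 : HasCompactSupport fun x => f x * deriv g x := by
    rcases hc with hc | hc
    · exact hc.mul_right
    · exact hc.deriv.mul_left
  have c3 : HasCompactSupport fun x => f x * g x := by
    rcases hc with hc | hc
    · exact hc.mul_right
    · exact hc.mul_left
  have i1 : Integrable (fun x => deriv f x * g x) := (hf'.continuous.mul hg.continuous).integrable_of_hasCompactSupport (μ := volume) c1
  have i2 : Integrable (fun x => f x * deriv g x) := (hf.continuous.mul hg'.continuous).integrable_of_hasCompactSupport (μ := volume) c2
  have := integral_eq_zero_of_hasDerivAt hd c3
    ((hf'.continuous.mul hg.continuous).add (hf.continuous.mul hg'.continuous))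
  rw [integral_add i1 i2] at this
  linarith

theorem integral_sq_pos {f : ℝ → ℝ} (hf : Continuous f) (hc : HasCompactSupport f) (h0 : f ≠ 0) :
    0 < ∫ x, f x * f x := by
  obtain ⟨x, hx⟩ := Function.ne_iff.1 h0
  exact (hf.mul hf).integral_pos_of_hasCompactSupport_nonneg_nonzero hc.mul_right
    (fun x => mul_self_nonneg _) (mul_self_ne_zero.2 hx)

theorem deriv_ne_zero_of_hasCompactSupport {f : ℝ → ℝ} (hf : Differentiable ℝ f)
    (hc : HasCompactSupport f) (h0 : f ≠ 0) : deriv f ≠ 0 := by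
  intro h
  apply h0
  have hconst := is_const_of_deriv_eq_zero hf (fun x => congrFun h x)
  obtain ⟨R, hR⟩ := hc.isCompact.isBounded.subset_closedBall 0
  funext x
  rw [hconst x (|R| + 1)]
  by_contra hne
  have := hR (subset_tsupport f hne)
  rw [Metric.mem_closedBall, dist_zero_right, Real.norm_eq_abs, abs_of_nonneg (by positivity)] at this
  linarith [le_abs_self R]

theorem exists_interval_of_hasCompactSupport {E : Type*} [Zero E] {f : ℝ → E}
    (hc : HasCompactSupport f) : ∃ R : ℝ, 0 < R ∧ ∀ x, R ≤ |x| → f x = 0 := by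
  obtain ⟨R, hR⟩ := hc.isCompact.isBounded.subset_closedBall 0
  refine ⟨|R| + 1, by positivity, fun x hx => ?_⟩
  by_contra hne
  have := hR (subset_tsupport f hne)
  rw [Metric.mem_closedBall, dist_zero_right, Real.norm_eq_abs] at this
  linarith [le_abs_self R]

theorem exists_bump : ∃ f : ℝ → ℝ, ContDiff ℝ ∞ f ∧ HasCompactSupport f ∧ f ≠ 0 := by
  obtain ⟨f, -, hc, hf, -, h1⟩ := exists_contDiff_tsupport_subset (n := ⊤)
    (univ_mem : (univ : Set ℝ) ∈ 𝓝 (0 : ℝ))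
  refine ⟨f, hf, hc, fun h => ?_⟩
  simp [h] at h1

/-- The plateau $|x|<R+1$ is open, so multiplication by $\chi$ preserves all derivatives at each of
its points, including those with $|x|=R$. -/
theorem exists_cutoff (R : ℝ) : ∃ χ : ℝ → ℝ, ContDiff ℝ ∞ χ ∧ HasCompactSupport χ ∧
    ∀ x, |x| < R + 1 → χ x = 1 := by
  let χ : ContDiffBump (0 : ℝ) := ⟨|R| + 1, |R| + 2, by positivity, by linarith⟩
  refine ⟨χ, χ.contDiff, χ.hasCompactSupport, fun x hx => ?_⟩
  apply χ.one_of_mem_closedBall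
  rw [Metric.mem_closedBall, dist_zero_right, Real.norm_eq_abs]
  show _ ≤ |R| + 1
  linarith [le_abs_self R]

/-- Smoothness is asked only at the point, since a perturbed curve $u+\varepsilon v$ may leave the
domain when $\varepsilon$ is not small. Schwarz's theorem is local. -/
theorem deriv_deriv_comm {F : ℝ × ℝ → ℝ} {a b : ℝ} (hF : ContDiffAt ℝ ∞ F (a, b)) :
    deriv (fun ε => deriv (fun y => F (ε, y)) b) a =
      deriv (fun y => deriv (fun ε => F (ε, y)) a) b := by
  have h2 : ContDiffAt ℝ 2 F (a, b) := hF.of_le ENat.LEInfty.out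
  have hsym : IsSymmSndFDerivAt ℝ F (a, b) := h2.isSymmSndFDerivAt (by simp)
  have hev : ∀ᶠ z in 𝓝 (a, b), DifferentiableAt ℝ F z := by
    filter_upwards [h2.eventually (by simp)] with z hz
    exact hz.differentiableAt (by simp)
  have hd : DifferentiableAt ℝ (fderiv ℝ F) (a, b) :=
    (h2.fderiv_right (m := 1) (by norm_num)).differentiableAt (by simp)
  have e1 : (fun ε => deriv (fun y => F (ε, y)) b) =ᶠ[𝓝 a] fun ε => fderiv ℝ F (ε, b) (0, 1) := by
    have : Tendsto (fun ε : ℝ => (ε, b)) (𝓝 a) (𝓝 (a, b)) :=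
      (Continuous.prodMk_left b).tendsto a
    filter_upwards [this.eventually hev] with ε hε
    exact (hε.hasFDerivAt.comp_hasDerivAt b
      ((hasDerivAt_const b ε).prodMk (hasDerivAt_id b))).deriv
  have e2 : (fun y => deriv (fun ε => F (ε, y)) a) =ᶠ[𝓝 b] fun y => fderiv ℝ F (a, y) (1, 0) := by
    have : Tendsto (fun y : ℝ => (a, y)) (𝓝 b) (𝓝 (a, b)) :=
      (Continuous.prodMk_right a).tendsto b
    filter_upwards [this.eventually hev] with y hy
    exact (hy.hasFDerivAt.comp_hasDerivAt a
      ((hasDerivAt_id a).prodMk (hasDerivAt_const a y))).deriv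
  rw [e1.deriv_eq, e2.deriv_eq]
  have d1 : HasDerivAt (fun ε => fderiv ℝ F (ε, b) (0, 1))
      (fderiv ℝ (fderiv ℝ F) (a, b) (1, 0) (0, 1)) a := by
    have := hd.hasFDerivAt.comp_hasDerivAt a ((hasDerivAt_id a).prodMk (hasDerivAt_const a b))
    simpa using this.clm_apply (hasDerivAt_const a ((0 : ℝ), (1 : ℝ)))
  have d2 : HasDerivAt (fun y => fderiv ℝ F (a, y) (1, 0))
      (fderiv ℝ (fderiv ℝ F) (a, b) (0, 1) (1, 0)) b := by
    have := hd.hasFDerivAt.comp_hasDerivAt b ((hasDerivAt_const b a).prodMk (hasDerivAt_id b))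
    simpa using this.clm_apply (hasDerivAt_const b ((1 : ℝ), (0 : ℝ)))
  rw [d1.deriv, d2.deriv]
  exact hsym _ _

theorem hasDerivAt_intervalIntegral {F F' : ℝ → ℝ → ℝ} (a b ε₀ : ℝ)
    (hF : Continuous fun z : ℝ × ℝ => F z.1 z.2) (hF' : Continuous fun z : ℝ × ℝ => F' z.1 z.2)
    (h : ∀ ε x, HasDerivAt (fun ε => F ε x) (F' ε x) ε) :
    HasDerivAt (fun ε => ∫ x in a..b, F ε x) (∫ x in a..b, F' ε₀ x) ε₀ := by
  have hK : IsCompact (Metric.closedBall ε₀ 1 ×ˢ uIcc a b) :=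
    (isCompact_closedBall _ _).prod isCompact_uIcc
  obtain ⟨C, hC⟩ := hK.exists_bound_of_continuousOn hF'.continuousOn
  have cF : ∀ ε, Continuous (F ε) := fun ε => hF.comp (Continuous.prodMk_right ε)
  have cF' : ∀ ε, Continuous (F' ε) := fun ε => hF'.comp (Continuous.prodMk_right ε)
  refine (intervalIntegral.hasDerivAt_integral_of_dominated_loc_of_deriv_le
    (s := Metric.closedBall ε₀ 1) (bound := fun _ => C) (Metric.closedBall_mem_nhds _ one_pos)
    (Eventually.of_forall fun ε => (cF ε).aestronglyMeasurable) ((cF ε₀).intervalIntegrable _ _)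
    (cF' ε₀).aestronglyMeasurable ?_ (by simp) ?_).2
  · exact Eventually.of_forall fun x hx ε hε => hC (ε, x) ⟨hε, uIoc_subset_uIcc hx⟩
  · exact Eventually.of_forall fun x _ ε _ => h ε x

theorem integral_eq_intervalIntegral {f : ℝ → ℝ} {R : ℝ} (hR : 0 < R)
    (hf : ∀ x, R ≤ |x| → f x = 0) : ∫ x, f x = ∫ x in (-R)..R, f x := by
  rw [intervalIntegral.integral_of_le (by linarith), setIntegral_eq_integral_of_forall_compl_eq_zero]
  intro x hx
  apply hf
  by_contra h
  push Not at h
  exact hx ⟨(abs_lt.1 h).1, (abs_lt.1 h).2.le⟩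

/-- For identities that carry a factor $\sin\varepsilon$: this factor can be divided out only when
$\varepsilon\ne0$, and the case $\varepsilon=0$ is recovered by continuity. The common support in
$[-R,R]$ makes the integral continuous in $\varepsilon$. -/
theorem integral_eq_zero_of_continuous_of_pos {F : ℝ → ℝ → ℝ} {R : ℝ} (hR : 0 < R)
    (hF : Continuous fun z : ℝ × ℝ => F z.1 z.2) (hs : ∀ ε x, R ≤ |x| → F ε x = 0)
    (h : ∀ ε, 0 < ε → ε < 1 → ∫ x, F ε x = 0) : ∫ x, F 0 x = 0 := by
  have hc : Continuous fun ε => ∫ x, F ε x := by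
    simp only [fun ε => integral_eq_intervalIntegral hR (hs ε)]
    exact intervalIntegral.continuous_parametric_intervalIntegral_of_continuous' hF _ _
  have h1 : Tendsto (fun ε => ∫ x, F ε x) (𝓝[>] 0) (𝓝 (∫ x, F 0 x)) :=
    (hc.tendsto 0).mono_left nhdsWithin_le_nhds
  have h2 : Tendsto (fun ε => ∫ x, F ε x) (𝓝[>] 0) (𝓝 0) := by
    apply tendsto_const_nhds.congr'
    filter_upwards [Ioo_mem_nhdsGT (zero_lt_one' ℝ)] with ε hε
    exact (h ε hε.1 hε.2).symm
  exact tendsto_nhds_unique h1 h2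

end

section

/-! ### The dot product and multilinear maps with given coefficients -/

/-- The dot product as a continuous bilinear form. -/
def dotL {n : ℕ} : (Fin n → ℝ) →L[ℝ] (Fin n → ℝ) →L[ℝ] ℝ :=
  ∑ i, (ContinuousLinearMap.proj (R := ℝ) (φ := fun _ : Fin n => ℝ) i).smulRight
    (ContinuousLinearMap.proj (R := ℝ) (φ := fun _ : Fin n => ℝ) i)

/-- The linear map with matrix `M`. -/
def linOf {n : ℕ} (M : Matrix (Fin n) (Fin n) ℝ) : (Fin n → ℝ) →L[ℝ] (Fin n → ℝ) :=
  ∑ i, ∑ j, M i j • (ContinuousLinearMap.proj (R := ℝ) (φ := fun _ : Fin n => ℝ) j).smulRight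
    (Pi.single i (1 : ℝ))

/-- The bilinear map `(y, z) ↦ (∑ j k, T r j k * y j * z k)_r`. -/
def bilOf {n : ℕ} (T : Fin n → Fin n → Fin n → ℝ) :
    (Fin n → ℝ) →L[ℝ] (Fin n → ℝ) →L[ℝ] (Fin n → ℝ) :=
  ∑ r, ∑ j, ∑ k, T r j k •
    (ContinuousLinearMap.proj (R := ℝ) (φ := fun _ : Fin n => ℝ) j).smulRight
      ((ContinuousLinearMap.proj (R := ℝ) (φ := fun _ : Fin n => ℝ) k).smulRight
        (Pi.single r (1 : ℝ)))

variable {n : ℕ}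

theorem dotL_apply (x y : Fin n → ℝ) : dotL x y = ∑ i, x i * y i := by
  simp [dotL]

theorem dotL_comm (x y : Fin n → ℝ) : dotL x y = dotL y x := by
  simp only [dotL_apply, mul_comm]

theorem dotL_single (i : Fin n) (y : Fin n → ℝ) : dotL (Pi.single i 1) y = y i := by
  simp [dotL_apply, Pi.single_apply]

theorem eq_of_dotL {x y : Fin n → ℝ} (h : ∀ z, dotL z x = dotL z y) : x = y := by
  funext i
  simpa only [dotL_single] using h (Pi.single i 1)

theorem linOf_apply (M : Matrix (Fin n) (Fin n) ℝ) (y : Fin n → ℝ) (i : Fin n) :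
    linOf M y i = ∑ j, M i j * y j := by
  simp [linOf, Finset.sum_apply, Pi.single_apply]

theorem bilOf_apply (T : Fin n → Fin n → Fin n → ℝ) (y z : Fin n → ℝ) (r : Fin n) :
    bilOf T y z r = ∑ j, ∑ k, T r j k * y j * z k := by
  simp [bilOf, Finset.sum_apply, Pi.single_apply, mul_assoc]

theorem contDiffOn_smul_const {E F : Type*} [NormedAddCommGroup E] [NormedSpace ℝ E]
    [NormedAddCommGroup F] [NormedSpace ℝ F] {U : Set E} {f : E → ℝ} (hf : ContDiffOn ℝ ∞ f U)
    (v : F) : ContDiffOn ℝ ∞ (fun u => f u • v) U :=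
  hf.smul contDiffOn_const

theorem contDiffOn_linOf {U : Set (Fin n → ℝ)} {M : (Fin n → ℝ) → Matrix (Fin n) (Fin n) ℝ}
    (h : ∀ i j, ContDiffOn ℝ ∞ (fun u => M u i j) U) :
    ContDiffOn ℝ ∞ (fun u => linOf (M u)) U := by
  unfold linOf
  exact ContDiffOn.sum fun i _ => ContDiffOn.sum fun j _ => (h i j).smul contDiffOn_const

theorem contDiffOn_bilOf {U : Set (Fin n → ℝ)} {T : (Fin n → ℝ) → Fin n → Fin n → Fin n → ℝ}
    (h : ∀ i j k, ContDiffOn ℝ ∞ (fun u => T u i j k) U) :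
    ContDiffOn ℝ ∞ (fun u => bilOf (T u)) U := by
  unfold bilOf
  exact ContDiffOn.sum fun i _ => ContDiffOn.sum fun j _ => ContDiffOn.sum fun k _ =>
    contDiffOn_smul_const (h i j k) _

/-! ### Operators along a curve -/

/-- The vector field `(G ∂ + c u_x) ∂ q` along the curve `u`. -/
def opFlux (G : (Fin n → ℝ) → (Fin n → ℝ) →L[ℝ] (Fin n → ℝ))
    (c : (Fin n → ℝ) → (Fin n → ℝ) →L[ℝ] (Fin n → ℝ) →L[ℝ] (Fin n → ℝ))
    (u α : ℝ → Fin n → ℝ) (x : ℝ) : Fin n → ℝ :=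
  G (u x) (deriv α x) + c (u x) (deriv u x) (α x)

/-- The last two indices of `c` trade places because the bilinear map takes $u_x$ before the
covector. -/
theorem thirdOrderOp_eq (G : (Fin n → ℝ) → Matrix (Fin n) (Fin n) ℝ)
    (c : (Fin n → ℝ) → Fin n → Fin n → Fin n → ℝ) (u q : ℝ → Fin n → ℝ) (x : ℝ) (i : Fin n) :
    thirdOrderOp G c u q x i = deriv (fun y => opFlux (fun u => linOf (G u))
      (fun u => bilOf fun i k j => c u i j k) u (deriv q) y i) x := by
  unfold thirdOrderOp opFlux
  congr 1
  funext y
  rw [Pi.add_apply, linOf_apply, bilOf_apply, Finset.sum_comm, ← Finset.sum_add_distrib]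
  simp only [Finset.sum_mul]

theorem contDiff_deriv {E : Type*} [NormedAddCommGroup E] [NormedSpace ℝ E] {f : ℝ → E}
    (hf : ContDiff ℝ ∞ f) : ContDiff ℝ ∞ (deriv f) := (contDiff_infty_iff_deriv.1 hf).2

theorem hasDerivAt_of_contDiff {E : Type*} [NormedAddCommGroup E] [NormedSpace ℝ E] {f : ℝ → E}
    (hf : ContDiff ℝ ∞ f) (x : ℝ) : HasDerivAt f (deriv f x) x :=
  ((hf.differentiable (by simp)) x).hasDerivAt

theorem contDiff_comp_curve {E : Type*} [NormedAddCommGroup E] [NormedSpace ℝ E]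
    {U : Set (Fin n → ℝ)} {g : (Fin n → ℝ) → E} {u : ℝ → Fin n → ℝ}
    (hg : ContDiffOn ℝ ∞ g U) (hu : IsCurveIn U u) : ContDiff ℝ ∞ fun x => g (u x) :=
  hg.comp_contDiff hu.1 hu.2

theorem hasFDerivAt_of_contDiffOn {E : Type*} [NormedAddCommGroup E] [NormedSpace ℝ E]
    {U : Set (Fin n → ℝ)} {g : (Fin n → ℝ) → E} (hU : IsOpen U)
    (hg : ContDiffOn ℝ ∞ g U) {u : Fin n → ℝ} (hu : u ∈ U) : HasFDerivAt g (fderiv ℝ g u) u :=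
  ((hg.contDiffAt (hU.mem_nhds hu)).differentiableAt (by simp)).hasFDerivAt

theorem hasDerivAt_add_smul {E F : Type*} [NormedAddCommGroup E] [NormedSpace ℝ E]
    [NormedAddCommGroup F] [NormedSpace ℝ F] {g : E → F} {g' : E →L[ℝ] F} {u : E}
    (hg : HasFDerivAt g g' u) (v : E) : HasDerivAt (fun ε : ℝ => g (u + ε • v)) (g' v) 0 := by
  have d0 : HasDerivAt (fun ε : ℝ => u + ε • v) v 0 := by
    simpa using ((hasDerivAt_id (0 : ℝ)).smul_const v).const_add u
  have e0 : u + (0 : ℝ) • v = u := by simp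
  rw [← e0] at hg
  exact hg.comp_hasDerivAt (0 : ℝ) d0

theorem contDiffOn_fderiv {E : Type*} [NormedAddCommGroup E] [NormedSpace ℝ E]
    {U : Set (Fin n → ℝ)} {g : (Fin n → ℝ) → E} (hU : IsOpen U)
    (hg : ContDiffOn ℝ ∞ g U) : ContDiffOn ℝ ∞ (fderiv ℝ g) U :=
  hg.fderiv_of_isOpen hU (by simp)

theorem hasDerivAt_comp_curve {E : Type*} [NormedAddCommGroup E] [NormedSpace ℝ E]
    {U : Set (Fin n → ℝ)} {g : (Fin n → ℝ) → E} {u : ℝ → Fin n → ℝ} (hU : IsOpen U)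
    (hg : ContDiffOn ℝ ∞ g U) (hu : IsCurveIn U u) (x : ℝ) :
    HasDerivAt (fun x => g (u x)) (fderiv ℝ g (u x) (deriv u x)) x :=
  (hasFDerivAt_of_contDiffOn hU hg (hu.2 x)).comp_hasDerivAt x (hasDerivAt_of_contDiff hu.1 x)

theorem isTestField_deriv {p : ℝ → Fin n → ℝ} (hp : IsTestField p) : IsTestField (deriv p) :=
  ⟨contDiff_deriv hp.1, hp.2.deriv⟩

theorem contDiff_opFlux {U : Set (Fin n → ℝ)}
    {G : (Fin n → ℝ) → (Fin n → ℝ) →L[ℝ] (Fin n → ℝ)}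
    {c : (Fin n → ℝ) → (Fin n → ℝ) →L[ℝ] (Fin n → ℝ) →L[ℝ] (Fin n → ℝ)}
    (hG : ContDiffOn ℝ ∞ G U) (hc : ContDiffOn ℝ ∞ c U) {u α : ℝ → Fin n → ℝ}
    (hu : IsCurveIn U u) (hα : ContDiff ℝ ∞ α) : ContDiff ℝ ∞ (opFlux G c u α) := by
  have h1 := contDiff_comp_curve hG hu
  have h2 := contDiff_comp_curve hc hu
  exact (h1.clm_apply (contDiff_deriv hα)).add
    ((h2.clm_apply (contDiff_deriv hu.1)).clm_apply hα)

theorem isTestField_opFlux {U : Set (Fin n → ℝ)}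
    {G : (Fin n → ℝ) → (Fin n → ℝ) →L[ℝ] (Fin n → ℝ)}
    {c : (Fin n → ℝ) → (Fin n → ℝ) →L[ℝ] (Fin n → ℝ) →L[ℝ] (Fin n → ℝ)}
    (hG : ContDiffOn ℝ ∞ G U) (hc : ContDiffOn ℝ ∞ c U) {u α : ℝ → Fin n → ℝ}
    (hu : IsCurveIn U u) (hα : IsTestField α) : IsTestField (opFlux G c u α) := by
  refine ⟨contDiff_opFlux hG hc hu hα.1, ?_⟩
  have h1 : HasCompactSupport fun x => G (u x) (deriv α x) :=
    hα.2.deriv.mono fun x hx h => hx (by simp [h])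
  have h2 : HasCompactSupport fun x => c (u x) (deriv u x) (α x) :=
    hα.2.mono fun x hx h => hx (by simp [h])
  exact h1.add h2

theorem integral_sum_mul_deriv {p K : ℝ → Fin n → ℝ} (hp : IsTestField p) (hK : ContDiff ℝ ∞ K) :
    ∫ x, ∑ i, p x i * deriv (fun y => K y i) x = -∫ x, dotL (deriv p x) (K x) := by
  have hpi : ∀ i, ContDiff ℝ ∞ fun x => p x i := contDiff_pi.1 hp.1
  have hKi : ∀ i, ContDiff ℝ ∞ fun x => K x i := contDiff_pi.1 hK
  have hci : ∀ i, HasCompactSupport fun x => p x i := fun i =>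
    hp.2.mono fun x hx h => hx (by simp [h])
  have hd : ∀ x i, deriv p x i = deriv (fun y => p y i) x := fun x i => by
    rw [deriv_pi fun i => ((hpi i).differentiable (by simp)) x]
  simp only [dotL_apply, hd]
  rw [integral_finsetSum, integral_finsetSum, ← Finset.sum_neg_distrib]
  · exact Finset.sum_congr rfl fun i _ => integral_mul_deriv_eq_neg (hpi i) (hKi i) (Or.inl (hci i))
  · exact fun i _ => ((contDiff_deriv (hpi i)).continuous.mul
      (hKi i).continuous).integrable_of_hasCompactSupport (hci i).deriv.mul_right
  · exact fun i _ => ((hpi i).continuous.mul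
      (contDiff_deriv (hKi i)).continuous).integrable_of_hasCompactSupport (hci i).mul_right

section

variable {U : Set (Fin n → ℝ)} {G : (Fin n → ℝ) → Matrix (Fin n) (Fin n) ℝ}
  {c : (Fin n → ℝ) → Fin n → Fin n → Fin n → ℝ}
  {G' : (Fin n → ℝ) → (Fin n → ℝ) →L[ℝ] (Fin n → ℝ)}
  {c' : (Fin n → ℝ) → (Fin n → ℝ) →L[ℝ] (Fin n → ℝ) →L[ℝ] (Fin n → ℝ)}

/-- The outer $\partial$ moves onto $p$. From here on only the inner first-order operator matters,
applied to derivatives of test fields. -/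
theorem integral_thirdOrderOp (eG : G' = fun u => linOf (G u))
    (ec : c' = fun u => bilOf fun i k j => c u i j k)
    (hG : ContDiffOn ℝ ∞ G' U) (hc : ContDiffOn ℝ ∞ c' U)
    {u p q : ℝ → Fin n → ℝ} (hu : IsCurveIn U u) (hp : IsTestField p) (hq : IsTestField q) :
    ∫ x, ∑ i, p x i * thirdOrderOp G c u q x i
      = -∫ x, dotL (deriv p x) (opFlux G' c' u (deriv q) x) := by
  simp only [thirdOrderOp_eq, ← eG, ← ec]
  exact integral_sum_mul_deriv hp (contDiff_opFlux hG hc hu (contDiff_deriv hq.1))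

theorem contDiffAt_perturbed (hU : IsOpen U) (hG : ContDiffOn ℝ ∞ G' U) (hc : ContDiffOn ℝ ∞ c' U)
    {u v α : ℝ → Fin n → ℝ} (hu : IsCurveIn U u) (hv : ContDiff ℝ ∞ v) (hα : ContDiff ℝ ∞ α)
    (x : ℝ) :
    ContDiffAt ℝ ∞ (fun z : ℝ × ℝ => G' (u z.2 + z.1 • v z.2) (deriv α z.2)
      + c' (u z.2 + z.1 • v z.2) (deriv u z.2 + z.1 • deriv v z.2) (α z.2)) (0, x) := by
  have hin : ContDiff ℝ ∞ fun z : ℝ × ℝ => u z.2 + z.1 • v z.2 :=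
    (hu.1.comp contDiff_snd).add (contDiff_fst.smul (hv.comp contDiff_snd))
  have hx : u x + (0 : ℝ) • v x ∈ U := by simpa using hu.2 x
  have gG : ContDiffAt ℝ ∞ G' (u x + (0 : ℝ) • v x) := hG.contDiffAt (hU.mem_nhds hx)
  have gc : ContDiffAt ℝ ∞ c' (u x + (0 : ℝ) • v x) := hc.contDiffAt (hU.mem_nhds hx)
  have g1 : ContDiffAt ℝ ∞ (fun z : ℝ × ℝ => G' (u z.2 + z.1 • v z.2)) (0, x) :=
    gG.comp ((0 : ℝ), x) (f := fun z : ℝ × ℝ => u z.2 + z.1 • v z.2) hin.contDiffAt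
  have g2 : ContDiffAt ℝ ∞ (fun z : ℝ × ℝ => c' (u z.2 + z.1 • v z.2)) (0, x) :=
    gc.comp ((0 : ℝ), x) (f := fun z : ℝ × ℝ => u z.2 + z.1 • v z.2) hin.contDiffAt
  have k1 : ContDiff ℝ ∞ fun z : ℝ × ℝ => deriv α z.2 := (contDiff_deriv hα).comp contDiff_snd
  have k2 : ContDiff ℝ ∞ fun z : ℝ × ℝ => α z.2 := hα.comp contDiff_snd
  have k3 : ContDiff ℝ ∞ fun z : ℝ × ℝ => deriv u z.2 + z.1 • deriv v z.2 :=
    ((contDiff_deriv hu.1).comp contDiff_snd).add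
      (contDiff_fst.smul ((contDiff_deriv hv).comp contDiff_snd))
  exact (g1.clm_apply k1.contDiffAt).add ((g2.clm_apply k3.contDiffAt).clm_apply k2.contDiffAt)

theorem hasDerivAt_perturbed (hU : IsOpen U) (hG : ContDiffOn ℝ ∞ G' U) (hc : ContDiffOn ℝ ∞ c' U)
    {u : Fin n → ℝ} (hu : u ∈ U) (v w v' α α' : Fin n → ℝ) :
    HasDerivAt (fun ε : ℝ => G' (u + ε • v) α' + c' (u + ε • v) (w + ε • v') α)
      (fderiv ℝ G' u v α' + (fderiv ℝ c' u v w α + c' u v' α)) 0 := by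
  have d0 : HasDerivAt (fun ε : ℝ => u + ε • v) v 0 := by
    simpa using ((hasDerivAt_id (0 : ℝ)).smul_const v).const_add u
  have d1 : HasDerivAt (fun ε : ℝ => w + ε • v') v' 0 := by
    simpa using ((hasDerivAt_id (0 : ℝ)).smul_const v').const_add w
  have dG := hasDerivAt_add_smul (hasFDerivAt_of_contDiffOn hU hG hu) v
  have dc := hasDerivAt_add_smul (hasFDerivAt_of_contDiffOn hU hc hu) v
  have h1 := dG.clm_apply (hasDerivAt_const (0 : ℝ) α')
  have h2 := (dc.clm_apply d1).clm_apply (hasDerivAt_const (0 : ℝ) α)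
  simpa using h1.fun_add h2

/-- The $\varepsilon$-derivative is exchanged with the outer $\partial_x$ and evaluated by the
product rule with $v=Pq$, which also perturbs $u_x$ by $v_x$. Then $\partial_x$ moves onto $p$. -/
theorem schoutenTerm_eq (hU : IsOpen U) (eG : G' = fun u => linOf (G u))
    (ec : c' = fun u => bilOf fun i k j => c u i j k)
    (hG : ContDiffOn ℝ ∞ G' U) (hc : ContDiffOn ℝ ∞ c' U)
    {u p q r : ℝ → Fin n → ℝ} (hu : IsCurveIn U u) (hp : IsTestField p) (hq : IsTestField q)
    (hr : IsTestField r) :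
    schoutenTerm G c u p q r = -∫ x, dotL (deriv p x)
      (fderiv ℝ G' (u x) (deriv (opFlux G' c' u (deriv q)) x) (deriv (deriv r) x)
        + (fderiv ℝ c' (u x) (deriv (opFlux G' c' u (deriv q)) x) (deriv u x) (deriv r x)
        + c' (u x) (deriv (deriv (opFlux G' c' u (deriv q))) x) (deriv r x))) := by
  have hB := (isTestField_opFlux hG hc hu (isTestField_deriv hq))
  obtain ⟨v, hv⟩ : ∃ v, v = deriv (opFlux G' c' u (deriv q)) := ⟨_, rfl⟩
  rw [← hv]
  have hvs : ContDiff ℝ ∞ v := hv ▸ contDiff_deriv hB.1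
  have hop : ∀ y, thirdOrderOp G c u q y = v y := fun y => by
    funext i
    rw [thirdOrderOp_eq, ← eG, ← ec, hv, deriv_pi]
    exact fun i => ((contDiff_pi.1 hB.1 i).differentiable (by simp)) y
  obtain ⟨M, hMdef⟩ : ∃ M : ℝ × ℝ → Fin n → ℝ, M = fun z =>
    G' (u z.2 + z.1 • v z.2) (deriv (deriv r) z.2)
      + c' (u z.2 + z.1 • v z.2) (deriv u z.2 + z.1 • deriv v z.2) (deriv r z.2) := ⟨_, rfl⟩
  have hM : ∀ x, ContDiffAt ℝ ∞ M (0, x) := fun x =>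
    hMdef ▸ contDiffAt_perturbed hU hG hc hu hvs (contDiff_deriv hr.1) x
  have hflux : ∀ ε y, opFlux G' c' (fun y => u y + ε • v y) (deriv r) y = M (ε, y) := fun ε y => by
    have : deriv (fun y => u y + ε • v y) y = deriv u y + ε • deriv v y :=
      ((hasDerivAt_of_contDiff hu.1 y).add ((hasDerivAt_of_contDiff hvs y).const_smul ε)).deriv
    simp only [opFlux, hMdef, this]
  have hMd : ∀ y, HasDerivAt (fun ε => M (ε, y)) (fderiv ℝ G' (u y) (v y) (deriv (deriv r) y)
        + (fderiv ℝ c' (u y) (v y) (deriv u y) (deriv r y) + c' (u y) (deriv v y) (deriv r y)))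
        0 := fun y => by
    simpa only [hMdef] using hasDerivAt_perturbed hU hG hc (hu.2 y) (v y) (deriv u y) (deriv v y)
      (deriv r y) (deriv (deriv r) y)
  have hterm : ∀ x i, deriv (fun ε : ℝ => thirdOrderOp G c
      (fun y => u y + ε • thirdOrderOp G c u q y) r x i) 0 =
      deriv (fun y => (fderiv ℝ G' (u y) (v y) (deriv (deriv r) y)
        + (fderiv ℝ c' (u y) (v y) (deriv u y) (deriv r y)
          + c' (u y) (deriv v y) (deriv r y))) i) x := fun x i => by
    have e1 : (fun ε : ℝ => thirdOrderOp G c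
        (fun y => u y + ε • thirdOrderOp G c u q y) r x i) =
        fun ε => deriv (fun y => M (ε, y) i) x := by
      funext ε
      have : (fun y => u y + ε • thirdOrderOp G c u q y) = fun y => u y + ε • v y := by
        funext y
        rw [hop y]
      rw [this, thirdOrderOp_eq, ← eG, ← ec]
      simp only [hflux]
    rw [e1, deriv_deriv_comm (F := fun z => M z i) (contDiffAt_pi.1 (hM x) i)]
    congr 1
    funext y
    exact (hasDerivAt_pi.1 (hMd y) i).deriv
  unfold schoutenTerm
  simp only [hterm]
  apply integral_sum_mul_deriv hp
  have s1 := contDiff_comp_curve (contDiffOn_fderiv hU hG) hu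
  have s2 := contDiff_comp_curve (contDiffOn_fderiv hU hc) hu
  have s3 := contDiff_comp_curve hc hu
  exact ((s1.clm_apply hvs).clm_apply (contDiff_deriv (contDiff_deriv hr.1))).add
    ((((s2.clm_apply hvs).clm_apply (contDiff_deriv hu.1)).clm_apply (contDiff_deriv hr.1)).add
      ((s3.clm_apply (contDiff_deriv hvs)).clm_apply (contDiff_deriv hr.1)))

end

end

/-! ### The Schouten bracket in terms of a metric connection. -/

section

theorem hasDerivAt_dotL {n : ℕ} {a b : ℝ → Fin n → ℝ} {a' b' : Fin n → ℝ} {x : ℝ}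
    (ha : HasDerivAt a a' x) (hb : HasDerivAt b b' x) :
    HasDerivAt (fun x => dotL (a x) (b x)) (dotL a' (b x) + dotL (a x) b') x := by
  have h1 : HasDerivAt (fun x => ThirdOrder.dotL (a x)) (ThirdOrder.dotL a') x :=
    (ThirdOrder.dotL (n := n)).hasFDerivAt.comp_hasDerivAt x ha
  simpa using h1.clm_apply hb

theorem hasDerivAt_dotL_const {n : ℕ} (a : Fin n → ℝ) {b : ℝ → Fin n → ℝ} {b' : Fin n → ℝ}
    {x : ℝ} (hb : HasDerivAt b b' x) :
    HasDerivAt (fun x => ThirdOrder.dotL a (b x)) (ThirdOrder.dotL a b') x :=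
  (ThirdOrder.dotL a).hasFDerivAt.comp_hasDerivAt x hb

theorem contDiff_dotL {n : ℕ} {F : Type*} [NormedAddCommGroup F] [NormedSpace ℝ F] {a b : F → Fin n → ℝ}
    (ha : ContDiff ℝ ∞ a) (hb : ContDiff ℝ ∞ b) : ContDiff ℝ ∞ fun x => dotL (a x) (b x) :=
  ((dotL (n := n)).contDiff.comp ha).clm_apply hb

theorem integral_add_add {f g k : ℝ → ℝ} (hf : Integrable f) (hg : Integrable g)
    (hk : Integrable k) : ∫ x, (f x + g x + k x) = (∫ x, f x) + (∫ x, g x) + ∫ x, k x := by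
  rw [← integral_add hf hg]
  exact integral_add (hf.add hg) hk

/-- The operator `G ∂ + c u_x` is `G ∘ ∇` for the connection with symbols `h` on covectors,
which preserves the symmetric form `G`. -/
structure IsMetricOp {n : ℕ} (U : Set (Fin n → ℝ))
    (G : (Fin n → ℝ) → (Fin n → ℝ) →L[ℝ] (Fin n → ℝ))
    (c h : (Fin n → ℝ) → (Fin n → ℝ) →L[ℝ] (Fin n → ℝ) →L[ℝ] (Fin n → ℝ)) : Prop where
  isOpen : IsOpen U
  smooth_G : ContDiffOn ℝ ∞ G U
  smooth_c : ContDiffOn ℝ ∞ c U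
  smooth_h : ContDiffOn ℝ ∞ h U
  symm : ∀ u ∈ U, ∀ α γ, dotL α (G u γ) = dotL γ (G u α)
  rel : ∀ u ∈ U, ∀ α γ w, dotL α (c u w γ) = - dotL γ (h u (G u α) w)
  compat : ∀ u ∈ U, ∀ v α, fderiv ℝ G u v α = c u v α - h u (G u α) v

/-- The derivative of the torsion `h` of the connection with symbols `h`, up to sign. -/
def curv {n : ℕ} (h : (Fin n → ℝ) → (Fin n → ℝ) →L[ℝ] (Fin n → ℝ) →L[ℝ] (Fin n → ℝ))
    (u l y z : Fin n → ℝ) : Fin n → ℝ :=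
  fderiv ℝ h u l y z + h u (h u y z) l

/-- The cyclic term of the Schouten bracket, up to total derivatives, in invariant form. -/
def schoutenDensity {n : ℕ} (G : (Fin n → ℝ) → (Fin n → ℝ) →L[ℝ] (Fin n → ℝ))
    (c h : (Fin n → ℝ) → (Fin n → ℝ) →L[ℝ] (Fin n → ℝ) →L[ℝ] (Fin n → ℝ))
    (u α β γ : ℝ → Fin n → ℝ) (x : ℝ) : ℝ :=
  dotL (α x) (h (u x) (opFlux G c u γ x) (deriv (opFlux G c u β) x))
    - dotL (γ x) (h (u x) (opFlux G c u α x) (deriv (opFlux G c u β) x))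
    + dotL (γ x) (curv h (u x) (deriv (opFlux G c u β) x) (G (u x) (α x)) (deriv u x)
      - curv h (u x) (deriv u x) (G (u x) (α x)) (deriv (opFlux G c u β) x))

/-- The curvature part of the cyclic term of the Schouten bracket; `w` stands for `u_x`. -/
def curvDensity {n : ℕ} (G : (Fin n → ℝ) → (Fin n → ℝ) →L[ℝ] (Fin n → ℝ))
    (c h : (Fin n → ℝ) → (Fin n → ℝ) →L[ℝ] (Fin n → ℝ) →L[ℝ] (Fin n → ℝ))
    (u α β γ : ℝ → Fin n → ℝ) (w : Fin n → ℝ) (x : ℝ) : ℝ :=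
  dotL (α x) (curv h (u x) w (opFlux G c u β x) (opFlux G c u γ x))
    + dotL (γ x) (curv h (u x) (deriv (opFlux G c u β) x) (G (u x) (α x)) w
      - curv h (u x) w (G (u x) (α x)) (deriv (opFlux G c u β) x))

variable {n : ℕ} {U : Set (Fin n → ℝ)}
  {G : (Fin n → ℝ) → (Fin n → ℝ) →L[ℝ] (Fin n → ℝ)}
  {c h : (Fin n → ℝ) → (Fin n → ℝ) →L[ℝ] (Fin n → ℝ) →L[ℝ] (Fin n → ℝ)}

namespace IsMetricOp

variable (H : IsMetricOp U G c h)
include H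

/-- Represent $y\mapsto\gamma\cdot h(y,w)$ by a covector $\lambda$. Symmetry of $G$ and `rel` give
$G\lambda=-c(w,\gamma)$, and a second use of `rel`, now for $\lambda$, produces the exchange. -/
theorem rel' {u : Fin n → ℝ} (hu : u ∈ U) (α γ v w : Fin n → ℝ) :
    dotL γ (h u (c u v α) w) = dotL α (h u (c u w γ) v) := by
  let lam : Fin n → ℝ := fun i => dotL γ (h u (Pi.single i 1) w)
  have hlam : ∀ y, dotL lam y = dotL γ (h u y w) := fun y => by
    have hy : y = ∑ i, y i • (Pi.single i (1 : ℝ) : Fin n → ℝ) := by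
      funext j
      simp [Finset.sum_apply, Pi.single_apply]
    conv_rhs => rw [hy]
    simp only [map_sum, map_smul, sum_apply, smul_apply,
      dotL_apply lam, lam, smul_eq_mul]
    exact Finset.sum_congr rfl fun i _ => mul_comm _ _
  have hG : G u lam = - c u w γ := by
    apply eq_of_dotL
    intro z
    rw [H.symm u hu, hlam, map_neg, H.rel u hu, neg_neg]
  rw [← hlam, H.rel u hu, hG]
  simp

theorem fderiv_rel {u : Fin n → ℝ} (hu : u ∈ U) (α γ v w : Fin n → ℝ) :
    dotL α (fderiv ℝ c u v w γ)
      = - dotL γ (fderiv ℝ h u v (G u α) w) - dotL γ (h u (fderiv ℝ G u v α) w) := by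
  have dG := hasDerivAt_add_smul (hasFDerivAt_of_contDiffOn H.isOpen H.smooth_G hu) v
  have dc := hasDerivAt_add_smul (hasFDerivAt_of_contDiffOn H.isOpen H.smooth_c hu) v
  have dh := hasDerivAt_add_smul (hasFDerivAt_of_contDiffOn H.isOpen H.smooth_h hu) v
  have h1 : HasDerivAt (fun ε : ℝ => dotL α (c (u + ε • v) w γ)) (dotL α (fderiv ℝ c u v w γ)) 0 := by
    have := (dc.clm_apply (hasDerivAt_const (0 : ℝ) w)).clm_apply (hasDerivAt_const (0 : ℝ) γ)
    simpa using hasDerivAt_dotL_const α this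
  have h2 : HasDerivAt (fun ε : ℝ => dotL γ (h (u + ε • v) (G (u + ε • v) α) w))
      (dotL γ (fderiv ℝ h u v (G u α) w) + dotL γ (h u (fderiv ℝ G u v α) w)) 0 := by
    have := (dh.clm_apply (dG.clm_apply (hasDerivAt_const (0 : ℝ) α))).clm_apply
      (hasDerivAt_const (0 : ℝ) w)
    simpa using hasDerivAt_dotL_const γ this
  have hev : (fun ε : ℝ => dotL α (c (u + ε • v) w γ)) =ᶠ[𝓝 0]
      fun ε : ℝ => - dotL γ (h (u + ε • v) (G (u + ε • v) α) w) := by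
    have ht : Tendsto (fun ε : ℝ => u + ε • v) (𝓝 0) (𝓝 u) := by
      have : Continuous fun ε : ℝ => u + ε • v := by fun_prop
      simpa using this.tendsto 0
    filter_upwards [ht.eventually (H.isOpen.mem_nhds hu)] with ε hε
    exact H.rel _ hε _ _ _
  have := h1.unique (h2.neg.congr_of_eventuallyEq hev)
  linarith

/-- Here `rel` and `compat` eliminate the derivatives of $c$ in favour of $h$. Read with primes as
$x$-derivatives and $w=u_x$, the first bracket on the right is the derivative of $\gamma\cdot
h(G\alpha,v)$, which integrates to zero; the rest is `schoutenDensity`. -/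
theorem schouten_pointwise {u : Fin n → ℝ} (hu : u ∈ U) (α α' γ γ' v v' w : Fin n → ℝ) :
    dotL α (fderiv ℝ G u v γ' + (fderiv ℝ c u v w γ + c u v' γ)) =
      - (dotL γ' (h u (G u α) v) + dotL γ (fderiv ℝ h u w (G u α) v
        + h u (fderiv ℝ G u w α + G u α') v + h u (G u α) v'))
      - (dotL α (h u (G u γ' + c u w γ) v) - dotL γ (h u (G u α' + c u w α) v)
        + dotL γ (curv h u v (G u α) w - curv h u w (G u α) v)) := by
  have e1 := H.fderiv_rel hu α γ v w
  have e2 := H.rel u hu α γ' v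
  have e3 := H.rel u hu α γ v'
  have e4 := H.rel' hu α γ v w
  simp only [H.compat u hu, curv, map_add, map_sub, add_apply, sub_apply] at *
  linarith

/-- The torsion terms of the cyclic sum are exact up to curvature: they differ from minus the
derivative of $\alpha\cdot h(B,C)+\beta\cdot h(C,A)+\gamma\cdot h(A,B)$ only by `curv` terms. The
cyclic identity removes the contribution of the covariant derivatives of $\alpha,\beta,\gamma$. -/
theorem schoutenDensity_sum (hanti : ∀ u ∈ U, ∀ y z, h u y z = - h u z y)
    (hsurj : ∀ u ∈ U, Function.Surjective (G u))
    (hcyc : ∀ u ∈ U, ∀ l m k, dotL l (h u (G u m) (G u k)) + dotL m (h u (G u k) (G u l))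
      + dotL k (h u (G u l) (G u m)) = 0)
    {u : Fin n → ℝ} (hu : u ∈ U) (α α' β β' γ γ' w A B C A' B' C' : Fin n → ℝ)
    (hA : A = G u α' + c u w α) (hB : B = G u β' + c u w β) (hC : C = G u γ' + c u w γ) :
    (dotL α (h u C B') - dotL γ (h u A B')) + (dotL β (h u A C') - dotL α (h u B C'))
      + (dotL γ (h u B A') - dotL β (h u C A')) =
    dotL α (curv h u w B C) + dotL β (curv h u w C A) + dotL γ (curv h u w A B)
    - ((dotL α' (h u B C) + dotL α (fderiv ℝ h u w B C + h u B' C + h u B C'))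
      + (dotL β' (h u C A) + dotL β (fderiv ℝ h u w C A + h u C' A + h u C A'))
      + (dotL γ' (h u A B) + dotL γ (fderiv ℝ h u w A B + h u A' B + h u A B'))) := by
  -- The covector `l` with $Gl=A\alpha$ is the covariant derivative of $\alpha$, and the term in $h$
  -- is the difference from the ordinary derivative.
  have key : ∀ X α α' y, X = G u α' + c u w α → ∀ l, G u l = X →
      dotL α' y = dotL l y + dotL α (h u y w) := by
    intro X α α' y hX l hl
    obtain ⟨η, rfl⟩ := hsurj u hu y
    have h1 := H.symm u hu α' η
    have h2 := H.symm u hu l η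
    have h3 := H.rel u hu η α w
    have h4 : dotL η X = dotL η (G u α') + dotL η (c u w α) := by rw [hX, map_add]
    rw [hl] at h2
    linarith
  obtain ⟨l, hl⟩ := hsurj u hu A
  obtain ⟨m, hm⟩ := hsurj u hu B
  obtain ⟨k, hk⟩ := hsurj u hu C
  have ka := key A α α' (h u B C) hA l hl
  have kb := key B β β' (h u C A) hB m hm
  have kc := key C γ γ' (h u A B) hC k hk
  have hcy := hcyc u hu l m k
  rw [hl, hm, hk] at hcy
  rw [hanti u hu C B', hanti u hu A C', hanti u hu B A']
  simp only [curv, map_add, map_neg] at *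
  linarith

theorem contDiff_curv {F : Type*} [NormedAddCommGroup F] [NormedSpace ℝ F]
    {u l y z : F → Fin n → ℝ} (hu : ContDiff ℝ ∞ u) (huU : ∀ x, u x ∈ U) (hl : ContDiff ℝ ∞ l)
    (hy : ContDiff ℝ ∞ y) (hz : ContDiff ℝ ∞ z) :
    ContDiff ℝ ∞ fun x => curv h (u x) (l x) (y x) (z x) := by
  have sh : ContDiff ℝ ∞ fun x => h (u x) := H.smooth_h.comp_contDiff hu huU
  have sh' := (contDiffOn_fderiv H.isOpen H.smooth_h).comp_contDiff hu huU
  exact (((sh'.clm_apply hl).clm_apply hy).clm_apply hz).add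
    ((sh.clm_apply ((sh.clm_apply hy).clm_apply hz)).clm_apply hl)

theorem isTestFun_schoutenDensity {u α β γ : ℝ → Fin n → ℝ} (hu : IsCurveIn U u)
    (hα : IsTestField α) (hβ : IsTestField β) (hγ : IsTestField γ) :
    ContDiff ℝ ∞ (schoutenDensity G c h u α β γ) ∧
      HasCompactSupport (schoutenDensity G c h u α β γ) := by
  have hv := isTestField_deriv (isTestField_opFlux H.smooth_G H.smooth_c hu hβ)
  have sG := contDiff_comp_curve H.smooth_G hu
  have sh := contDiff_comp_curve H.smooth_h hu
  have sA := contDiff_opFlux H.smooth_G H.smooth_c hu hα.1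
  have sC := contDiff_opFlux H.smooth_G H.smooth_c hu hγ.1
  have su := contDiff_deriv hu.1
  have sa := sG.clm_apply hα.1
  constructor
  · exact ((contDiff_dotL hα.1 ((sh.clm_apply sC).clm_apply hv.1)).sub
      (contDiff_dotL hγ.1 ((sh.clm_apply sA).clm_apply hv.1))).add
      (contDiff_dotL hγ.1 ((H.contDiff_curv hu.1 hu.2 hv.1 sa su).sub
        (H.contDiff_curv hu.1 hu.2 su sa hv.1)))
  · refine hv.2.mono fun x hx h => hx ?_
    simp [schoutenDensity, h, curv]

/-- The total derivative split off in `schouten_pointwise` has compact support because $\gamma$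
does, so its integral vanishes. -/
theorem integral_schouten {u α β γ : ℝ → Fin n → ℝ} (hu : IsCurveIn U u) (hα : IsTestField α)
    (hβ : IsTestField β) (hγ : IsTestField γ) :
    -∫ x, dotL (α x) (fderiv ℝ G (u x) (deriv (opFlux G c u β) x) (deriv γ x)
        + (fderiv ℝ c (u x) (deriv (opFlux G c u β) x) (deriv u x) (γ x)
        + c (u x) (deriv (deriv (opFlux G c u β)) x) (γ x)))
      = ∫ x, schoutenDensity G c h u α β γ x := by
  have hB := isTestField_opFlux H.smooth_G H.smooth_c hu hβ
  obtain ⟨v, hv⟩ : ∃ v, v = deriv (opFlux G c u β) := ⟨_, rfl⟩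
  have hvs : IsTestField v := hv ▸ isTestField_deriv hB
  rw [← hv]
  have sG := contDiff_comp_curve H.smooth_G hu
  have sh := contDiff_comp_curve H.smooth_h hu
  have sG' := contDiff_comp_curve (contDiffOn_fderiv H.isOpen H.smooth_G) hu
  have sh' := contDiff_comp_curve (contDiffOn_fderiv H.isOpen H.smooth_h) hu
  have su := contDiff_deriv hu.1
  let D : ℝ → ℝ := fun x => dotL (deriv γ x) (h (u x) (G (u x) (α x)) (v x))
    + dotL (γ x) (fderiv ℝ h (u x) (deriv u x) (G (u x) (α x)) (v x)
      + h (u x) (fderiv ℝ G (u x) (deriv u x) (α x) + G (u x) (deriv α x)) (v x)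
      + h (u x) (G (u x) (α x)) (deriv v x))
  have sa : ContDiff ℝ ∞ fun x => G (u x) (α x) := sG.clm_apply hα.1
  have hD : ∀ x, HasDerivAt (fun x => dotL (γ x) (h (u x) (G (u x) (α x)) (v x))) (D x) x := by
    intro x
    have d1 := ((hasDerivAt_comp_curve H.isOpen H.smooth_h hu x).clm_apply
      ((hasDerivAt_comp_curve H.isOpen H.smooth_G hu x).clm_apply
        (hasDerivAt_of_contDiff hα.1 x))).clm_apply (hasDerivAt_of_contDiff hvs.1 x)
    exact hasDerivAt_dotL (hasDerivAt_of_contDiff hγ.1 x) d1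
  have hDc : Continuous D := by
    have k1 := contDiff_dotL (contDiff_deriv hγ.1) ((sh.clm_apply sa).clm_apply hvs.1)
    have k2 := contDiff_dotL hγ.1 (((((sh'.clm_apply su).clm_apply sa).clm_apply hvs.1).add
      ((sh.clm_apply (((sG'.clm_apply su).clm_apply hα.1).add
        (sG.clm_apply (contDiff_deriv hα.1)))).clm_apply hvs.1)).add
        ((sh.clm_apply sa).clm_apply (contDiff_deriv hvs.1)))
    exact (k1.add k2).continuous
  have hW : HasCompactSupport (fun x => dotL (γ x) (h (u x) (G (u x) (α x)) (v x))) :=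
    hγ.2.mono fun x hx h => hx (by simp [h])
  have hDs : HasCompactSupport D := by
    have : D = deriv (fun x => dotL (γ x) (h (u x) (G (u x) (α x)) (v x))) :=
      funext fun x => (hD x).deriv.symm
    exact this ▸ hW.deriv
  have hJ := H.isTestFun_schoutenDensity hu hα hβ hγ
  have i1 := hDc.integrable_of_hasCompactSupport (μ := volume) hDs
  have i2 := hJ.1.continuous.integrable_of_hasCompactSupport (μ := volume) hJ.2
  have hsum := integral_eq_zero_of_hasDerivAt hD hW hDc
  have hpt : ∀ x, dotL (α x) (fderiv ℝ G (u x) (v x) (deriv γ x)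
        + (fderiv ℝ c (u x) (v x) (deriv u x) (γ x) + c (u x) (deriv v x) (γ x)))
      = -(D x + schoutenDensity G c h u α β γ x) := fun x => by
    rw [H.schouten_pointwise (hu.2 x) (α x) (deriv α x) (γ x) (deriv γ x) (v x) (deriv v x)
      (deriv u x)]
    simp only [D, schoutenDensity, ← hv, opFlux]
    ring
  simp only [hpt]
  rw [integral_neg, neg_neg, integral_add i1 i2, hsum, zero_add]

theorem integral_schoutenDensity_sum (hanti : ∀ u ∈ U, ∀ y z, h u y z = - h u z y)
    (hsurj : ∀ u ∈ U, Function.Surjective (G u))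
    (hcyc : ∀ u ∈ U, ∀ l m k, dotL l (h u (G u m) (G u k)) + dotL m (h u (G u k) (G u l))
      + dotL k (h u (G u l) (G u m)) = 0)
    {u α β γ : ℝ → Fin n → ℝ} (hu : IsCurveIn U u) (hα : IsTestField α)
    (hβ : IsTestField β) (hγ : IsTestField γ) :
    (∫ x, schoutenDensity G c h u α β γ x) + (∫ x, schoutenDensity G c h u β γ α x)
      + (∫ x, schoutenDensity G c h u γ α β x) =
    ∫ x, (curvDensity G c h u α β γ (deriv u x) x + curvDensity G c h u β γ α (deriv u x) x
      + curvDensity G c h u γ α β (deriv u x) x) := by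
  have hA := isTestField_opFlux H.smooth_G H.smooth_c hu hα
  have hB := isTestField_opFlux H.smooth_G H.smooth_c hu hβ
  have hC := isTestField_opFlux H.smooth_G H.smooth_c hu hγ
  have sh := contDiff_comp_curve H.smooth_h hu
  have key : ∀ {α B C : ℝ → Fin n → ℝ}, IsTestField α → IsTestField B → IsTestField C →
      ∃ D : ℝ → ℝ, (∀ x, D x = dotL (deriv α x) (h (u x) (B x) (C x)) + dotL (α x)
        (fderiv ℝ h (u x) (deriv u x) (B x) (C x) + h (u x) (deriv B x) (C x)
          + h (u x) (B x) (deriv C x))) ∧ Integrable D ∧ ∫ x, D x = 0 := by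
    intro α B C hα hB hC
    have hs : ContDiff ℝ ∞ fun x => dotL (α x) (h (u x) (B x) (C x)) :=
      contDiff_dotL hα.1 ((sh.clm_apply hB.1).clm_apply hC.1)
    have hc : HasCompactSupport fun x => dotL (α x) (h (u x) (B x) (C x)) :=
      hα.2.mono fun x hx h => hx (by simp [h])
    refine ⟨deriv fun x => dotL (α x) (h (u x) (B x) (C x)), fun x => ?_,
      (contDiff_deriv hs).continuous.integrable_of_hasCompactSupport hc.deriv,
      integral_eq_zero_of_hasDerivAt (hasDerivAt_of_contDiff hs) hc (contDiff_deriv hs).continuous⟩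
    have d1 := ((hasDerivAt_comp_curve H.isOpen H.smooth_h hu x).clm_apply
      (hasDerivAt_of_contDiff hB.1 x)).clm_apply (hasDerivAt_of_contDiff hC.1 x)
    exact (hasDerivAt_dotL (hasDerivAt_of_contDiff hα.1 x) d1).deriv
  obtain ⟨D1, hD1, i1, z1⟩ := key hα hB hC
  obtain ⟨D2, hD2, i2, z2⟩ := key hβ hC hA
  obtain ⟨D3, hD3, i3, z3⟩ := key hγ hA hB
  have int : ∀ {f : ℝ → ℝ}, ContDiff ℝ ∞ f ∧ HasCompactSupport f → Integrable f := fun hf =>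
    hf.1.continuous.integrable_of_hasCompactSupport hf.2
  have j1 := int (H.isTestFun_schoutenDensity hu hα hβ hγ)
  have j2 := int (H.isTestFun_schoutenDensity hu hβ hγ hα)
  have j3 := int (H.isTestFun_schoutenDensity hu hγ hα hβ)
  have hpt : ∀ x, curvDensity G c h u α β γ (deriv u x) x + curvDensity G c h u β γ α (deriv u x) x
      + curvDensity G c h u γ α β (deriv u x) x = (schoutenDensity G c h u α β γ x
        + schoutenDensity G c h u β γ α x + schoutenDensity G c h u γ α β x)
        + (D1 x + D2 x + D3 x) := fun x => by
    have := H.schoutenDensity_sum hanti hsurj hcyc (hu.2 x) (α x) (deriv α x) (β x) (deriv β x)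
      (γ x) (deriv γ x) (deriv u x) (opFlux G c u α x) (opFlux G c u β x) (opFlux G c u γ x)
      (deriv (opFlux G c u α) x) (deriv (opFlux G c u β) x) (deriv (opFlux G c u γ) x) rfl rfl rfl
    simp only [schoutenDensity, curvDensity, hD1, hD2, hD3]
    linarith
  simp only [hpt]
  rw [integral_add (f := fun x => schoutenDensity G c h u α β γ x + schoutenDensity G c h u β γ α x
      + schoutenDensity G c h u γ α β x) (g := fun x => D1 x + D2 x + D3 x)
    ((j1.add j2).add j3) ((i1.add i2).add i3), integral_add_add j1 j2 j3,
    integral_add_add i1 i2 i3, z1, z2, z3]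
  ring

end IsMetricOp

end

section

/-! ### Test functions -/

theorem exists_bump_derivs : ∃ (b : ℝ → ℝ) (R : ℝ), ContDiff ℝ ∞ b ∧ HasCompactSupport b ∧ b ≠ 0 ∧
    0 < R ∧ ∀ x, R ≤ |x| → b x = 0 ∧ deriv b x = 0 ∧ deriv (deriv b) x = 0 ∧
      deriv (deriv (deriv b)) x = 0 := by
  obtain ⟨b, hb, hc, h0⟩ := exists_bump
  obtain ⟨R0, p0, h0'⟩ := exists_interval_of_hasCompactSupport hc
  obtain ⟨R1, p1, h1⟩ := exists_interval_of_hasCompactSupport hc.deriv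
  obtain ⟨R2, p2, h2⟩ := exists_interval_of_hasCompactSupport hc.deriv.deriv
  obtain ⟨R3, p3, h3⟩ := exists_interval_of_hasCompactSupport hc.deriv.deriv.deriv
  exact ⟨b, R0 + R1 + R2 + R3, hb, hc, h0, by positivity, fun x hx =>
    ⟨h0' x (by linarith), h1 x (by linarith), h2 x (by linarith), h3 x (by linarith)⟩⟩

/-- The computations call for the polynomials $x$ and $x^2/2$ as test functions, but test fields
must have compact support. Cutting off beyond the support of the bump leaves all integrands
unchanged. -/
theorem exists_cutoff_eq (R : ℝ) {m : ℝ → ℝ} (hm : ContDiff ℝ ∞ m) :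
    ∃ K : ℝ → ℝ, ContDiff ℝ ∞ K ∧ HasCompactSupport K ∧ ∀ x, |x| < R + 1 → K x = m x ∧
      deriv K x = deriv m x ∧ deriv (deriv K) x = deriv (deriv m) x ∧
        deriv (deriv (deriv K)) x = deriv (deriv (deriv m)) x := by
  obtain ⟨χ, hχ, hc, h1⟩ := exists_cutoff R
  refine ⟨fun x => χ x * m x, hχ.mul hm, hc.mul_right, fun x hx => ?_⟩
  have hev : (fun x => χ x * m x) =ᶠ[𝓝 x] m := by
    filter_upwards [(isOpen_lt continuous_abs continuous_const).mem_nhds hx] with y hy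
    rw [h1 y hy, one_mul]
  exact ⟨hev.eq_of_nhds, hev.deriv_eq, hev.deriv.deriv_eq, hev.deriv.deriv.deriv_eq⟩

variable {n : ℕ}

theorem deriv_smul_vec {P : ℝ → ℝ} (hP : ContDiff ℝ ∞ P) (l : Fin n → ℝ) :
    deriv (fun x => P x • l) = fun x => deriv P x • l :=
  funext fun x => ((hasDerivAt_of_contDiff hP x).smul_const l).deriv

theorem isTestField_smul {P : ℝ → ℝ} (hP : ContDiff ℝ ∞ P) (hc : HasCompactSupport P)
    (l : Fin n → ℝ) : IsTestField fun x => P x • l :=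
  ⟨hP.smul contDiff_const, hc.smul_right⟩

/-- The curve `u₀ + sin ε * s(x) * l`. -/
def bentLine (u₀ l : Fin n → ℝ) (s : ℝ → ℝ) (ε x : ℝ) : Fin n → ℝ := u₀ + (Real.sin ε * s x) • l

theorem contDiff_bentLine (u₀ l : Fin n → ℝ) {s : ℝ → ℝ} (hs : ContDiff ℝ ∞ s) :
    ContDiff ℝ ∞ fun z : ℝ × ℝ => bentLine u₀ l s z.1 z.2 := by
  have h1 : ContDiff ℝ ∞ fun z : ℝ × ℝ => Real.sin z.1 * s z.2 :=
    (Real.contDiff_sin.comp contDiff_fst).mul (hs.comp contDiff_snd)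
  have h2 : ContDiff ℝ ∞ fun z : ℝ × ℝ => (Real.sin z.1 * s z.2) • l := h1.smul contDiff_const
  exact contDiff_const.add h2

theorem isCurveIn_bentLine {U : Set (Fin n → ℝ)} {u₀ l : Fin n → ℝ} {s : ℝ → ℝ}
    (hs : ContDiff ℝ ∞ s) (hin : ∀ ε x, bentLine u₀ l s ε x ∈ U) (ε : ℝ) :
    IsCurveIn U (bentLine u₀ l s ε) := by
  refine ⟨?_, hin ε⟩
  have h1 : ContDiff ℝ ∞ fun x => (Real.sin ε * s x) • l :=
    (contDiff_const.mul hs).smul contDiff_const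
  exact contDiff_const.add h1

theorem deriv_bentLine (u₀ l : Fin n → ℝ) {s : ℝ → ℝ} (hs : ContDiff ℝ ∞ s) (ε x : ℝ) :
    deriv (bentLine u₀ l s ε) x = Real.sin ε • (deriv s x • l) := by
  rw [← mul_smul]
  exact ((((hasDerivAt_of_contDiff hs x).const_mul (Real.sin ε)).smul_const l).const_add u₀).deriv

/-- Since $\sin\varepsilon$ is bounded, one scale $t$ keeps the curves in $U$ for every real
$\varepsilon$, and the family is then smooth on all of $\mathbb R^2$. -/
theorem exists_bentLine_mem {U : Set (Fin n → ℝ)} (hU : IsOpen U) {u₀ : Fin n → ℝ} (hu : u₀ ∈ U)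
    (l : Fin n → ℝ) {s : ℝ → ℝ} (hs : ContDiff ℝ ∞ s) (hc : HasCompactSupport s) :
    ∃ t : ℝ, 0 < t ∧ ∀ ε x, bentLine u₀ (t • l) s ε x ∈ U := by
  obtain ⟨C, hC⟩ := hc.exists_bound_of_continuous hs.continuous
  obtain ⟨r, hr, hball⟩ := Metric.isOpen_iff.1 hU u₀ hu
  have hC0 : 0 ≤ C := (norm_nonneg _).trans (hC 0)
  -- Adding $1$ to $C$ and to $\|l\|$ avoids division by zero and makes the displacement strictly
  -- smaller than $r$.
  refine ⟨r / ((C + 1) * (‖l‖ + 1)), by positivity, fun ε x => hball ?_⟩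
  rw [Metric.mem_ball, dist_eq_norm, bentLine, add_sub_cancel_left, smul_smul, norm_smul, norm_mul,
    norm_mul]
  have h1 : ‖Real.sin ε‖ ≤ 1 := Real.abs_sin_le_one ε
  have h2 : ‖Real.sin ε‖ * ‖s x‖ ≤ C := by
    calc _ ≤ 1 * C := mul_le_mul h1 (hC x) (norm_nonneg _) zero_le_one
      _ = C := one_mul C
  have h3 : ‖r / ((C + 1) * (‖l‖ + 1))‖ = r / ((C + 1) * (‖l‖ + 1)) := by
    rw [Real.norm_eq_abs, abs_of_pos (by positivity)]
  rw [h3]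
  have hl := norm_nonneg l
  calc _ ≤ C * (r / ((C + 1) * (‖l‖ + 1))) * ‖l‖ := by gcongr
    _ = r * ((C / (C + 1)) * (‖l‖ / (‖l‖ + 1))) := by field_simp
    _ < r * 1 := by
      apply mul_lt_mul_of_pos_left _ hr
      have e1 : C / (C + 1) < 1 := (div_lt_one (by positivity)).2 (by linarith)
      have e2 : ‖l‖ / (‖l‖ + 1) < 1 := (div_lt_one (by positivity)).2 (by linarith)
      have e3 : 0 ≤ C / (C + 1) := by positivity
      have e4 : 0 ≤ ‖l‖ / (‖l‖ + 1) := by positivity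
      nlinarith
    _ = r := mul_one r

theorem contDiff_deriv_snd {E : Type*} [NormedAddCommGroup E] [NormedSpace ℝ E] {F : ℝ × ℝ → E}
    (hF : ContDiff ℝ ∞ F) : ContDiff ℝ ∞ fun z : ℝ × ℝ => deriv (fun y => F (z.1, y)) z.2 := by
  have : (fun z : ℝ × ℝ => deriv (fun y => F (z.1, y)) z.2) = fun z => fderiv ℝ F z (0, 1) := by
    funext z
    exact ((hF.differentiable (by simp) z).hasFDerivAt.comp_hasDerivAt z.2
      ((hasDerivAt_const z.2 z.1).prodMk (hasDerivAt_id z.2))).deriv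
  rw [this]
  exact (hF.fderiv_right (m := ∞) (by simp)).clm_apply contDiff_const

variable {U : Set (Fin n → ℝ)} {G : (Fin n → ℝ) → (Fin n → ℝ) →L[ℝ] (Fin n → ℝ)}
  {c h : (Fin n → ℝ) → (Fin n → ℝ) →L[ℝ] (Fin n → ℝ) →L[ℝ] (Fin n → ℝ)}

theorem contDiff_opFlux_family (hG : ContDiffOn ℝ ∞ G U) (hc : ContDiffOn ℝ ∞ c U)
    {u : ℝ → ℝ → Fin n → ℝ} (hu : ContDiff ℝ ∞ fun z : ℝ × ℝ => u z.1 z.2)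
    (huU : ∀ ε x, u ε x ∈ U) {α : ℝ → Fin n → ℝ} (hα : ContDiff ℝ ∞ α) :
    ContDiff ℝ ∞ fun z : ℝ × ℝ => opFlux G c (u z.1) α z.2 := by
  have h1 := hG.comp_contDiff hu fun z => huU z.1 z.2
  have h2 := hc.comp_contDiff hu fun z => huU z.1 z.2
  exact (h1.clm_apply ((contDiff_deriv hα).comp contDiff_snd)).add
    ((h2.clm_apply (contDiff_deriv_snd hu)).clm_apply (hα.comp contDiff_snd))

/-! ### Skew-symmetry -/

/-- The sum $\alpha\cdot A\beta+\beta\cdot A\alpha$ is the $x$-derivative of $\alpha\cdot G\beta$.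
-/
theorem IsMetricOp.integral_opFlux_skew (H : IsMetricOp U G c h) {u α β : ℝ → Fin n → ℝ}
    (hu : IsCurveIn U u) (hα : IsTestField α) (hβ : IsTestField β) :
    ∫ x, dotL (α x) (opFlux G c u β x) = -∫ x, dotL (β x) (opFlux G c u α x) := by
  have sG := contDiff_comp_curve H.smooth_G hu
  have s0 : ContDiff ℝ ∞ fun x => dotL (α x) (G (u x) (β x)) :=
    contDiff_dotL hα.1 (sG.clm_apply hβ.1)
  have c0 : HasCompactSupport fun x => dotL (α x) (G (u x) (β x)) :=
    hα.2.mono fun x hx h => hx (by simp [h])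
  have key := integral_eq_zero_of_hasDerivAt (hasDerivAt_of_contDiff s0) c0
    (contDiff_deriv s0).continuous
  have hpt : ∀ x, deriv (fun x => dotL (α x) (G (u x) (β x))) x =
      dotL (α x) (opFlux G c u β x) + dotL (β x) (opFlux G c u α x) := fun x => by
    have d1 := (hasDerivAt_comp_curve H.isOpen H.smooth_G hu x).clm_apply
      (hasDerivAt_of_contDiff hβ.1 x)
    rw [(hasDerivAt_dotL (hasDerivAt_of_contDiff hα.1 x) d1).deriv, H.compat _ (hu.2 x)]
    have e1 := H.symm _ (hu.2 x) (deriv α x) (β x)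
    have e2 := H.rel _ (hu.2 x) (β x) (α x) (deriv u x)
    simp only [opFlux, map_add, map_sub] at *
    linarith
  have i1 : Integrable fun x => dotL (α x) (opFlux G c u β x) :=
    (contDiff_dotL hα.1 (contDiff_opFlux H.smooth_G H.smooth_c hu
      hβ.1)).continuous.integrable_of_hasCompactSupport (hα.2.mono fun x hx h => hx (by simp [h]))
  have i2 : Integrable fun x => dotL (β x) (opFlux G c u α x) :=
    (contDiff_dotL hβ.1 (contDiff_opFlux H.smooth_G H.smooth_c hu
      hα.1)).continuous.integrable_of_hasCompactSupport (hβ.2.mono fun x hx h => hx (by simp [h]))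
  simp only [hpt] at key
  rw [integral_add i1 i2] at key
  linarith

section

variable (hU : IsOpen U) (hG : ContDiffOn ℝ ∞ G U) (hc : ContDiffOn ℝ ∞ c U)
  (hskew : ∀ u p q : ℝ → Fin n → ℝ, IsCurveIn U u → IsTestField p → IsTestField q →
    ∫ x, dotL (deriv p x) (opFlux G c u (deriv q) x)
      = -∫ x, dotL (deriv q x) (opFlux G c u (deriv p) x))

include hskew in
-- On a constant curve $A=G\partial$. With $p=b'l$ and $q=bm$ both sides are multiples of
-- $\int(b'')^2$, the right one after an integration by parts.
theorem symm_of_skew {u₀ : Fin n → ℝ} (hu : u₀ ∈ U) (l m : Fin n → ℝ) :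
    dotL l (G u₀ m) = dotL m (G u₀ l) := by
  obtain ⟨b, R, hb, hbc, hb0, -, -⟩ := exists_bump_derivs
  have hb1 := contDiff_deriv hb
  have hb2 := contDiff_deriv hb1
  have hpos := integral_sq_pos hb2.continuous hbc.deriv.deriv
    (deriv_ne_zero_of_hasCompactSupport (hb1.differentiable (by simp)) hbc.deriv
      (deriv_ne_zero_of_hasCompactSupport (hb.differentiable (by simp)) hbc hb0))
  have h1 := hskew (fun _ => u₀) _ _ ⟨contDiff_const, fun _ => hu⟩
    (isTestField_smul hb1 hbc.deriv l) (isTestField_smul hb hbc m)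
  have h2 := integral_mul_deriv_eq_neg hb1 hb2 (Or.inl hbc.deriv)
  have hf : ∀ P : ℝ → ℝ, ContDiff ℝ ∞ P → ∀ (k : Fin n → ℝ) (x : ℝ),
      opFlux G c (fun _ => u₀) (fun x => P x • k) x = deriv P x • G u₀ k := by
    intro P hP k x
    rw [opFlux, deriv_smul_vec hP, deriv_const]
    simp
  simp only [hf _ hb1, hf _ hb2, deriv_smul_vec hb, deriv_smul_vec hb1, map_smul, smul_apply,
    smul_eq_mul] at h1
  have e1 : ∀ x, deriv (deriv b) x * (deriv (deriv b) x * dotL l (G u₀ m))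
      = (deriv (deriv b) x * deriv (deriv b) x) * dotL l (G u₀ m) := fun x => by ring
  have e2 : ∀ x, deriv (deriv (deriv b)) x * (deriv b x * dotL m (G u₀ l))
      = (deriv b x * deriv (deriv (deriv b)) x) * dotL m (G u₀ l) := fun x => by ring
  simp only [e1, e2, integral_mul_const, h2, neg_mul, neg_neg] at h1
  exact mul_left_cancel₀ hpos.ne' h1

include hU hG hc hskew in
-- Take the curve $u_0+t\sin\varepsilon\,b(x)\,v$, $p=b\,l$ and $q=K\,m$ with $K=x$ on the support
-- of $b$. Skew-symmetry divided by $\sin\varepsilon$ tends, as $\varepsilon\to0$, to $t\int(b')^2$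
-- times the defect of the identity.
theorem compat_of_skew {u₀ : Fin n → ℝ} (hu : u₀ ∈ U) (v l m : Fin n → ℝ) :
    dotL l (fderiv ℝ G u₀ v m) = dotL l (c u₀ v m) + dotL m (c u₀ v l) := by
  obtain ⟨b, R, hb, hbc, hb0, hR, hbR⟩ := exists_bump_derivs
  obtain ⟨K, hK, hKc, hKm⟩ := exists_cutoff_eq R (contDiff_id (𝕜 := ℝ) (E := ℝ))
  have hb1 := contDiff_deriv hb
  have hpos := integral_sq_pos hb1.continuous hbc.deriv
    (deriv_ne_zero_of_hasCompactSupport (hb.differentiable (by simp)) hbc hb0)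
  obtain ⟨t, ht, hin⟩ := exists_bentLine_mem hU hu v hb hbc
  obtain ⟨u, hudef⟩ : ∃ u, u = bentLine u₀ (t • v) b := ⟨_, rfl⟩
  have huU : ∀ ε, IsCurveIn U (u ε) := fun ε => hudef ▸ isCurveIn_bentLine hb hin ε
  have hus : ContDiff ℝ ∞ fun z : ℝ × ℝ => u z.1 z.2 := hudef ▸ contDiff_bentLine _ _ hb
  have hdu : ∀ ε x, deriv (u ε) x = Real.sin ε • (deriv b x • t • v) := fun ε x =>
    hudef ▸ deriv_bentLine _ _ hb ε x
  have hp := isTestField_smul hb hbc l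
  have hq := isTestField_smul hK hKc m
  obtain ⟨α, hα⟩ : ∃ α, α = deriv fun x => b x • l := ⟨_, rfl⟩
  obtain ⟨β, hβ⟩ : ∃ β, β = deriv fun x => K x • m := ⟨_, rfl⟩
  have tα : IsTestField α := hα ▸ isTestField_deriv hp
  have tβ : IsTestField β := hβ ▸ isTestField_deriv hq
  obtain ⟨w, hw⟩ : ∃ w : ℝ → Fin n → ℝ, w = fun x => deriv b x • t • v := ⟨_, rfl⟩
  have ws : ContDiff ℝ ∞ w := hw ▸ hb1.smul contDiff_const
  -- $\sin\varepsilon\cdot F$ is the integrand $\alpha\cdot A\beta+\beta\cdot A\alpha$ minus the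
  -- derivative of $\alpha\cdot G\beta$. The factor comes from $u_x=\sin\varepsilon\cdot w$.
  let F : ℝ → ℝ → ℝ := fun ε x => dotL (α x) (c (u ε x) (w x) (β x))
      + dotL (β x) (c (u ε x) (w x) (α x)) - dotL (α x) (fderiv ℝ G (u ε x) (w x) (β x))
  have scG := (contDiffOn_fderiv hU hG).comp_contDiff hus fun z => (huU z.1).2 z.2
  have scc := hc.comp_contDiff hus fun z => (huU z.1).2 z.2
  have w2 := ws.comp (contDiff_snd (𝕜 := ℝ) (E := ℝ) (F := ℝ))
  have α2 := tα.1.comp (contDiff_snd (𝕜 := ℝ) (E := ℝ) (F := ℝ))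
  have β2 := tβ.1.comp (contDiff_snd (𝕜 := ℝ) (E := ℝ) (F := ℝ))
  have hFs : ContDiff ℝ ∞ fun z : ℝ × ℝ => F z.1 z.2 :=
    ((contDiff_dotL α2 ((scc.clm_apply w2).clm_apply β2)).add
      (contDiff_dotL β2 ((scc.clm_apply w2).clm_apply α2))).sub
      (contDiff_dotL α2 ((scG.clm_apply w2).clm_apply β2))
  have hF0 : ∀ ε x, R ≤ |x| → F ε x = 0 := fun ε x hx => by
    have : w x = 0 := by rw [hw]; simp [(hbR x hx).2.1]
    simp [F, this]
  have hFint : ∀ ε, 0 < ε → ε < 1 → ∫ x, F ε x = 0 := by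
    intro ε h0 h1
    have sG := contDiff_comp_curve hG (huU ε)
    have s0 : ContDiff ℝ ∞ fun x => dotL (α x) (G (u ε x) (β x)) :=
      contDiff_dotL tα.1 (sG.clm_apply tβ.1)
    have c0 : HasCompactSupport fun x => dotL (α x) (G (u ε x) (β x)) :=
      tα.2.mono fun x hx h => hx (by simp [h])
    have key := integral_eq_zero_of_hasDerivAt (hasDerivAt_of_contDiff s0) c0
      (contDiff_deriv s0).continuous
    have hpt : ∀ x, Real.sin ε * F ε x = dotL (α x) (opFlux G c (u ε) β x)
        + dotL (β x) (opFlux G c (u ε) α x)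
        - deriv (fun x => dotL (α x) (G (u ε x) (β x))) x := fun x => by
      have d1 := (hasDerivAt_comp_curve hU hG (huU ε) x).clm_apply
        (hasDerivAt_of_contDiff tβ.1 x)
      rw [(hasDerivAt_dotL (hasDerivAt_of_contDiff tα.1 x) d1).deriv]
      have e1 := symm_of_skew hskew ((huU ε).2 x) (deriv α x) (β x)
      have e2 : deriv (u ε) x = Real.sin ε • w x := by rw [hdu, hw]
      simp only [opFlux, e2, map_add, map_smul, smul_apply, smul_eq_mul, F] at *
      linarith
    have i1 : Integrable fun x => dotL (α x) (opFlux G c (u ε) β x) :=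
      (contDiff_dotL tα.1 (contDiff_opFlux hG hc (huU ε)
        tβ.1)).continuous.integrable_of_hasCompactSupport (tα.2.mono fun x hx h => hx (by simp [h]))
    have i2 : Integrable fun x => dotL (β x) (opFlux G c (u ε) α x) :=
      (contDiff_dotL tβ.1 (contDiff_opFlux hG hc (huU ε)
        tα.1)).continuous.integrable_of_hasCompactSupport (tβ.2.mono fun x hx h => hx (by simp [h]))
    have i3 : Integrable (deriv fun x => dotL (α x) (G (u ε x) (β x))) :=
      (contDiff_deriv s0).continuous.integrable_of_hasCompactSupport c0.deriv
    have hs : ∫ x, Real.sin ε * F ε x = 0 := by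
      have hsk := hskew (u ε) _ _ (huU ε) hp hq
      rw [← hα, ← hβ] at hsk
      simp only [hpt]
      rw [integral_sub (f := fun x => dotL (α x) (opFlux G c (u ε) β x)
        + dotL (β x) (opFlux G c (u ε) α x)) (i1.add i2) i3, integral_add i1 i2, key, hsk]
      ring
    rw [integral_const_mul] at hs
    exact (mul_eq_zero.1 hs).resolve_left (Real.sin_pos_of_pos_of_lt_pi h0
      (by linarith [Real.pi_gt_three])).ne'
  have hlim := integral_eq_zero_of_continuous_of_pos hR hFs.continuous hF0 hFint
  have hval : ∀ x, F 0 x = (deriv b x * deriv b x) *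
      (t * (dotL l (c u₀ v m) + dotL m (c u₀ v l) - dotL l (fderiv ℝ G u₀ v m))) := fun x => by
    by_cases hx : |x| < R + 1
    · have k1 : deriv K x = 1 := by rw [(hKm x hx).2.1]; simp
      have u0 : u 0 x = u₀ := by simp [hudef, bentLine]
      simp only [F, u0, hw, hα, hβ, deriv_smul_vec hb, deriv_smul_vec hK, k1, map_smul,
        smul_apply, smul_eq_mul]
      ring
    · have hx' : R ≤ |x| := by linarith [not_lt.1 hx]
      rw [hF0 0 x hx', (hbR x hx').2.1]
      ring
  simp only [hval] at hlim
  rw [integral_mul_const] at hlim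
  have := (mul_eq_zero.1 ((mul_eq_zero.1 hlim).resolve_left hpos.ne')).resolve_left ht.ne'
  linarith

end

end

section

/-! ### Consequences of the Jacobi identity -/

variable {n : ℕ} {U : Set (Fin n → ℝ)} {G : (Fin n → ℝ) → (Fin n → ℝ) →L[ℝ] (Fin n → ℝ)}
  {c h : (Fin n → ℝ) → (Fin n → ℝ) →L[ℝ] (Fin n → ℝ) →L[ℝ] (Fin n → ℝ)}

theorem schoutenDensity_const (u₀ : Fin n → ℝ) {f g k : ℝ → ℝ} (hf : ContDiff ℝ ∞ f)
    (hg : ContDiff ℝ ∞ g) (hk : ContDiff ℝ ∞ k) (l m r : Fin n → ℝ) (x : ℝ) :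
    schoutenDensity G c h (fun _ => u₀) (fun x => f x • l) (fun x => g x • m) (fun x => k x • r) x =
      (f x * deriv k x * deriv (deriv g) x) * dotL l (h u₀ (G u₀ r) (G u₀ m))
        - (k x * deriv f x * deriv (deriv g) x) * dotL r (h u₀ (G u₀ l) (G u₀ m)) := by
  have hfl : ∀ P : ℝ → ℝ, ContDiff ℝ ∞ P → ∀ (k : Fin n → ℝ),
      opFlux G c (fun _ => u₀) (fun x => P x • k) = fun x => deriv P x • G u₀ k := by
    intro P hP k
    funext x
    rw [opFlux, deriv_smul_vec hP, deriv_const]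
    simp
  rw [schoutenDensity, hfl _ hf, hfl _ hg, hfl _ hk, deriv_smul_vec (contDiff_deriv hg), deriv_const]
  simp [curv]
  ring

section

variable (H : IsMetricOp U G c h)
  (hjac : ∀ u p q r : ℝ → Fin n → ℝ, IsCurveIn U u → IsTestField p → IsTestField q →
    IsTestField r → (∫ x, schoutenDensity G c h u (deriv p) (deriv q) (deriv r) x)
      + (∫ x, schoutenDensity G c h u (deriv q) (deriv r) (deriv p) x)
      + (∫ x, schoutenDensity G c h u (deriv r) (deriv p) (deriv q) x) = 0)

include hjac H

theorem jacobi_const {u₀ : Fin n → ℝ} (hu : u₀ ∈ U) {P Q K : ℝ → ℝ} (hP : ContDiff ℝ ∞ P)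
    (hQ : ContDiff ℝ ∞ Q) (hK : ContDiff ℝ ∞ K) (cP : HasCompactSupport P)
    (cQ : HasCompactSupport Q) (cK : HasCompactSupport K) (l m r : Fin n → ℝ)
    {f g k : ℝ → ℝ} (ef : f = deriv P) (eg : g = deriv Q) (ek : k = deriv K) :
    ∫ x, (((f x * deriv k x * deriv (deriv g) x) * dotL l (h u₀ (G u₀ r) (G u₀ m))
        - (k x * deriv f x * deriv (deriv g) x) * dotL r (h u₀ (G u₀ l) (G u₀ m)))
      + ((g x * deriv f x * deriv (deriv k) x) * dotL m (h u₀ (G u₀ l) (G u₀ r))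
        - (f x * deriv g x * deriv (deriv k) x) * dotL l (h u₀ (G u₀ m) (G u₀ r)))
      + ((k x * deriv g x * deriv (deriv f) x) * dotL r (h u₀ (G u₀ m) (G u₀ l))
        - (g x * deriv k x * deriv (deriv f) x) * dotL m (h u₀ (G u₀ r) (G u₀ l)))) = 0 := by
  have hf : ContDiff ℝ ∞ f := ef ▸ contDiff_deriv hP
  have hg : ContDiff ℝ ∞ g := eg ▸ contDiff_deriv hQ
  have hk : ContDiff ℝ ∞ k := ek ▸ contDiff_deriv hK
  have cf : HasCompactSupport f := ef ▸ cP.deriv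
  have cg : HasCompactSupport g := eg ▸ cQ.deriv
  have ck : HasCompactSupport k := ek ▸ cK.deriv
  have hcu : IsCurveIn U (fun _ => u₀) := ⟨contDiff_const, fun _ => hu⟩
  have key := hjac (fun _ => u₀) _ _ _ hcu (isTestField_smul hP cP l)
    (isTestField_smul hQ cQ m) (isTestField_smul hK cK r)
  rw [deriv_smul_vec hP, deriv_smul_vec hQ, deriv_smul_vec hK, ← ef, ← eg, ← ek] at key
  have tl := isTestField_smul hf cf l
  have tm := isTestField_smul hg cg m
  have tr := isTestField_smul hk ck r
  have int : ∀ {f : ℝ → ℝ}, ContDiff ℝ ∞ f ∧ HasCompactSupport f → Integrable f := fun hf =>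
    hf.1.continuous.integrable_of_hasCompactSupport hf.2
  rw [← integral_add_add (int (H.isTestFun_schoutenDensity hcu tl tm tr))
    (int (H.isTestFun_schoutenDensity hcu tm tr tl))
    (int (H.isTestFun_schoutenDensity hcu tr tl tm))] at key
  simpa only [schoutenDensity_const u₀ hf hg hk, schoutenDensity_const u₀ hg hk hf,
    schoutenDensity_const u₀ hk hf hg] using key

/-- On a constant curve take $p,q,r$ to be $b,b',K$ times constant covectors, with $K=x$ on the
support of $b$. As $K'=1$ and $K''=0$, only $\int(b''')^2$ and $\int b''b''''=-\int(b''')^2$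
survive. -/
theorem antisymm_of_jacobi {u₀ : Fin n → ℝ} (hu : u₀ ∈ U) (l m r : Fin n → ℝ) :
    dotL r (h u₀ (G u₀ m) (G u₀ l)) = - dotL r (h u₀ (G u₀ l) (G u₀ m)) := by
  obtain ⟨b, R, hb, hbc, hb0, hR, hbR⟩ := exists_bump_derivs
  obtain ⟨K, hK, hKc, hKm⟩ := exists_cutoff_eq R (contDiff_id (𝕜 := ℝ) (E := ℝ))
  have hb1 := contDiff_deriv hb
  have hb2 := contDiff_deriv hb1
  have hb3 := contDiff_deriv hb2
  have hpos := integral_sq_pos hb3.continuous hbc.deriv.deriv.deriv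
    (deriv_ne_zero_of_hasCompactSupport (hb2.differentiable (by simp)) hbc.deriv.deriv
      (deriv_ne_zero_of_hasCompactSupport (hb1.differentiable (by simp)) hbc.deriv
        (deriv_ne_zero_of_hasCompactSupport (hb.differentiable (by simp)) hbc hb0)))
  have hpart := integral_mul_deriv_eq_neg hb2 hb3 (Or.inl hbc.deriv.deriv)
  have key := jacobi_const H hjac hu hb hb1 hK hbc hbc.deriv hKc l m r rfl rfl rfl
  have i1 : Integrable fun x => deriv (deriv b) x * deriv (deriv (deriv (deriv b))) x :=
    (hb2.continuous.mul (contDiff_deriv hb3).continuous).integrable_of_hasCompactSupport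
      hbc.deriv.deriv.mul_right
  have i2 : Integrable fun x => deriv (deriv (deriv b)) x * deriv (deriv (deriv b)) x :=
    (hb3.continuous.mul hb3.continuous).integrable_of_hasCompactSupport
      hbc.deriv.deriv.deriv.mul_right
  rw [integral_congr_ae (g := fun x =>
      (deriv (deriv (deriv b)) x * deriv (deriv (deriv b)) x) * dotL r (h u₀ (G u₀ m) (G u₀ l))
      - (deriv (deriv b) x * deriv (deriv (deriv (deriv b))) x)
        * dotL r (h u₀ (G u₀ l) (G u₀ m))) (ae_of_all _ fun x => ?_),
    integral_sub (i2.mul_const _) (i1.mul_const _), integral_mul_const, integral_mul_const,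
    hpart] at key
  · have : (∫ x, deriv (deriv (deriv b)) x * deriv (deriv (deriv b)) x) *
        (dotL r (h u₀ (G u₀ m) (G u₀ l)) + dotL r (h u₀ (G u₀ l) (G u₀ m))) = 0 := by
      linear_combination key
    linarith [(mul_eq_zero.1 this).resolve_left hpos.ne']
  · by_cases hx : |x| < R + 1
    · obtain ⟨-, k1, k2, k3⟩ := hKm x hx
      simp only [k1, k2, k3, deriv_id', deriv_const']
      ring
    · obtain ⟨-, z1, z2, z3⟩ := hbR x (by linarith [not_lt.1 hx])
      simp only [z1, z2, z3]
      ring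

/-- The same method with $p,q,r$ built from $b,b,K$, where $K=x^2/2$ on the support. By the
skew-symmetry of $h$ already found, the terms with $K'=x$ combine into $x\,((b'')^2)'$. All
integrals then reduce to $\int(b'')^2$. -/
theorem cyclic_of_jacobi {u₀ : Fin n → ℝ} (hu : u₀ ∈ U) (l m r : Fin n → ℝ) :
    dotL l (h u₀ (G u₀ m) (G u₀ r)) + dotL m (h u₀ (G u₀ r) (G u₀ l))
      + dotL r (h u₀ (G u₀ l) (G u₀ m)) = 0 := by
  obtain ⟨b, R, hb, hbc, hb0, hR, hbR⟩ := exists_bump_derivs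
  have hm : ContDiff ℝ ∞ fun x : ℝ => x ^ 2 / 2 := (contDiff_id.pow 2).div_const 2
  have hm1 : deriv (fun x : ℝ => x ^ 2 / 2) = fun x => x := by
    funext x
    simp
  obtain ⟨K, hK, hKc, hKm⟩ := exists_cutoff_eq R hm
  have hb1 := contDiff_deriv hb
  have hb2 := contDiff_deriv hb1
  have hpos := integral_sq_pos hb2.continuous hbc.deriv.deriv
    (deriv_ne_zero_of_hasCompactSupport (hb1.differentiable (by simp)) hbc.deriv
      (deriv_ne_zero_of_hasCompactSupport (hb.differentiable (by simp)) hbc hb0))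
  have hpart := integral_mul_deriv_eq_neg hb1 hb2 (Or.inl hbc.deriv)
  have hpart2 := integral_mul_deriv_eq_neg (f := fun x : ℝ => x) contDiff_id (hb2.mul hb2)
    (Or.inr hbc.deriv.deriv.mul_right)
  have hd2 : ∀ x, deriv (fun x => deriv (deriv b) x * deriv (deriv b) x) x =
      2 * (deriv (deriv b) x * deriv (deriv (deriv b)) x) := fun x => by
    rw [((hasDerivAt_of_contDiff hb2 x).fun_mul (hasDerivAt_of_contDiff hb2 x)).deriv]
    ring
  have key := jacobi_const H hjac hu hb hb hK hbc hbc hKc l m r rfl rfl rfl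
  have i1 : Integrable fun x => deriv b x * deriv (deriv (deriv b)) x :=
    (hb1.continuous.mul (contDiff_deriv hb2).continuous).integrable_of_hasCompactSupport
      hbc.deriv.mul_right
  have i2 : Integrable fun x => x * deriv (fun x => deriv (deriv b) x * deriv (deriv b) x) x :=
    (continuous_id.mul (contDiff_deriv (hb2.mul hb2)).continuous).integrable_of_hasCompactSupport
      hbc.deriv.deriv.mul_right.deriv.mul_left
  have ha := antisymm_of_jacobi H hjac hu
  rw [integral_congr_ae (g := fun x =>
      (deriv b x * deriv (deriv (deriv b)) x) *
        (dotL l (h u₀ (G u₀ r) (G u₀ m)) - dotL m (h u₀ (G u₀ r) (G u₀ l)))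
      - (x * deriv (fun x => deriv (deriv b) x * deriv (deriv b) x) x)
        * dotL r (h u₀ (G u₀ l) (G u₀ m))) (ae_of_all _ fun x => ?_),
    integral_sub (i1.mul_const _) (i2.mul_const _), integral_mul_const, integral_mul_const,
    hpart, hpart2] at key
  · simp only [deriv_id'', one_mul] at key
    have : (∫ x, deriv (deriv b) x * deriv (deriv b) x) *
        (dotL l (h u₀ (G u₀ m) (G u₀ r)) + dotL m (h u₀ (G u₀ r) (G u₀ l))
      + dotL r (h u₀ (G u₀ l) (G u₀ m))) = 0 := by
      linear_combination key + (∫ x, deriv (deriv b) x * deriv (deriv b) x) * ha r m l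
    exact (mul_eq_zero.1 this).resolve_left hpos.ne'
  · by_cases hx : |x| < R + 1
    · obtain ⟨-, k1, k2, k3⟩ := hKm x hx
      simp only [k1, k2, k3, hm1, deriv_id'', deriv_const', hd2, ha l m r]
      ring
    · obtain ⟨-, z1, z2, z3⟩ := hbR x (by linarith [not_lt.1 hx])
      simp only [z1, z2, z3, hd2]
      ring

/-- The curve $u_0+t\sin\varepsilon\,b''(x)\,v$ is used, with $\alpha=b'l$ and with $\beta,\gamma$
equal to the constants $m,r$ on the support of $b$. In the limit $\varepsilon\to0$ the fluxes
$A\beta$ and $A\gamma$ vanish there, so only the third cyclic term is left. It carries the factor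
$(b''')^2$. -/
theorem curv_symm_of_jacobi (hanti : ∀ u ∈ U, ∀ y z, h u y z = - h u z y)
    (hsurj : ∀ u ∈ U, Function.Surjective (G u))
    (hcyc : ∀ u ∈ U, ∀ l m k, dotL l (h u (G u m) (G u k)) + dotL m (h u (G u k) (G u l))
      + dotL k (h u (G u l) (G u m)) = 0)
    {u₀ : Fin n → ℝ} (hu : u₀ ∈ U) (v l m r : Fin n → ℝ) :
    dotL m (curv h u₀ (G u₀ l) (G u₀ r) v) = dotL m (curv h u₀ v (G u₀ r) (G u₀ l)) := by
  obtain ⟨b, R, hb, hbc, hb0, hR, hbR⟩ := exists_bump_derivs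
  obtain ⟨K, hK, hKc, hKm⟩ := exists_cutoff_eq R (contDiff_id (𝕜 := ℝ) (E := ℝ))
  have hb1 := contDiff_deriv hb
  have hb2 := contDiff_deriv hb1
  have hb3 := contDiff_deriv hb2
  have hpos := integral_sq_pos hb3.continuous hbc.deriv.deriv.deriv
    (deriv_ne_zero_of_hasCompactSupport (hb2.differentiable (by simp)) hbc.deriv.deriv
      (deriv_ne_zero_of_hasCompactSupport (hb1.differentiable (by simp)) hbc.deriv
        (deriv_ne_zero_of_hasCompactSupport (hb.differentiable (by simp)) hbc hb0)))
  obtain ⟨t, ht, hin⟩ := exists_bentLine_mem H.isOpen hu v hb2 hbc.deriv.deriv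
  obtain ⟨u, hudef⟩ : ∃ u, u = bentLine u₀ (t • v) (deriv (deriv b)) := ⟨_, rfl⟩
  have huU : ∀ ε, IsCurveIn U (u ε) := fun ε => hudef ▸ isCurveIn_bentLine hb2 hin ε
  have hus : ContDiff ℝ ∞ fun z : ℝ × ℝ => u z.1 z.2 := hudef ▸ contDiff_bentLine _ _ hb2
  have hdu : ∀ ε x, deriv (u ε) x = Real.sin ε • (deriv (deriv (deriv b)) x • t • v) := fun ε x =>
    hudef ▸ deriv_bentLine _ _ hb2 ε x
  have hp := isTestField_smul hb hbc l
  have hq := isTestField_smul hK hKc m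
  have hr := isTestField_smul hK hKc r
  obtain ⟨α, hα⟩ : ∃ α, α = deriv fun x => b x • l := ⟨_, rfl⟩
  obtain ⟨β, hβ⟩ : ∃ β, β = deriv fun x => K x • m := ⟨_, rfl⟩
  obtain ⟨γ, hγ⟩ : ∃ γ, γ = deriv fun x => K x • r := ⟨_, rfl⟩
  have tα : IsTestField α := hα ▸ isTestField_deriv hp
  have tβ : IsTestField β := hβ ▸ isTestField_deriv hq
  have tγ : IsTestField γ := hγ ▸ isTestField_deriv hr
  obtain ⟨w, hw⟩ : ∃ w : ℝ → Fin n → ℝ, w = fun x => deriv (deriv (deriv b)) x • t • v := ⟨_, rfl⟩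
  have ws : ContDiff ℝ ∞ w := hw ▸ hb3.smul contDiff_const
  have w2 : ContDiff ℝ ∞ fun z : ℝ × ℝ => w z.2 := ws.comp contDiff_snd
  have sG := H.smooth_G.comp_contDiff hus fun z => (huU z.1).2 z.2
  -- The density is linear in its argument `w`, which replaces $u_x$; this allows the factor
  -- $\sin\varepsilon$ to be removed before the limit.
  let F : ℝ → ℝ → ℝ := fun ε x => curvDensity G c h (u ε) α β γ (w x) x
    + curvDensity G c h (u ε) β γ α (w x) x + curvDensity G c h (u ε) γ α β (w x) x
  have hsm : ∀ {α β γ : ℝ → Fin n → ℝ}, ContDiff ℝ ∞ α → ContDiff ℝ ∞ β → ContDiff ℝ ∞ γ →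
      ContDiff ℝ ∞ fun z : ℝ × ℝ => curvDensity G c h (u z.1) α β γ (w z.2) z.2 := by
    intro α β γ hα hβ hγ
    have sB := contDiff_opFlux_family H.smooth_G H.smooth_c hus (fun ε => (huU ε).2) hβ
    have sC := contDiff_opFlux_family H.smooth_G H.smooth_c hus (fun ε => (huU ε).2) hγ
    have sB' := contDiff_deriv_snd sB
    have α2 : ContDiff ℝ ∞ fun z : ℝ × ℝ => α z.2 := hα.comp contDiff_snd
    have γ2 : ContDiff ℝ ∞ fun z : ℝ × ℝ => γ z.2 := hγ.comp contDiff_snd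
    have sa := sG.clm_apply α2
    exact (contDiff_dotL α2 (H.contDiff_curv hus (fun z => (huU z.1).2 z.2) w2 sB sC)).add
      (contDiff_dotL γ2 ((H.contDiff_curv hus (fun z => (huU z.1).2 z.2) sB' sa w2).sub
        (H.contDiff_curv hus (fun z => (huU z.1).2 z.2) w2 sa sB')))
  have hFs : ContDiff ℝ ∞ fun z : ℝ × ℝ => F z.1 z.2 :=
    ((hsm tα.1 tβ.1 tγ.1).add (hsm tβ.1 tγ.1 tα.1)).add (hsm tγ.1 tα.1 tβ.1)
  have hF0 : ∀ ε x, R ≤ |x| → F ε x = 0 := fun ε x hx => by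
    have : w x = 0 := by rw [hw]; simp [(hbR x hx).2.2.2]
    simp [F, this, curvDensity, curv]
  have hFint : ∀ ε, 0 < ε → ε < 1 → ∫ x, F ε x = 0 := by
    intro ε h0 h1
    have key := hjac (u ε) _ _ _ (huU ε) hp hq hr
    rw [← hα, ← hβ, ← hγ, H.integral_schoutenDensity_sum hanti hsurj hcyc (huU ε) tα tβ tγ] at key
    have hlin : ∀ (α β γ : ℝ → Fin n → ℝ) x, curvDensity G c h (u ε) α β γ (deriv (u ε) x) x
        = Real.sin ε * curvDensity G c h (u ε) α β γ (w x) x := fun α β γ x => by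
      have e2 : deriv (u ε) x = Real.sin ε • w x := by rw [hdu, hw]
      rw [e2]
      simp only [curvDensity, curv, map_smul, smul_apply, map_add, map_sub, smul_eq_mul]
      ring
    simp only [hlin, ← mul_add] at key
    rw [integral_const_mul] at key
    exact (mul_eq_zero.1 key).resolve_left (Real.sin_pos_of_pos_of_lt_pi h0
      (by linarith [Real.pi_gt_three])).ne'
  have hlim := integral_eq_zero_of_continuous_of_pos hR hFs.continuous hF0 hFint
  have hval : ∀ x, F 0 x = (deriv (deriv (deriv b)) x * deriv (deriv (deriv b)) x) *
      (t * (dotL m (curv h u₀ (G u₀ l) (G u₀ r) v)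
        - dotL m (curv h u₀ v (G u₀ r) (G u₀ l)))) := fun x => by
    by_cases hx : |x| < R + 1
    · obtain ⟨-, k1, k2, k3⟩ := hKm x hx
      have u0 : u 0 = fun _ => u₀ := by
        funext x
        simp [hudef, bentLine]
      have hfl : ∀ P : ℝ → ℝ, ContDiff ℝ ∞ P → ∀ (k : Fin n → ℝ),
          opFlux G c (fun _ => u₀) (deriv fun x => P x • k) = fun x => deriv (deriv P) x • G u₀ k := by
        intro P hP k
        funext x
        rw [deriv_smul_vec hP, opFlux, deriv_smul_vec (contDiff_deriv hP), deriv_const]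
        simp
      have hK2 := contDiff_deriv (contDiff_deriv hK)
      simp only [F, curvDensity, u0, hα, hβ, hγ, hfl _ hb, hfl _ hK, deriv_smul_vec hb2,
        deriv_smul_vec hK2]
      simp only [deriv_smul_vec hb, deriv_smul_vec hK, hw, k1, k2, k3, deriv_id', deriv_const']
      simp [curv]
      ring
    · have hx' : R ≤ |x| := by linarith [not_lt.1 hx]
      rw [hF0 0 x hx', (hbR x hx').2.2.2]
      ring
  simp only [hval] at hlim
  rw [integral_mul_const] at hlim
  have := (mul_eq_zero.1 ((mul_eq_zero.1 hlim).resolve_left hpos.ne')).resolve_left ht.ne'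
  linarith

/-- A trilinear expression symmetric in its outer arguments and skew in its last two is zero: three
alternations of the two symmetries return the arguments with the opposite sign. -/
theorem curv_eq_zero_of_jacobi (hanti : ∀ u ∈ U, ∀ y z, h u y z = - h u z y)
    (hsurj : ∀ u ∈ U, Function.Surjective (G u))
    (hcyc : ∀ u ∈ U, ∀ l m k, dotL l (h u (G u m) (G u k)) + dotL m (h u (G u k) (G u l))
      + dotL k (h u (G u l) (G u m)) = 0)
    {u₀ : Fin n → ℝ} (hu : u₀ ∈ U) (x y z : Fin n → ℝ) : curv h u₀ x y z = 0 := by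
  have hs : ∀ x y z, curv h u₀ x y z = curv h u₀ z y x := by
    intro x y z
    apply eq_of_dotL
    intro m
    obtain ⟨l, rfl⟩ := hsurj u₀ hu x
    obtain ⟨r, rfl⟩ := hsurj u₀ hu y
    exact curv_symm_of_jacobi H hjac hanti hsurj hcyc hu z l m r
  have ha : ∀ x y z, curv h u₀ x y z = - curv h u₀ x z y := by
    intro x y z
    have dh := hasDerivAt_add_smul (hasFDerivAt_of_contDiffOn H.isOpen H.smooth_h hu) x
    have d1 := (dh.clm_apply (hasDerivAt_const (0 : ℝ) y)).clm_apply (hasDerivAt_const (0 : ℝ) z)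
    have d2 := (dh.clm_apply (hasDerivAt_const (0 : ℝ) z)).clm_apply (hasDerivAt_const (0 : ℝ) y)
    have hev : (fun ε : ℝ => h (u₀ + ε • x) y z) =ᶠ[𝓝 0] fun ε : ℝ => - h (u₀ + ε • x) z y := by
      have ht : Tendsto (fun ε : ℝ => u₀ + ε • x) (𝓝 0) (𝓝 u₀) := by
        have : Continuous fun ε : ℝ => u₀ + ε • x := by fun_prop
        simpa using this.tendsto 0
      filter_upwards [ht.eventually (H.isOpen.mem_nhds hu)] with ε hε
      exact hanti _ hε _ _
    have e := d1.unique (d2.fun_neg.congr_of_eventuallyEq hev)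
    simp only [map_zero, add_zero] at e
    rw [curv, curv, e, hanti u₀ hu y z, map_neg, neg_apply, neg_add]
  have key : curv h u₀ x y z = - curv h u₀ x y z := by
    calc curv h u₀ x y z = curv h u₀ z y x := hs _ _ _
      _ = - curv h u₀ z x y := ha _ _ _
      _ = - curv h u₀ y x z := by rw [hs z x y]
      _ = curv h u₀ y z x := by rw [ha y x z, neg_neg]
      _ = curv h u₀ x z y := hs _ _ _
      _ = - curv h u₀ x y z := ha _ _ _
  exact self_eq_neg.1 key

end

end

section

/-! ### The conditions for an operator to be Hamiltonian -/

/-- The conditions on `G`, `c` for `∂ (G ∂ + c u_x) ∂` to be Hamiltonian. -/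
structure IsFlatOp {n : ℕ} (U : Set (Fin n → ℝ))
    (G : (Fin n → ℝ) → (Fin n → ℝ) →L[ℝ] (Fin n → ℝ))
    (c h : (Fin n → ℝ) → (Fin n → ℝ) →L[ℝ] (Fin n → ℝ) →L[ℝ] (Fin n → ℝ)) : Prop
    extends IsMetricOp U G c h where
  surj : ∀ u ∈ U, Function.Surjective (G u)
  antisymm : ∀ u ∈ U, ∀ y z, h u y z = - h u z y
  cyclic : ∀ u ∈ U, ∀ l m k, dotL l (h u (G u m) (G u k)) + dotL m (h u (G u k) (G u l))
      + dotL k (h u (G u l) (G u m)) = 0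
  flat : ∀ u ∈ U, ∀ x y z, curv h u x y z = 0

variable {n : ℕ}

/-- The linear maps with matrices `G`. -/
def opG (G : (Fin n → ℝ) → Matrix (Fin n) (Fin n) ℝ) (u : Fin n → ℝ) :
    (Fin n → ℝ) →L[ℝ] (Fin n → ℝ) := linOf (G u)

/-- The bilinear maps `(w, γ) ↦ (c^{ij}_k w^k γ_j)_i`. -/
def opC (c : (Fin n → ℝ) → Fin n → Fin n → Fin n → ℝ) (u : Fin n → ℝ) :
    (Fin n → ℝ) →L[ℝ] (Fin n → ℝ) →L[ℝ] (Fin n → ℝ) := bilOf fun i k j => c u i j k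

/-- The symbols `- g_{ij} c^{ir}_k` of the connection of an operator. -/
def opH (G : (Fin n → ℝ) → Matrix (Fin n) (Fin n) ℝ)
    (c : (Fin n → ℝ) → Fin n → Fin n → Fin n → ℝ) (u : Fin n → ℝ) :
    (Fin n → ℝ) →L[ℝ] (Fin n → ℝ) →L[ℝ] (Fin n → ℝ) :=
  bilOf fun r j k => - ∑ i, (G u)⁻¹ i j * c u i r k

theorem linOf_eq_mulVec (M : Matrix (Fin n) (Fin n) ℝ) (y : Fin n → ℝ) :
    linOf M y = M.mulVec y := by
  funext i
  rw [linOf_apply]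
  rfl

theorem linOf_mul (A B : Matrix (Fin n) (Fin n) ℝ) (y : Fin n → ℝ) :
    linOf (A * B) y = linOf A (linOf B y) := by
  simp only [linOf_eq_mulVec, Matrix.mulVec_mulVec]

theorem linOf_one (y : Fin n → ℝ) : linOf (1 : Matrix (Fin n) (Fin n) ℝ) y = y := by
  rw [linOf_eq_mulVec, Matrix.one_mulVec]

theorem linOf_inv_apply {M : Matrix (Fin n) (Fin n) ℝ} (hM : M.det ≠ 0) (y : Fin n → ℝ) :
    linOf M⁻¹ (linOf M y) = y := by
  rw [← linOf_mul, Matrix.nonsing_inv_mul _ (isUnit_iff_ne_zero.2 hM), linOf_one]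

theorem linOf_apply_inv {M : Matrix (Fin n) (Fin n) ℝ} (hM : M.det ≠ 0) (y : Fin n → ℝ) :
    linOf M (linOf M⁻¹ y) = y := by
  rw [← linOf_mul, Matrix.mul_nonsing_inv _ (isUnit_iff_ne_zero.2 hM), linOf_one]

theorem contDiffOn_det {U : Set (Fin n → ℝ)} {M : (Fin n → ℝ) → Matrix (Fin n) (Fin n) ℝ}
    (h : ∀ i j, ContDiffOn ℝ ∞ (fun u => M u i j) U) : ContDiffOn ℝ ∞ (fun u => (M u).det) U := by
  simp only [Matrix.det_apply']
  exact ContDiffOn.sum fun σ _ => contDiffOn_const.mul (contDiffOn_prod fun i _ => h _ _)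

theorem contDiffOn_inv {U : Set (Fin n → ℝ)} {M : (Fin n → ℝ) → Matrix (Fin n) (Fin n) ℝ}
    (h : ∀ i j, ContDiffOn ℝ ∞ (fun u => M u i j) U) (h0 : ∀ u ∈ U, (M u).det ≠ 0) (i j : Fin n) :
    ContDiffOn ℝ ∞ (fun u => (M u)⁻¹ i j) U := by
  simp only [Matrix.inv_def, Ring.inverse_eq_inv', Matrix.smul_apply, smul_eq_mul,
    Matrix.adjugate_apply]
  refine ((contDiffOn_det h).inv h0).mul (contDiffOn_det fun k l => ?_)
  simp only [Matrix.updateRow_apply]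
  split_ifs
  · exact contDiffOn_const
  · exact h k l

theorem dotL_opH (G : (Fin n → ℝ) → Matrix (Fin n) (Fin n) ℝ)
    (c : (Fin n → ℝ) → Fin n → Fin n → Fin n → ℝ) (u y w γ : Fin n → ℝ) :
    dotL γ (opH G c u y w) = - dotL (linOf (G u)⁻¹ y) (opC c u w γ) := by
  simp only [dotL_apply, opH, opC, bilOf_apply, linOf_apply, neg_mul, Finset.sum_neg_distrib,
    mul_neg, neg_inj, Finset.mul_sum, Finset.sum_mul]
  calc _ = ∑ r, ∑ j, ∑ k, ∑ i, γ r * ((G u)⁻¹ i j * c u i r k * y j * w k) := rfl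
    _ = ∑ r, ∑ k, ∑ j, ∑ i, γ r * ((G u)⁻¹ i j * c u i r k * y j * w k) :=
      Finset.sum_congr rfl fun r _ => Finset.sum_comm
    _ = ∑ r, ∑ k, ∑ i, ∑ j, γ r * ((G u)⁻¹ i j * c u i r k * y j * w k) :=
      Finset.sum_congr rfl fun r _ => Finset.sum_congr rfl fun k _ => Finset.sum_comm
    _ = ∑ k, ∑ r, ∑ i, ∑ j, γ r * ((G u)⁻¹ i j * c u i r k * y j * w k) := Finset.sum_comm
    _ = ∑ k, ∑ i, ∑ r, ∑ j, γ r * ((G u)⁻¹ i j * c u i r k * y j * w k) :=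
      Finset.sum_congr rfl fun k _ => Finset.sum_comm
    _ = ∑ i, ∑ k, ∑ r, ∑ j, γ r * ((G u)⁻¹ i j * c u i r k * y j * w k) := Finset.sum_comm
    _ = _ := Finset.sum_congr rfl fun i _ => Finset.sum_congr rfl fun k _ =>
      Finset.sum_congr rfl fun r _ => Finset.sum_congr rfl fun j _ => by ring

variable {U : Set (Fin n → ℝ)} {G : (Fin n → ℝ) → Matrix (Fin n) (Fin n) ℝ}
  {c : (Fin n → ℝ) → Fin n → Fin n → Fin n → ℝ}

/-- Skew-symmetry yields the metric conditions. The Jacobi identity on constant curves yields the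
two algebraic conditions on $h$, and these are needed before non-constant curves can isolate `curv`.
-/
theorem isFlatOp_of_isHamiltonianOp (hU : IsOpen U) (H : IsHamiltonianOp U G c) :
    IsFlatOp U (opG G) (opC c) (opH G c) := by
  have sG : ContDiffOn ℝ ∞ (opG G) U := contDiffOn_linOf H.smooth_G
  have sc : ContDiffOn ℝ ∞ (opC c) U := contDiffOn_bilOf fun i k j => H.smooth_c i j k
  have sh : ContDiffOn ℝ ∞ (opH G c) U := contDiffOn_bilOf fun r j k =>
    (ContDiffOn.sum fun i _ => (contDiffOn_inv H.smooth_G H.nondegenerate i j).mul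
      (H.smooth_c i r k)).neg
  have hskew : ∀ u p q : ℝ → Fin n → ℝ, IsCurveIn U u → IsTestField p → IsTestField q →
      ∫ x, dotL (deriv p x) (opFlux (opG G) (opC c) u (deriv q) x)
        = -∫ x, dotL (deriv q x) (opFlux (opG G) (opC c) u (deriv p) x) := by
    intro u p q hu hp hq
    have := H.skew u p q hu hp hq
    rw [integral_thirdOrderOp (G' := opG G) (c' := opC c) rfl rfl sG sc hu hp hq,
      integral_thirdOrderOp (G' := opG G) (c' := opC c) rfl rfl sG sc hu hq hp] at this
    linarith
  have rel : ∀ u ∈ U, ∀ α γ w, dotL α (opC c u w γ) = - dotL γ (opH G c u (opG G u α) w) := by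
    intro u hu α γ w
    rw [dotL_opH, neg_neg, opG, linOf_inv_apply (H.nondegenerate u hu)]
  have M : IsMetricOp U (opG G) (opC c) (opH G c) :=
    { isOpen := hU
      smooth_G := sG
      smooth_c := sc
      smooth_h := sh
      symm := fun u hu => symm_of_skew hskew hu
      rel := rel
      compat := fun u hu v α => by
        apply eq_of_dotL
        intro z
        rw [compat_of_skew hU sG sc hskew hu, map_sub, rel u hu α z]
        ring }
  have surj : ∀ u ∈ U, Function.Surjective (opG G u) := fun u hu y =>
    ⟨_, linOf_apply_inv (H.nondegenerate u hu) y⟩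
  have hjac : ∀ u p q r : ℝ → Fin n → ℝ, IsCurveIn U u → IsTestField p → IsTestField q →
    IsTestField r →
    (∫ x, schoutenDensity (opG G) (opC c) (opH G c) u (deriv p) (deriv q) (deriv r) x)
      + (∫ x, schoutenDensity (opG G) (opC c) (opH G c) u (deriv q) (deriv r) (deriv p) x)
      + (∫ x, schoutenDensity (opG G) (opC c) (opH G c) u (deriv r) (deriv p) (deriv q) x) = 0 := by
    intro u p q r hu hp hq hr
    have := H.jacobi u p q r hu hp hq hr
    rw [schoutenTerm_eq (G' := opG G) (c' := opC c) hU rfl rfl sG sc hu hp hq hr,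
      schoutenTerm_eq (G' := opG G) (c' := opC c) hU rfl rfl sG sc hu hq hr hp,
      schoutenTerm_eq (G' := opG G) (c' := opC c) hU rfl rfl sG sc hu hr hp hq,
      M.integral_schouten hu (isTestField_deriv hp) (isTestField_deriv hq) (isTestField_deriv hr),
      M.integral_schouten hu (isTestField_deriv hq) (isTestField_deriv hr) (isTestField_deriv hp),
      M.integral_schouten hu (isTestField_deriv hr) (isTestField_deriv hp) (isTestField_deriv hq)]
      at this
    exact this
  have anti : ∀ u ∈ U, ∀ y z, opH G c u y z = - opH G c u z y := by
    intro u hu y z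
    obtain ⟨m, rfl⟩ := surj u hu y
    obtain ⟨l, rfl⟩ := surj u hu z
    apply eq_of_dotL
    intro r
    rw [antisymm_of_jacobi M hjac hu, map_neg]
  have cyc := fun u (hu : u ∈ U) => cyclic_of_jacobi M hjac hu
  exact { M with
    surj := surj
    antisymm := anti
    cyclic := cyc
    flat := fun u hu => curv_eq_zero_of_jacobi M hjac anti surj cyc hu }

/-- Up to total derivatives the cyclic sum of Schouten terms consists of `curv` terms only, and
these vanish. -/
theorem isHamiltonianOp_of_isFlatOp
    {h : (Fin n → ℝ) → (Fin n → ℝ) →L[ℝ] (Fin n → ℝ) →L[ℝ] (Fin n → ℝ)}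
    (smooth_G : ∀ i j, ContDiffOn ℝ ∞ (fun u => G u i j) U)
    (smooth_c : ∀ i j k, ContDiffOn ℝ ∞ (fun u => c u i j k) U)
    (nondegenerate : ∀ u ∈ U, (G u).det ≠ 0)
    (H : IsFlatOp U (opG G) (opC c) h) : IsHamiltonianOp U G c where
  smooth_G := smooth_G
  smooth_c := smooth_c
  nondegenerate := nondegenerate
  skew u p q hu hp hq := by
    rw [integral_thirdOrderOp (G' := opG G) (c' := opC c) rfl rfl H.smooth_G H.smooth_c hu hp hq,
      integral_thirdOrderOp (G' := opG G) (c' := opC c) rfl rfl H.smooth_G H.smooth_c hu hq hp,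
      H.integral_opFlux_skew hu (isTestField_deriv hp) (isTestField_deriv hq)]
  jacobi u p q r hu hp hq hr := by
    have tp := isTestField_deriv hp
    have tq := isTestField_deriv hq
    have tr := isTestField_deriv hr
    rw [schoutenTerm_eq (G' := opG G) (c' := opC c) H.isOpen rfl rfl H.smooth_G H.smooth_c
        hu hp hq hr,
      schoutenTerm_eq (G' := opG G) (c' := opC c) H.isOpen rfl rfl H.smooth_G H.smooth_c
        hu hq hr hp,
      schoutenTerm_eq (G' := opG G) (c' := opC c) H.isOpen rfl rfl H.smooth_G H.smooth_c
        hu hr hp hq,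
      H.integral_schouten hu tp tq tr, H.integral_schouten hu tq tr tp,
      H.integral_schouten hu tr tp tq,
      H.integral_schoutenDensity_sum H.antisymm H.surj H.cyclic hu tp tq tr]
    simp [curvDensity, H.flat _ (hu.2 _)]

end

section

/-! ### Monge data in terms of multilinear maps -/

section

variable {n : ℕ} (D : MongeData n)

/-- The bilinear map with coefficients `ψ`. -/
def psiB : (Fin n → ℝ) →L[ℝ] (Fin n → ℝ) →L[ℝ] (Fin n → ℝ) := bilOf D.ψ

/-- The linear map with coefficients `ω`. -/
def omL : (Fin n → ℝ) →L[ℝ] (Fin n → ℝ) := linOf (Matrix.of D.om)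

/-- The linear map with coefficients `η`. -/
def etaL : (Fin n → ℝ) →L[ℝ] (Fin n → ℝ) := linOf (Matrix.of D.η)

/-- The bilinear form with coefficients `φ`. -/
def phiB (x y : Fin n → ℝ) : ℝ := dotL x (linOf D.φ y)

/-- The frame `y ↦ ψ^γ_k(u) y^k`. -/
def frame (u y : Fin n → ℝ) : Fin n → ℝ := psiB D y u + omL D y

theorem phiB_apply (x y : Fin n → ℝ) : phiB D x y = ∑ β, ∑ γ, D.φ β γ * x β * y γ := by
  simp only [phiB, dotL_apply, linOf_apply, Finset.mul_sum]
  exact Finset.sum_congr rfl fun _ _ => Finset.sum_congr rfl fun _ _ => by ring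

@[simp] theorem phiB_add_left (x x' y : Fin n → ℝ) : phiB D (x + x') y = phiB D x y + phiB D x' y := by
  simp [phiB]

@[simp] theorem phiB_add_right (x y y' : Fin n → ℝ) :
    phiB D x (y + y') = phiB D x y + phiB D x y' := by
  simp [phiB]

@[simp] theorem phiB_smul_left (r : ℝ) (x y : Fin n → ℝ) : phiB D (r • x) y = r * phiB D x y := by
  simp [phiB]

@[simp] theorem phiB_smul_right (r : ℝ) (x y : Fin n → ℝ) : phiB D x (r • y) = r * phiB D x y := by
  simp [phiB]

@[simp] theorem phiB_neg_left (x y : Fin n → ℝ) : phiB D (-x) y = - phiB D x y := by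
  simp [phiB]

@[simp] theorem phiB_neg_right (x y : Fin n → ℝ) : phiB D x (-y) = - phiB D x y := by
  simp [phiB]

@[simp] theorem phiB_sub_left (x x' y : Fin n → ℝ) : phiB D (x - x') y = phiB D x y - phiB D x' y := by
  simp [phiB]

@[simp] theorem phiB_sub_right (x y y' : Fin n → ℝ) :
    phiB D x (y - y') = phiB D x y - phiB D x y' := by
  simp [phiB]

@[simp] theorem phiB_zero_left (y : Fin n → ℝ) : phiB D 0 y = 0 := by
  simp [phiB]

@[simp] theorem phiB_zero_right (x : Fin n → ℝ) : phiB D x 0 = 0 := by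
  simp [phiB]

@[simp] theorem frame_add (u y z : Fin n → ℝ) : frame D u (y + z) = frame D u y + frame D u z := by
  simp only [frame, map_add, add_apply]
  abel

@[simp] theorem frame_smul (u : Fin n → ℝ) (r : ℝ) (y : Fin n → ℝ) :
    frame D u (r • y) = r • frame D u y := by
  simp only [frame, map_smul, smul_apply, smul_add]

theorem frame_apply (u y : Fin n → ℝ) (γ : Fin n) : frame D u y γ = ∑ k, D.psi γ k u * y k := by
  simp only [frame, psiB, omL, MongeData.psi, Pi.add_apply, bilOf_apply, linOf_apply,
    Matrix.of_apply, ← Finset.sum_add_distrib]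
  refine Finset.sum_congr rfl fun k _ => ?_
  rw [add_mul, Finset.sum_mul]
  congr 1
  exact Finset.sum_congr rfl fun m _ => by ring

theorem psiB_single (γ k m : Fin n) : psiB D (Pi.single k 1) (Pi.single m 1) γ = D.ψ γ k m := by
  simp [psiB, bilOf_apply, Pi.single_apply]

theorem omL_single (γ k : Fin n) : omL D (Pi.single k 1) γ = D.om γ k := by
  simp [omL, linOf_apply, Pi.single_apply]

theorem etaL_single (γ k : Fin n) : etaL D (Pi.single k 1) γ = D.η γ k := by
  simp [etaL, linOf_apply, Pi.single_apply]

theorem frame_single (u : Fin n → ℝ) (γ k : Fin n) : frame D u (Pi.single k 1) γ = D.psi γ k u := by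
  simp [frame_apply, Pi.single_apply]

/-- The algebraic relations between the constants, in terms of multilinear maps. -/
structure IsMonge : Prop where
  symm : ∀ x y, phiB D x y = phiB D y x
  nondegenerate : D.φ.det ≠ 0
  skew : ∀ y z, psiB D y z = - psiB D z y
  psi_psi : ∀ y z w t, phiB D (psiB D y t) (psiB D z w) + phiB D (psiB D z t) (psiB D w y)
    + phiB D (psiB D w t) (psiB D y z) = 0
  omega_psi : ∀ y z w, phiB D (omL D y) (psiB D z w) + phiB D (omL D z) (psiB D w y)
    + phiB D (omL D w) (psiB D y z) = 0
  psi_eta : ∀ y z w, phiB D (psiB D y z) (etaL D w) + phiB D (psiB D z w) (etaL D y)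
    + phiB D (psiB D w y) (etaL D z) = 0
  psi_xi : ∀ y z, phiB D (psiB D y z) D.ξ + phiB D (omL D z) (etaL D y)
    - phiB D (omL D y) (etaL D z) = 0

/-- Reduces multilinear identities to basis vectors one argument at a time, which is how index
relations are exchanged for coordinate-free ones. -/
theorem eq_zero_of_single {F : (Fin n → ℝ) → ℝ} (ha : ∀ x y, F (x + y) = F x + F y)
    (hs : ∀ (r : ℝ) x, F (r • x) = r * F x) (h : ∀ i, F (Pi.single i 1) = 0) (y : Fin n → ℝ) :
    F y = 0 := by
  let L : (Fin n → ℝ) →ₗ[ℝ] ℝ := ⟨⟨F, ha⟩, hs⟩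
  have : L = 0 := LinearMap.pi_ext' fun i => LinearMap.ext_ring (by simpa using (show L (Pi.single i 1) = 0 from h i))
  exact LinearMap.congr_fun this y

theorem phiB_symm_iff : (∀ x y, phiB D x y = phiB D y x) ↔ D.φ.IsSymm := by
  constructor
  · intro h
    ext i j
    simpa [phiB_apply, Pi.single_apply] using h (Pi.single j 1) (Pi.single i 1)
  · intro h x y
    rw [phiB_apply, phiB_apply, Finset.sum_comm]
    refine Finset.sum_congr rfl fun β _ => Finset.sum_congr rfl fun γ _ => ?_
    rw [h.apply β γ]
    ring

theorem describes_iff {U : Set (Fin n → ℝ)} {V : (Fin n → ℝ) → (Fin n → ℝ)}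
    {g : (Fin n → ℝ) → Matrix (Fin n) (Fin n) ℝ} :
    D.Describes U V g ↔ IsMonge D ∧
      (∀ u ∈ U, ∀ y z, dotL y (linOf (g u) z) = phiB D (frame D u y) (frame D u z)) ∧
      ∀ u ∈ U, frame D u (V u) = etaL D u + D.ξ := by
  have e2 : ∀ x y, phiB D x y = ∑ β, ∑ γ, D.φ β γ * (x β * y γ) := fun x y => by
    simp only [phiB_apply, mul_assoc]
  have e4 : ∀ x y : Fin n → ℝ, ∀ z w t s : Fin n → ℝ, phiB D x y + phiB D z w + phiB D t s =
      ∑ β, ∑ γ, D.φ β γ * (x β * y γ + z β * w γ + t β * s γ) := fun x y z w t s => by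
    simp only [e2, mul_add, Finset.sum_add_distrib]
  have e5 : ∀ x y : Fin n → ℝ, ∀ z w t s : Fin n → ℝ, phiB D x y + phiB D z w - phiB D t s =
      ∑ β, ∑ γ, D.φ β γ * (x β * y γ + z β * w γ - t β * s γ) := fun x y z w t s => by
    simp only [e2, mul_add, mul_sub, Finset.sum_add_distrib, Finset.sum_sub_distrib]
  constructor
  · intro H
    refine ⟨⟨(phiB_symm_iff D).2 H.symm, H.nondegenerate, ?_, ?_, ?_, ?_, ?_⟩, ?_, ?_⟩
    · intro y z
      funext γ
      rw [← sub_eq_zero]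
      revert z
      refine fun z => eq_zero_of_single (F := fun y => psiB D y z γ - (- psiB D z y) γ) ?_ ?_ ?_ y
      · intros; simp; ring
      · intros; simp; ring
      intro k
      revert z
      refine fun z => eq_zero_of_single
        (F := fun z => psiB D (Pi.single k 1) z γ - (- psiB D z (Pi.single k 1)) γ) ?_ ?_ ?_ z
      · intros; simp; ring
      · intros; simp; ring
      intro m
      simp [psiB_single, H.skew γ k m]
    · intro y z w t
      refine eq_zero_of_single (F := fun y => phiB D (psiB D y t) (psiB D z w)
        + phiB D (psiB D z t) (psiB D w y) + phiB D (psiB D w t) (psiB D y z)) ?_ ?_ ?_ y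
      · intros; simp; ring
      · intros; simp; ring
      intro i
      refine eq_zero_of_single (F := fun z => phiB D (psiB D (Pi.single i 1) t) (psiB D z w)
        + phiB D (psiB D z t) (psiB D w (Pi.single i 1))
        + phiB D (psiB D w t) (psiB D (Pi.single i 1) z)) ?_ ?_ ?_ z
      · intros; simp; ring
      · intros; simp; ring
      intro j
      refine eq_zero_of_single (F := fun w => phiB D (psiB D (Pi.single i 1) t)
        (psiB D (Pi.single j 1) w)
        + phiB D (psiB D (Pi.single j 1) t) (psiB D w (Pi.single i 1))
        + phiB D (psiB D w t) (psiB D (Pi.single i 1) (Pi.single j 1))) ?_ ?_ ?_ w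
      · intros; simp; ring
      · intros; simp; ring
      intro k
      refine eq_zero_of_single (F := fun t => phiB D (psiB D (Pi.single i 1) t)
        (psiB D (Pi.single j 1) (Pi.single k 1))
        + phiB D (psiB D (Pi.single j 1) t) (psiB D (Pi.single k 1) (Pi.single i 1))
        + phiB D (psiB D (Pi.single k 1) t) (psiB D (Pi.single i 1) (Pi.single j 1))) ?_ ?_ ?_ t
      · intros; simp; ring
      · intros; simp; ring
      intro s
      rw [e4]
      simpa only [psiB_single] using H.psi_psi i j k s
    · intro y z w
      refine eq_zero_of_single (F := fun y => phiB D (omL D y) (psiB D z w)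
        + phiB D (omL D z) (psiB D w y) + phiB D (omL D w) (psiB D y z)) ?_ ?_ ?_ y
      · intros; simp; ring
      · intros; simp; ring
      intro i
      refine eq_zero_of_single (F := fun z => phiB D (omL D (Pi.single i 1)) (psiB D z w)
        + phiB D (omL D z) (psiB D w (Pi.single i 1))
        + phiB D (omL D w) (psiB D (Pi.single i 1) z)) ?_ ?_ ?_ z
      · intros; simp; ring
      · intros; simp; ring
      intro j
      refine eq_zero_of_single (F := fun w => phiB D (omL D (Pi.single i 1))
        (psiB D (Pi.single j 1) w)
        + phiB D (omL D (Pi.single j 1)) (psiB D w (Pi.single i 1))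
        + phiB D (omL D w) (psiB D (Pi.single i 1) (Pi.single j 1))) ?_ ?_ ?_ w
      · intros; simp; ring
      · intros; simp; ring
      intro k
      rw [e4]
      simpa only [psiB_single, omL_single] using H.omega_psi i j k
    · intro y z w
      refine eq_zero_of_single (F := fun y => phiB D (psiB D y z) (etaL D w)
        + phiB D (psiB D z w) (etaL D y) + phiB D (psiB D w y) (etaL D z)) ?_ ?_ ?_ y
      · intros; simp; ring
      · intros; simp; ring
      intro i
      refine eq_zero_of_single (F := fun z => phiB D (psiB D (Pi.single i 1) z) (etaL D w)
        + phiB D (psiB D z w) (etaL D (Pi.single i 1))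
        + phiB D (psiB D w (Pi.single i 1)) (etaL D z)) ?_ ?_ ?_ z
      · intros; simp; ring
      · intros; simp; ring
      intro j
      refine eq_zero_of_single (F := fun w => phiB D (psiB D (Pi.single i 1) (Pi.single j 1))
          (etaL D w)
        + phiB D (psiB D (Pi.single j 1) w) (etaL D (Pi.single i 1))
        + phiB D (psiB D w (Pi.single i 1)) (etaL D (Pi.single j 1))) ?_ ?_ ?_ w
      · intros; simp; ring
      · intros; simp; ring
      intro k
      rw [e4]
      simpa only [psiB_single, etaL_single] using H.psi_eta i j k
    · intro y z
      refine eq_zero_of_single (F := fun y => phiB D (psiB D y z) D.ξ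
        + phiB D (omL D z) (etaL D y) - phiB D (omL D y) (etaL D z)) ?_ ?_ ?_ y
      · intros; simp; ring
      · intros; simp; ring
      intro i
      refine eq_zero_of_single (F := fun z => phiB D (psiB D (Pi.single i 1) z) D.ξ
        + phiB D (omL D z) (etaL D (Pi.single i 1))
        - phiB D (omL D (Pi.single i 1)) (etaL D z)) ?_ ?_ ?_ z
      · intros; simp; ring
      · intros; simp; ring
      intro k
      rw [e5]
      simpa only [psiB_single, omL_single, etaL_single] using H.psi_xi i k
    · intro u hu y z
      rw [← sub_eq_zero]
      refine eq_zero_of_single (F := fun y => dotL y (linOf (g u) z)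
        - phiB D (frame D u y) (frame D u z)) ?_ ?_ ?_ y
      · intros; simp; ring
      · intros; simp; ring
      intro i
      refine eq_zero_of_single (F := fun z => dotL (Pi.single i 1) (linOf (g u) z)
        - phiB D (frame D u (Pi.single i 1)) (frame D u z)) ?_ ?_ ?_ z
      · intros; simp; ring
      · intros; simp; ring
      intro j
      rw [dotL_single, linOf_apply, phiB_apply]
      simp only [frame_single]
      simp [Pi.single_apply, H.metric_eq u hu i j]
    · intro u hu
      funext γ
      rw [frame_apply, H.flux_eq u hu γ]
      simp [etaL, linOf_apply]
  · rintro ⟨M, hg, hV⟩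
    refine ⟨(phiB_symm_iff D).1 M.symm, M.nondegenerate, ?_, ?_, ?_, ?_, ?_, ?_, ?_⟩
    · intro γ k m
      rw [← psiB_single, M.skew, Pi.neg_apply, psiB_single]
    · intro i j k s
      simpa only [e4, psiB_single] using
        M.psi_psi (Pi.single i 1) (Pi.single j 1) (Pi.single k 1) (Pi.single s 1)
    · intro i j k
      simpa only [e4, psiB_single, omL_single] using
        M.omega_psi (Pi.single i 1) (Pi.single j 1) (Pi.single k 1)
    · intro i j k
      simpa only [e4, psiB_single, etaL_single] using
        M.psi_eta (Pi.single i 1) (Pi.single j 1) (Pi.single k 1)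
    · intro i k
      simpa only [e5, psiB_single, etaL_single, omL_single] using
        M.psi_xi (Pi.single i 1) (Pi.single k 1)
    · intro u hu i j
      have := hg u hu (Pi.single i 1) (Pi.single j 1)
      rw [dotL_single, linOf_apply, phiB_apply] at this
      simp only [frame_single] at this
      simpa [Pi.single_apply] using this
    · intro u hu γ
      rw [← frame_apply, hV u hu]
      simp [etaL, linOf_apply]

end

end

section

/-! ### The flat frame of a Hamiltonian operator -/

variable {n : ℕ}

theorem eq_sum_single (y : Fin n → ℝ) : y = ∑ i, y i • (Pi.single i (1 : ℝ) : Fin n → ℝ) := by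
  funext j
  simp [Finset.sum_apply, Pi.single_apply]

theorem linOf_coeff (L : (Fin n → ℝ) →L[ℝ] (Fin n → ℝ)) :
    linOf (Matrix.of fun i j => L (Pi.single j 1) i) = L := by
  ext1 y
  funext i
  rw [linOf_apply]
  conv_rhs => rw [eq_sum_single y]
  simp [Finset.sum_apply, mul_comm]

theorem bilOf_coeff (B : (Fin n → ℝ) →L[ℝ] (Fin n → ℝ) →L[ℝ] (Fin n → ℝ)) :
    bilOf (fun r j k => B (Pi.single j 1) (Pi.single k 1) r) = B := by
  ext1 y
  ext1 z
  funext i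
  rw [bilOf_apply]
  conv_rhs => rw [eq_sum_single y, eq_sum_single z]
  simp [Finset.sum_apply, sum_apply, Finset.mul_sum, mul_comm, mul_left_comm]
  exact Finset.sum_comm

theorem eventually_add_smul_mem {U : Set (Fin n → ℝ)} (hU : IsOpen U) {u : Fin n → ℝ} (hu : u ∈ U)
    (v : Fin n → ℝ) : ∀ᶠ ε : ℝ in 𝓝 0, u + ε • v ∈ U := by
  have ht : Tendsto (fun ε : ℝ => u + ε • v) (𝓝 0) (𝓝 u) := by
    have : Continuous fun ε : ℝ => u + ε • v := by fun_prop
    simpa using this.tendsto 0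
  exact ht.eventually (hU.mem_nhds hu)

theorem exists_add_smul_mem {U : Set (Fin n → ℝ)} (hU : IsOpen U) {u : Fin n → ℝ} (hu : u ∈ U)
    (v : Fin n → ℝ) : ∃ ε : ℝ, 0 < ε ∧ u + ε • v ∈ U := by
  have h := (eventually_add_smul_mem hU hu v).filter_mono (nhdsWithin_le_nhds (s := Ioi 0))
  obtain ⟨ε, h1, h2⟩ := (h.and self_mem_nhdsWithin).exists
  exact ⟨ε, h2, h1⟩

/-- An identity affine in $u$ on an open set splits into its linear and constant parts. This is what
separates relations for $\psi$ from those for $\omega$, and relations for $\eta$ from those for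
$\xi$. -/
theorem affine_eq_zero {U : Set (Fin n → ℝ)} (hU : IsOpen U) {u : Fin n → ℝ} (hu : u ∈ U)
    {A : (Fin n → ℝ) → ℝ} (ha : ∀ x y, A (x + y) = A x + A y) (hs : ∀ (r : ℝ) x, A (r • x) = r * A x)
    {B : ℝ} (h : ∀ w ∈ U, A w + B = 0) : (∀ t, A t = 0) ∧ B = 0 := by
  have h1 : ∀ t, A t = 0 := by
    intro t
    obtain ⟨ε, hε, hm⟩ := exists_add_smul_mem hU hu t
    have e1 := h _ hm
    have e2 := h u hu
    rw [ha, hs] at e1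
    have : ε * A t = 0 := by linarith
    exact (mul_eq_zero.1 this).resolve_left hε.ne'
  refine ⟨h1, ?_⟩
  have := h u hu
  rw [h1] at this
  linarith

/-- The constants `φ`, `ψ`, `ω` of `D` provide a flat frame for the connection `h` and the
metric `g`. -/
structure IsFlatFrame (D : MongeData n) (U : Set (Fin n → ℝ))
    (g : (Fin n → ℝ) → (Fin n → ℝ) →L[ℝ] (Fin n → ℝ))
    (h : (Fin n → ℝ) → (Fin n → ℝ) →L[ℝ] (Fin n → ℝ) →L[ℝ] (Fin n → ℝ)) : Prop where
  symm : ∀ x y, phiB D x y = phiB D y x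
  nondegenerate : D.φ.det ≠ 0
  skew : ∀ y z, psiB D y z = - psiB D z y
  psi_psi : ∀ y z w t, phiB D (psiB D y t) (psiB D z w) + phiB D (psiB D z t) (psiB D w y)
    + phiB D (psiB D w t) (psiB D y z) = 0
  omega_psi : ∀ y z w, phiB D (omL D y) (psiB D z w) + phiB D (omL D z) (psiB D w y)
    + phiB D (omL D w) (psiB D y z) = 0
  metric : ∀ u ∈ U, ∀ y z, dotL y (g u z) = phiB D (frame D u y) (frame D u z)
  frame_torsion : ∀ u ∈ U, ∀ y z, frame D u (h u y z) = psiB D y z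

theorem phiB_nondegenerate {D : MongeData n} (hD : D.φ.det ≠ 0) {y z : Fin n → ℝ}
    (h : ∀ x, phiB D x y = phiB D x z) : y = z := by
  rw [← linOf_inv_apply hD y, ← linOf_inv_apply hD z, eq_of_dotL h]

section

variable {U : Set (Fin n → ℝ)} {G g : (Fin n → ℝ) → (Fin n → ℝ) →L[ℝ] (Fin n → ℝ)}
  {c h : (Fin n → ℝ) → (Fin n → ℝ) →L[ℝ] (Fin n → ℝ) →L[ℝ] (Fin n → ℝ)}
  (H : IsFlatOp U G c h) (hg : ContDiffOn ℝ ∞ g U) (hGg : ∀ u ∈ U, ∀ y, G u (g u y) = y)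

namespace IsFlatOp

include H

/-- `curv` is by definition the covariant derivative of $h(y,z)$ for constant $y,z$. -/
theorem parallel_torsion {u : Fin n → ℝ} (hu : u ∈ U) (y z : Fin n → ℝ) :
    HasFDerivAt (fun w => h w y z) (-(h u (h u y z))) u := by
  have dh := hasFDerivAt_of_contDiffOn H.isOpen H.smooth_h hu
  have := (dh.clm_apply (hasFDerivAt_const y u)).clm_apply (hasFDerivAt_const z u)
  refine this.congr_fderiv ?_
  ext1 l
  have e := H.flat u hu l y z
  rw [curv] at e
  simp [eq_neg_of_add_eq_zero_left e]

/-- Differentiating the factor $w-u$ contributes $-h(y,l)$, exactly the connection term of the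
constant field $y$. The remaining terms cancel because $h(y,z)$ is parallel for constant $z$. -/
theorem parallel_frame {u : Fin n → ℝ} (hu : u ∈ U) (y w : Fin n → ℝ) :
    HasFDerivAt (fun u => y + h u y (w - u)) (-(h u (y + h u y (w - u)))) u := by
  have dh := hasFDerivAt_of_contDiffOn H.isOpen H.smooth_h hu
  have := ((dh.clm_apply (hasFDerivAt_const y u)).clm_apply
    ((hasFDerivAt_const w u).sub (hasFDerivAt_id u))).const_add y
  refine this.congr_fderiv ?_
  ext1 l
  have e := H.flat u hu l y (w - u)
  rw [curv] at e
  simp only [map_sub, sub_apply] at e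
  simp
  rw [← sub_eq_zero, ← e]
  abel

include hGg

theorem metric_symm {u : Fin n → ℝ} (hu : u ∈ U) (y z : Fin n → ℝ) :
    dotL y (g u z) = dotL z (g u y) := by
  have := H.symm u hu (g u y) (g u z)
  rw [hGg u hu, hGg u hu, dotL_comm _ z, dotL_comm _ y] at this
  exact this.symm

include hg

/-- Obtained by differentiating $Gg=1$ and inserting `compat`: the metric inverse to $G$ is
covariantly constant. -/
theorem fderiv_metric {u : Fin n → ℝ} (hu : u ∈ U) (l y z : Fin n → ℝ) :
    dotL z (fderiv ℝ g u l y) = dotL (h u z l) (g u y) + dotL z (g u (h u y l)) := by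
  have dG := hasDerivAt_add_smul (hasFDerivAt_of_contDiffOn H.isOpen H.smooth_G hu) l
  have dg := hasDerivAt_add_smul (hasFDerivAt_of_contDiffOn H.isOpen hg hu) l
  have d1 := dG.clm_apply (dg.clm_apply (hasDerivAt_const (0 : ℝ) y))
  have hev : (fun ε : ℝ => G (u + ε • l) (g (u + ε • l) y)) =ᶠ[𝓝 0] fun _ => y := by
    filter_upwards [eventually_add_smul_mem H.isOpen hu l] with ε hε using hGg _ hε y
  have e := d1.unique ((hasDerivAt_const (0 : ℝ) y).congr_of_eventuallyEq hev)
  simp only [zero_smul, add_zero, map_zero] at e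
  have e1 := congrArg (dotL (g u z)) e
  rw [map_add, map_zero, H.compat u hu, map_sub, H.rel u hu, H.symm u hu, hGg u hu, hGg u hu,
    dotL_comm _ z, dotL_comm (g u y), dotL_comm (g u z),
    metric_symm H hGg hu (h u y l) z] at e1
  linarith

theorem const_of_parallel (hU : IsPreconnected U) {Y Z : (Fin n → ℝ) → Fin n → ℝ}
    (hY : ∀ u ∈ U, DifferentiableAt ℝ Y u) (hZ : ∀ u ∈ U, DifferentiableAt ℝ Z u)
    (hY' : ∀ u ∈ U, ∀ l, fderiv ℝ Y u l = - h u (Y u) l)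
    (hZ' : ∀ u ∈ U, ∀ l, fderiv ℝ Z u l = - h u (Z u) l) {u v : Fin n → ℝ} (hu : u ∈ U)
    (hv : v ∈ U) : dotL (Y u) (g u (Z u)) = dotL (Y v) (g v (Z v)) := by
  have hd : ∀ w ∈ U, HasFDerivAt (fun w => dotL (Y w) (g w (Z w)))
      (0 : (Fin n → ℝ) →L[ℝ] ℝ) w := by
    intro w hw
    have dg := hasFDerivAt_of_contDiffOn H.isOpen hg hw
    have d2 := ((dotL (n := n)).hasFDerivAt.comp w (hY w hw).hasFDerivAt).clm_apply
      (dg.clm_apply (hZ w hw).hasFDerivAt)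
    refine d2.congr_fderiv ?_
    ext1 l
    have e1 := H.fderiv_metric hg hGg hw l (Z w) (Y w)
    simp [hY' w hw, hZ' w hw, e1]
  refine H.isOpen.is_const_of_fderiv_eq_zero hU
    (fun w hw => (hd w hw).differentiableAt.differentiableWithinAt) (fun w hw => ?_) hu hv
  exact (hd w hw).fderiv

end IsFlatOp

end

/-- Inner products of parallel fields are compared at $u$ and at a base point $v$. The fields from
`parallel_frame` give the metric, and pairing them with those from `parallel_torsion` gives the
torsion. The cyclic identity, affine in $u$ once written in the frame, splits into the two quadratic
relations. -/
theorem exists_flatFrame {U : Set (Fin n → ℝ)} (hU : IsConnected U)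
    {G : (Fin n → ℝ) → Matrix (Fin n) (Fin n) ℝ}
    {c h : (Fin n → ℝ) → (Fin n → ℝ) →L[ℝ] (Fin n → ℝ) →L[ℝ] (Fin n → ℝ)}
    (smooth_G : ∀ i j, ContDiffOn ℝ ∞ (fun u => G u i j) U)
    (nondegenerate : ∀ u ∈ U, (G u).det ≠ 0)
    (H : IsFlatOp U (opG G) c h) :
    ∃ D : MongeData n, IsFlatFrame D U (fun u => linOf (G u)⁻¹) h := by
  obtain ⟨v, hv⟩ := hU.nonempty
  have hg : ContDiffOn ℝ ∞ (fun u => linOf (G u)⁻¹) U :=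
    contDiffOn_linOf fun i j => contDiffOn_inv smooth_G nondegenerate i j
  have hGg : ∀ u ∈ U, ∀ y, opG G u (linOf (G u)⁻¹ y) = y := fun u hu y =>
    linOf_apply_inv (nondegenerate u hu) y
  let L : (Fin n → ℝ) →L[ℝ] (Fin n → ℝ) := ContinuousLinearMap.id ℝ _ - (h v).flip v
  -- $\phi$ is the metric at $v$, $\psi$ the torsion at $v$, and $\omega$ is chosen so that the
  -- frame at $v$ is the identity. The zeros for $\eta$ and $\xi$ are placeholders, which
  -- `IsFlatFrame` does not see.
  let D : MongeData n := ⟨(G v)⁻¹, fun r j k => h v (Pi.single j 1) (Pi.single k 1) r,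
    fun i j => L (Pi.single j 1) i, 0, 0⟩
  have hψ : psiB D = h v := bilOf_coeff (h v)
  have hω : omL D = L := linOf_coeff L
  have hφ : ∀ x y, phiB D x y = dotL x (linOf (G v)⁻¹ y) := fun x y => rfl
  have hfr : ∀ w y, frame D w y = y + h v y (w - v) := fun w y => by
    rw [frame, hψ, hω]
    simp [L]
    abel
  have hmet : ∀ u ∈ U, ∀ y z, dotL y (linOf (G u)⁻¹ z) = phiB D (frame D u y) (frame D u z) := by
    intro u hu y z
    have := H.const_of_parallel hg hGg hU.isPreconnected
      -- At $w=u$ these fields are $y$ and $z$; at $w=v$ they are `frame D u y` and `frame D u z`.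
      (Y := fun w => y + h w y (u - w)) (Z := fun w => z + h w z (u - w))
      (fun w hw => (H.parallel_frame hw y u).differentiableAt)
      (fun w hw => (H.parallel_frame hw z u).differentiableAt)
      (fun w hw l => by rw [(H.parallel_frame hw y u).fderiv]; rfl)
      (fun w hw l => by rw [(H.parallel_frame hw z u).fderiv]; rfl) hu hv
    simpa [hφ, hfr] using this
  have htor : ∀ u ∈ U, ∀ y z k, dotL y (linOf (G u)⁻¹ (h u z k))
      = phiB D (frame D u y) (psiB D z k) := by
    intro u hu y z k
    have := H.const_of_parallel hg hGg hU.isPreconnected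
      (Y := fun w => y + h w y (u - w)) (Z := fun w => h w z k)
      (fun w hw => (H.parallel_frame hw y u).differentiableAt)
      (fun w hw => (H.parallel_torsion hw z k).differentiableAt)
      (fun w hw l => by rw [(H.parallel_frame hw y u).fderiv]; rfl)
      (fun w hw l => by rw [(H.parallel_torsion hw z k).fderiv]; rfl) hu hv
    simpa [hφ, hfr, hψ] using this
  have hsymm : ∀ x y, phiB D x y = phiB D y x := fun x y => H.metric_symm hGg hv x y
  have hdet : D.φ.det ≠ 0 := by
    have := Matrix.isUnit_nonsing_inv_det _ (isUnit_iff_ne_zero.2 (nondegenerate v hv))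
    exact this.ne_zero
  have hinj : ∀ u ∈ U, Function.Injective (linOf (D.φ) ∘ frame D u) := by
    intro u hu y z hyz
    have : linOf (G u)⁻¹ y = linOf (G u)⁻¹ z := by
      apply eq_of_dotL
      intro x
      rw [hmet u hu, hmet u hu]
      exact congrArg (dotL (frame D u x)) hyz
    rw [← linOf_apply_inv (nondegenerate u hu) y, this, linOf_apply_inv (nondegenerate u hu)]
  have hsurj : ∀ u ∈ U, Function.Surjective (frame D u) := by
    intro u hu
    let Lf : (Fin n → ℝ) →ₗ[ℝ] (Fin n → ℝ) := ⟨⟨frame D u, frame_add D u⟩, frame_smul D u⟩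
    exact LinearMap.surjective_of_injective (f := Lf) (Function.Injective.of_comp (hinj u hu))
  have hcyc : ∀ u ∈ U, ∀ y z k, phiB D (frame D u y) (psiB D z k)
      + phiB D (frame D u z) (psiB D k y) + phiB D (frame D u k) (psiB D y z) = 0 := by
    intro u hu y z k
    have := H.cyclic u hu (linOf (G u)⁻¹ y) (linOf (G u)⁻¹ z) (linOf (G u)⁻¹ k)
    rw [hGg u hu, hGg u hu, hGg u hu] at this
    rw [← htor u hu, ← htor u hu, ← htor u hu, H.metric_symm hGg hu, H.metric_symm hGg hu z,
      H.metric_symm hGg hu k, dotL_comm _ (linOf _ y), dotL_comm _ (linOf _ z),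
      dotL_comm _ (linOf _ k)]
    exact this
  have hskew : ∀ y z, psiB D y z = - psiB D z y := by
    rw [hψ]
    exact H.antisymm v hv
  have haff : ∀ y z k, (∀ t, phiB D (psiB D y t) (psiB D z k) + phiB D (psiB D z t) (psiB D k y)
      + phiB D (psiB D k t) (psiB D y z) = 0) ∧ phiB D (omL D y) (psiB D z k)
      + phiB D (omL D z) (psiB D k y) + phiB D (omL D k) (psiB D y z) = 0 := by
    intro y z k
    refine affine_eq_zero H.isOpen hv (A := fun t => phiB D (psiB D y t) (psiB D z k)
      + phiB D (psiB D z t) (psiB D k y) + phiB D (psiB D k t) (psiB D y z)) ?_ ?_ ?_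
    · intros; simp; ring
    · intros; simp; ring
    · intro w hw
      have := hcyc w hw y z k
      simp only [frame, phiB_add_left] at this
      linarith
  exact ⟨D, {
    symm := hsymm
    nondegenerate := hdet
    skew := hskew
    psi_psi := fun y z w t => (haff y z w).1 t
    omega_psi := fun y z w => (haff y z w).2
    metric := hmet
    frame_torsion := fun u hu y z => by
      apply phiB_nondegenerate hdet
      intro x
      obtain ⟨x, rfl⟩ := hsurj u hu x
      rw [← hmet u hu, htor u hu] }⟩

end

section

/-! ### The Hamiltonian operator of Monge data -/

variable {n : ℕ} (D : MongeData n)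

/-- The metric `φ_{βγ} ψ^β_i ψ^γ_j`. -/
def mongeMetric (u : Fin n → ℝ) : Matrix (Fin n) (Fin n) ℝ :=
  Matrix.of fun i j => ∑ β, ∑ γ, D.φ β γ * D.psi β i u * D.psi γ j u

/-- The symbols of the flat connection defined by the frame `ψ^γ_k`. -/
def mongeSymbol (u : Fin n → ℝ) (r j k : Fin n) : ℝ :=
  ∑ s, (mongeMetric D u)⁻¹ r s * ∑ β, ∑ γ, D.φ β γ * D.psi β s u * D.ψ γ j k

/-- The coefficients `c^{ij}_k` of the Hamiltonian operator. -/
def mongeCoeff (u : Fin n → ℝ) (i j k : Fin n) : ℝ :=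
  - ∑ a, (mongeMetric D u)⁻¹ a i * mongeSymbol D u j a k

theorem dotL_mongeMetric (u y z : Fin n → ℝ) :
    dotL y (linOf (mongeMetric D u) z) = phiB D (frame D u y) (frame D u z) := by
  rw [← sub_eq_zero]
  refine eq_zero_of_single (F := fun y => dotL y (linOf (mongeMetric D u) z)
    - phiB D (frame D u y) (frame D u z)) ?_ ?_ ?_ y
  · intros; simp; ring
  · intros; simp; ring
  intro i
  refine eq_zero_of_single (F := fun z => dotL (Pi.single i 1) (linOf (mongeMetric D u) z)
    - phiB D (frame D u (Pi.single i 1)) (frame D u z)) ?_ ?_ ?_ z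
  · intros; simp; ring
  · intros; simp; ring
  intro j
  rw [dotL_single, linOf_apply, phiB_apply]
  simp only [frame_single]
  simp [Pi.single_apply, mongeMetric]

theorem contDiff_psi (γ k : Fin n) : ContDiff ℝ ∞ (D.psi γ k) := by
  unfold MongeData.psi
  fun_prop

theorem contDiff_mongeMetric (i j : Fin n) : ContDiff ℝ ∞ fun u => mongeMetric D u i j := by
  have := contDiff_psi D
  simp only [mongeMetric, Matrix.of_apply]
  exact ContDiff.sum fun β _ => ContDiff.sum fun γ _ => (contDiff_const.mul (this β i)).mul (this γ j)

variable {D} {U : Set (Fin n → ℝ)}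

theorem contDiffOn_mongeMetric_inv (h0 : ∀ u ∈ U, (mongeMetric D u).det ≠ 0) (i j : Fin n) :
    ContDiffOn ℝ ∞ (fun u => (mongeMetric D u)⁻¹ i j) U :=
  contDiffOn_inv (fun i j => (contDiff_mongeMetric D i j).contDiffOn) h0 i j

theorem contDiffOn_mongeSymbol (h0 : ∀ u ∈ U, (mongeMetric D u).det ≠ 0) (r j k : Fin n) :
    ContDiffOn ℝ ∞ (fun u => mongeSymbol D u r j k) U := by
  have := contDiff_psi D
  exact ContDiffOn.sum fun s _ => (contDiffOn_mongeMetric_inv h0 r s).mul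
    (ContDiff.sum fun β _ => ContDiff.sum fun γ _ =>
      (contDiff_const.mul (this β s)).mul contDiff_const).contDiffOn

theorem contDiffOn_mongeCoeff (h0 : ∀ u ∈ U, (mongeMetric D u).det ≠ 0) (i j k : Fin n) :
    ContDiffOn ℝ ∞ (fun u => mongeCoeff D u i j k) U :=
  (ContDiffOn.sum fun a _ => (contDiffOn_mongeMetric_inv h0 a i).mul
    (contDiffOn_mongeSymbol h0 j a k)).neg

/-- The linear map `frame D u`. -/
def frameL (D : MongeData n) (u : Fin n → ℝ) : (Fin n → ℝ) →L[ℝ] (Fin n → ℝ) :=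
  (psiB D).flip u + omL D

theorem frameL_apply (u y : Fin n → ℝ) : frameL D u y = frame D u y := rfl

theorem hasFDerivAt_frame (u y : Fin n → ℝ) : HasFDerivAt (fun u => frame D u y) (psiB D y) u :=
  (psiB D y).hasFDerivAt.add_const _

theorem hasFDerivAt_frameL (u : Fin n → ℝ) : HasFDerivAt (frameL D) (psiB D).flip u :=
  (psiB D).flip.hasFDerivAt.add_const _

theorem contDiff_frameL : ContDiff ℝ ∞ (frameL D) :=
  (psiB D).flip.contDiff.add contDiff_const

theorem frame_injective {u : Fin n → ℝ} (h0 : (mongeMetric D u).det ≠ 0) :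
    Function.Injective (frame D u) := by
  intro y z hyz
  have : linOf (mongeMetric D u) y = linOf (mongeMetric D u) z := by
    apply eq_of_dotL
    intro x
    rw [dotL_mongeMetric, dotL_mongeMetric, hyz]
  rw [← linOf_inv_apply h0 y, this, linOf_inv_apply h0]

theorem frame_surjective {u : Fin n → ℝ} (h0 : (mongeMetric D u).det ≠ 0) :
    Function.Surjective (frame D u) :=
  LinearMap.surjective_of_injective (f := (frameL D u : (Fin n → ℝ) →ₗ[ℝ] (Fin n → ℝ)))
    (frame_injective h0)

/-- The symbol solves $g(x,h(y,z))=\phi(\mathrm{frame}\,x,\psi(y,z))$ for all $x$. Since $g$ is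
$\phi$ in the frame and the frame is surjective, the frame can be stripped off by non-degeneracy of
$\phi$. -/
theorem frame_mongeSymbol (hD : D.φ.det ≠ 0) {u : Fin n → ℝ}
    (h0 : (mongeMetric D u).det ≠ 0) (y z : Fin n → ℝ) :
    frame D u (bilOf (mongeSymbol D u) y z) = psiB D y z := by
  apply phiB_nondegenerate hD
  intro x
  obtain ⟨x, rfl⟩ := frame_surjective h0 x
  rw [← dotL_mongeMetric]
  let lam : Fin n → ℝ := fun s => phiB D (frame D u (Pi.single s 1)) (psiB D y z)
  have h1 : bilOf (mongeSymbol D u) y z = linOf (mongeMetric D u)⁻¹ lam := by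
    funext r
    simp only [bilOf_apply, linOf_apply, lam, phiB_apply, frame_single, mongeSymbol, psiB,
      Finset.mul_sum, Finset.sum_mul]
    calc _ = ∑ j, ∑ s, ∑ k, ∑ β, ∑ γ, (mongeMetric D u)⁻¹ r s *
          (D.φ β γ * D.psi β s u * D.ψ γ j k) * y j * z k :=
        Finset.sum_congr rfl fun j _ => Finset.sum_comm
      _ = ∑ s, ∑ j, ∑ k, ∑ β, ∑ γ, (mongeMetric D u)⁻¹ r s *
          (D.φ β γ * D.psi β s u * D.ψ γ j k) * y j * z k := Finset.sum_comm
      _ = _ := Finset.sum_congr rfl fun s _ => ?_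
    calc _ = ∑ j, ∑ β, ∑ k, ∑ γ, (mongeMetric D u)⁻¹ r s *
          (D.φ β γ * D.psi β s u * D.ψ γ j k) * y j * z k :=
        Finset.sum_congr rfl fun j _ => Finset.sum_comm
      _ = ∑ β, ∑ j, ∑ k, ∑ γ, (mongeMetric D u)⁻¹ r s *
          (D.φ β γ * D.psi β s u * D.ψ γ j k) * y j * z k := Finset.sum_comm
      _ = ∑ β, ∑ j, ∑ γ, ∑ k, (mongeMetric D u)⁻¹ r s *
          (D.φ β γ * D.psi β s u * D.ψ γ j k) * y j * z k :=
        Finset.sum_congr rfl fun β _ => Finset.sum_congr rfl fun j _ => Finset.sum_comm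
      _ = ∑ β, ∑ γ, ∑ j, ∑ k, (mongeMetric D u)⁻¹ r s *
          (D.φ β γ * D.psi β s u * D.ψ γ j k) * y j * z k :=
        Finset.sum_congr rfl fun β _ => Finset.sum_comm
      _ = _ := Finset.sum_congr rfl fun β _ => Finset.sum_congr rfl fun γ _ =>
        Finset.sum_congr rfl fun j _ => Finset.sum_congr rfl fun k _ => by ring
  rw [h1, linOf_apply_inv h0, ← sub_eq_zero]
  refine eq_zero_of_single (F := fun x => dotL x lam - phiB D (frame D u x) (psiB D y z)) ?_ ?_ ?_ x
  · intros; simp; ring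
  · intros; simp; ring
  · intro i
    simp [dotL_single, lam]

theorem dotL_mongeCoeff (u α γ w : Fin n → ℝ) :
    dotL α (opC (mongeCoeff D) u w γ) =
      - dotL γ (bilOf (mongeSymbol D u) (linOf (mongeMetric D u)⁻¹ α) w) := by
  simp only [dotL_apply, opC, bilOf_apply, linOf_apply, mongeCoeff, neg_mul, mul_neg,
    Finset.sum_neg_distrib, neg_inj, Finset.mul_sum, Finset.sum_mul]
  calc _ = ∑ i, ∑ j, ∑ k, ∑ a, α i * ((mongeMetric D u)⁻¹ a i * mongeSymbol D u j a k * w k * γ j) :=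
        Finset.sum_congr rfl fun i _ => Finset.sum_comm
    _ = ∑ j, ∑ i, ∑ k, ∑ a, α i * ((mongeMetric D u)⁻¹ a i * mongeSymbol D u j a k * w k * γ j) :=
        Finset.sum_comm
    _ = ∑ j, ∑ i, ∑ a, ∑ k, α i * ((mongeMetric D u)⁻¹ a i * mongeSymbol D u j a k * w k * γ j) :=
        Finset.sum_congr rfl fun j _ => Finset.sum_congr rfl fun i _ => Finset.sum_comm
    _ = ∑ j, ∑ a, ∑ i, ∑ k, α i * ((mongeMetric D u)⁻¹ a i * mongeSymbol D u j a k * w k * γ j) :=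
        Finset.sum_congr rfl fun j _ => Finset.sum_comm
    _ = ∑ j, ∑ a, ∑ k, ∑ i, α i * ((mongeMetric D u)⁻¹ a i * mongeSymbol D u j a k * w k * γ j) :=
        Finset.sum_congr rfl fun j _ => Finset.sum_congr rfl fun a _ => Finset.sum_comm
    _ = _ := Finset.sum_congr rfl fun j _ => Finset.sum_congr rfl fun a _ =>
        Finset.sum_congr rfl fun k _ => Finset.sum_congr rfl fun i _ => by ring

/-- All properties follow from `frame_mongeSymbol` by applying the injective frame. The
skew-symmetry of $h$ is that of $\psi$, and the cyclic identity is `psi_psi` plus `omega_psi`.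
Compatibility comes from the derivative of $\phi(\mathrm{frame}\,x,\mathrm{frame}\,y)$. -/
theorem isFlatOp_monge (hU : IsOpen U) (hD : IsMonge D)
    (h0 : ∀ u ∈ U, (mongeMetric D u).det ≠ 0) :
    IsFlatOp U (opG fun u => (mongeMetric D u)⁻¹) (opC (mongeCoeff D))
      (fun u => bilOf (mongeSymbol D u)) := by
  have smooth_G : ContDiffOn ℝ ∞ (opG fun u => (mongeMetric D u)⁻¹) U :=
    contDiffOn_linOf fun i j => contDiffOn_mongeMetric_inv h0 i j
  have smooth_c : ContDiffOn ℝ ∞ (opC (mongeCoeff D)) U :=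
    contDiffOn_bilOf fun i k j => contDiffOn_mongeCoeff h0 i j k
  have smooth_h : ContDiffOn ℝ ∞ (fun u => bilOf (mongeSymbol D u)) U :=
    contDiffOn_bilOf fun r j k => contDiffOn_mongeSymbol h0 r j k
  have fr : ∀ u ∈ U, ∀ y z, frame D u (bilOf (mongeSymbol D u) y z) = psiB D y z := fun u hu =>
    frame_mongeSymbol hD.nondegenerate (h0 u hu)
  have gsymm : ∀ u y z, dotL y (linOf (mongeMetric D u) z) = dotL z (linOf (mongeMetric D u) y) :=
    fun u y z => by rw [dotL_mongeMetric, dotL_mongeMetric, hD.symm]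
  have repr : ∀ u ∈ U, ∀ α, ∃ y, α = linOf (mongeMetric D u) y := fun u hu α =>
    ⟨linOf (mongeMetric D u)⁻¹ α, (linOf_apply_inv (h0 u hu) α).symm⟩
  have Gg : ∀ u ∈ U, ∀ y, opG (fun u => (mongeMetric D u)⁻¹) u (linOf (mongeMetric D u) y) = y :=
    fun u hu y => linOf_inv_apply (h0 u hu) y
  have sym : ∀ u ∈ U, ∀ α γ, dotL α (opG (fun u => (mongeMetric D u)⁻¹) u γ)
      = dotL γ (opG (fun u => (mongeMetric D u)⁻¹) u α) := by
    intro u hu α γ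
    obtain ⟨y, rfl⟩ := repr u hu α
    obtain ⟨z, rfl⟩ := repr u hu γ
    rw [Gg u hu, Gg u hu, dotL_comm _ z, dotL_comm _ y, gsymm]
  have rel : ∀ u ∈ U, ∀ α γ w, dotL α (opC (mongeCoeff D) u w γ) =
      - dotL γ (bilOf (mongeSymbol D u) (opG (fun u => (mongeMetric D u)⁻¹) u α) w) :=
    fun u hu α γ w => dotL_mongeCoeff u α γ w
  exact
    { isOpen := hU
      smooth_G := smooth_G
      smooth_c := smooth_c
      smooth_h := smooth_h
      symm := sym
      rel := rel
      compat := by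
        intro u hu v α
        obtain ⟨y, rfl⟩ := repr u hu α
        apply eq_of_dotL
        intro z
        obtain ⟨x, rfl⟩ := repr u hu z
        have dG := hasDerivAt_add_smul (hasFDerivAt_of_contDiffOn hU smooth_G hu) v
        have sg : ContDiffOn ℝ ∞ (fun u => linOf (mongeMetric D u)) U :=
          contDiffOn_linOf fun i j => (contDiff_mongeMetric D i j).contDiffOn
        have dg := hasDerivAt_add_smul (hasFDerivAt_of_contDiffOn hU sg hu) v
        have d1 := dG.clm_apply (dg.clm_apply (hasDerivAt_const (0 : ℝ) y))
        have hev : (fun ε : ℝ => opG (fun u => (mongeMetric D u)⁻¹) (u + ε • v)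
            (linOf (mongeMetric D (u + ε • v)) y)) =ᶠ[𝓝 0] fun _ => y := by
          filter_upwards [eventually_add_smul_mem hU hu v] with ε hε using Gg _ hε y
        have e := d1.unique ((hasDerivAt_const (0 : ℝ) y).congr_of_eventuallyEq hev)
        simp only [zero_smul, add_zero, map_zero] at e
        have hm : dotL x (fderiv ℝ (fun u => linOf (mongeMetric D u)) u v y)
            = phiB D (psiB D x v) (frame D u y) + phiB D (frame D u x) (psiB D y v) := by
          have e1 := hasDerivAt_dotL_const x (dg.clm_apply (hasDerivAt_const (0 : ℝ) y))
          have f1 := hasDerivAt_add_smul (hasFDerivAt_frame (D := D) u x) v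
          have f2 := hasDerivAt_add_smul (hasFDerivAt_frame (D := D) u y) v
          have f3 := hasDerivAt_dotL f1 ((linOf D.φ).hasFDerivAt.comp_hasDerivAt (0 : ℝ) f2)
          have hfun : (fun ε : ℝ => dotL x (linOf (mongeMetric D (u + ε • v)) y)) =
              fun ε : ℝ => dotL (frame D (u + ε • v) x) (linOf D.φ (frame D (u + ε • v) y)) :=
            funext fun ε => dotL_mongeMetric D _ _ _
          rw [hfun] at e1
          have := e1.unique f3
          simpa [phiB] using this
        have e2 := congrArg (dotL (linOf (mongeMetric D u) x)) e
        rw [map_add, map_zero, sym u hu _ (fderiv ℝ (fun u => linOf (mongeMetric D u)) u v y),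
          Gg u hu, dotL_comm _ x, hm] at e2
        rw [map_sub, rel u hu, Gg u hu, Gg u hu, dotL_comm _ (bilOf _ _ _), dotL_comm _ (bilOf _ _ _),
          dotL_mongeMetric, dotL_mongeMetric, fr u hu, fr u hu]
        rw [hD.symm (frame D u x)] at e2
        linarith
      surj := fun u hu y => ⟨_, Gg u hu y⟩
      antisymm := by
        intro u hu y z
        apply frame_injective (h0 u hu)
        have := frameL_apply (D := D) u (-(bilOf (mongeSymbol D u) z y))
        rw [← this, map_neg, frameL_apply, fr u hu, fr u hu, hD.skew]
      cyclic := by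
        have key : ∀ u ∈ U, ∀ x y z, dotL (linOf (mongeMetric D u) x)
            (bilOf (mongeSymbol D u) y z) = phiB D (psiB D x u) (psiB D y z)
              + phiB D (omL D x) (psiB D y z) := fun u hu x y z => by
          rw [dotL_comm, dotL_mongeMetric, fr u hu, hD.symm, frame, phiB_add_left]
        intro u hu l m k
        obtain ⟨x, rfl⟩ := repr u hu l
        obtain ⟨y, rfl⟩ := repr u hu m
        obtain ⟨z, rfl⟩ := repr u hu k
        rw [Gg u hu, Gg u hu, Gg u hu, key u hu, key u hu, key u hu]
        linarith [hD.psi_psi x y z u, hD.omega_psi x y z]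
      flat := by
        intro u hu l y z
        apply frame_injective (h0 u hu)
        have dh := hasDerivAt_add_smul (hasFDerivAt_of_contDiffOn hU smooth_h hu) l
        have d1 := (dh.clm_apply (hasDerivAt_const (0 : ℝ) y)).clm_apply (hasDerivAt_const (0 : ℝ) z)
        have d2 := (hasDerivAt_add_smul (hasFDerivAt_frameL (D := D) u) l).clm_apply d1
        -- The frame sends $h(y,z)$ to a constant. Differentiating this along $l$ gives the frame
        -- image of `curv`.
        have hev : (fun ε : ℝ => frameL D (u + ε • l) (bilOf (mongeSymbol D (u + ε • l)) y z))
            =ᶠ[𝓝 0] fun _ => psiB D y z := by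
          filter_upwards [eventually_add_smul_mem hU hu l] with ε hε using fr _ hε y z
        have e := d2.unique ((hasDerivAt_const (0 : ℝ) (psiB D y z)).congr_of_eventuallyEq hev)
        simp only [zero_smul, add_zero, map_zero] at e
        rw [curv, frame_add, fr u hu, ← frameL_apply, ← frameL_apply, map_zero, ← e, add_comm]
        rfl }

theorem isHamiltonianOp_monge (hU : IsOpen U) (hD : IsMonge D)
    (h0 : ∀ u ∈ U, (mongeMetric D u).det ≠ 0) :
    IsHamiltonianOp U (fun u => (mongeMetric D u)⁻¹) (mongeCoeff D) :=
  isHamiltonianOp_of_isFlatOp (contDiffOn_mongeMetric_inv h0) (contDiffOn_mongeCoeff h0)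
    (fun u hu => (Matrix.isUnit_nonsing_inv_det _ (isUnit_iff_ne_zero.2 (h0 u hu))).ne_zero)
    (isFlatOp_monge hU hD h0)

end

section

/-! ### The Hamiltonian of Monge data -/

variable {n : ℕ}

/-- In a parallel frame the covariant derivative is the ordinary one, and $A\alpha$ is the covariant
derivative of $G\alpha$. -/
theorem hasDerivAt_frame_opG {U : Set (Fin n → ℝ)} {G : (Fin n → ℝ) → (Fin n → ℝ) →L[ℝ] (Fin n → ℝ)}
    {c h : (Fin n → ℝ) → (Fin n → ℝ) →L[ℝ] (Fin n → ℝ) →L[ℝ] (Fin n → ℝ)}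
    (H : IsMetricOp U G c h) {D : MongeData n}
    (hD : ∀ u ∈ U, ∀ y z, frame D u (h u y z) = psiB D y z)
    {u α : ℝ → Fin n → ℝ} (hu : IsCurveIn U u) (hα : ContDiff ℝ ∞ α) (x : ℝ) :
    HasDerivAt (fun x => frame D (u x) (G (u x) (α x))) (frame D (u x) (opFlux G c u α x)) x := by
  have d1 := (hasDerivAt_comp_curve H.isOpen H.smooth_G hu x).clm_apply
    (hasDerivAt_of_contDiff hα x)
  have d2 := (hasDerivAt_comp_curve isOpen_univ (contDiff_frameL (D := D)).contDiffOn
    ⟨hu.1, fun _ => mem_univ _⟩ x).clm_apply d1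
  refine d2.congr_deriv ?_
  rw [(hasFDerivAt_frameL (u x)).fderiv, H.compat _ (hu.2 x), opFlux, map_add, frame_add,
    frameL_apply, frameL_apply, sub_eq_add_neg, frame_add, ← neg_one_smul ℝ (h _ _ _), frame_smul,
    hD _ (hu.2 x), ContinuousLinearMap.flip_apply]
  module

/-- The density of the Hamiltonian. -/
def mongeDensity (D : MongeData n) (z : ℝ × (Fin (0 + 2) → Fin n → ℝ)) : ℝ :=
  -(1 / 3 * phiB D (etaL D (z.2 0)) (psiB D (z.2 0) (z.2 1))
    + 1 / 2 * (z.1 * phiB D D.ξ (psiB D (z.2 0) (z.2 1))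
      + phiB D (etaL D (z.2 0)) (omL D (z.2 0)))
    + z.1 * phiB D D.ξ (omL D (z.2 0)))

theorem contDiff_mongeDensity (D : MongeData n) : ContDiff ℝ ∞ (mongeDensity D) := by
  have h0 : ContDiff ℝ ∞ fun z : ℝ × (Fin (0 + 2) → Fin n → ℝ) => z.2 0 := by fun_prop
  have h1 : ContDiff ℝ ∞ fun z : ℝ × (Fin (0 + 2) → Fin n → ℝ) => z.2 1 := by fun_prop
  have hp : ContDiff ℝ ∞ fun z : ℝ × (Fin (0 + 2) → Fin n → ℝ) => psiB D (z.2 0) (z.2 1) :=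
    ((psiB D).contDiff.comp h0).clm_apply h1
  have he : ContDiff ℝ ∞ fun z : ℝ × (Fin (0 + 2) → Fin n → ℝ) => etaL D (z.2 0) :=
    (etaL D).contDiff.comp h0
  have ho : ContDiff ℝ ∞ fun z : ℝ × (Fin (0 + 2) → Fin n → ℝ) => omL D (z.2 0) :=
    (omL D).contDiff.comp h0
  have hB : ∀ {f g : ℝ × (Fin (0 + 2) → Fin n → ℝ) → Fin n → ℝ}, ContDiff ℝ ∞ f → ContDiff ℝ ∞ g →
      ContDiff ℝ ∞ fun z => phiB D (f z) (g z) := fun hf hg =>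
    contDiff_dotL hf ((linOf D.φ).contDiff.comp hg)
  have hc : ContDiff ℝ ∞ fun _ : ℝ × (Fin (0 + 2) → Fin n → ℝ) => D.ξ := contDiff_const
  exact (((contDiff_const.mul (hB he hp)).add (contDiff_const.mul
    ((contDiff_fst.mul (hB hc hp)).add (hB he ho)))).add (contDiff_fst.mul (hB hc ho))).neg

theorem hasDerivAt_quadratic (a A C : ℝ) : HasDerivAt (fun ε : ℝ => a + ε * A + ε ^ 2 * C) A 0 := by
  have := (((hasDerivAt_id (0 : ℝ)).mul_const A).const_add a).fun_add
    ((hasDerivAt_pow 2 (0 : ℝ)).mul_const C)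
  simpa using this

/-- With $b_x$ held fixed the density is a polynomial of degree two in $b$, so the derivative is the
linear coefficient along $z+\varepsilon y$. -/
theorem fderiv_mongeDensity_zero (D : MongeData n) (z : ℝ × (Fin (0 + 2) → Fin n → ℝ))
    (y : Fin n → ℝ) : fderiv ℝ (mongeDensity D) z (0, Pi.single 0 y) =
      -(1 / 3 * (phiB D (etaL D y) (psiB D (z.2 0) (z.2 1))
          + phiB D (etaL D (z.2 0)) (psiB D y (z.2 1)))
        + 1 / 2 * (z.1 * phiB D D.ξ (psiB D y (z.2 1)) + phiB D (etaL D y) (omL D (z.2 0))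
          + phiB D (etaL D (z.2 0)) (omL D y))
        + z.1 * phiB D D.ξ (omL D y)) := by
  have h1 := hasDerivAt_add_smul
    ((contDiff_mongeDensity D).differentiable (by simp) z).hasFDerivAt (0, Pi.single 0 y)
  refine h1.unique ((hasDerivAt_quadratic (mongeDensity D z) _
    (-(1 / 3 * phiB D (etaL D y) (psiB D y (z.2 1)) + 1 / 2 * phiB D (etaL D y) (omL D y)))
    ).congr_of_eventuallyEq (.of_forall fun ε => ?_))
  simp [mongeDensity]
  ring

theorem fderiv_mongeDensity_one (D : MongeData n) (z : ℝ × (Fin (0 + 2) → Fin n → ℝ))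
    (y : Fin n → ℝ) : fderiv ℝ (mongeDensity D) z (0, Pi.single 1 y) =
      -(1 / 3 * phiB D (etaL D (z.2 0)) (psiB D (z.2 0) y)
        + 1 / 2 * (z.1 * phiB D D.ξ (psiB D (z.2 0) y))) := by
  have h1 := hasDerivAt_add_smul
    ((contDiff_mongeDensity D).differentiable (by simp) z).hasFDerivAt (0, Pi.single 1 y)
  refine h1.unique ((hasDerivAt_quadratic (mongeDensity D z) _ 0).congr_of_eventuallyEq
    (.of_forall fun ε => ?_))
  simp [mongeDensity]
  ring

theorem hasDerivAt_phiB (D : MongeData n) {f g : ℝ → Fin n → ℝ} {f' g' : Fin n → ℝ} {x : ℝ}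
    (hf : HasDerivAt f f' x) (hg : HasDerivAt g g' x) :
    HasDerivAt (fun x => phiB D (f x) (g x)) (phiB D f' (g x) + phiB D (f x) g') x :=
  hasDerivAt_dotL hf ((linOf D.φ).hasFDerivAt.comp_hasDerivAt x hg)

/-- The density is the homotopy formula applied to the covector field on the right: pair it with $b$
and divide each term by its degree in $b$ and $b_x$ together, hence the weights $1/3$, $1/2$ and
$1$. The relations `psi_eta` and `psi_xi` are the Helmholtz conditions that make this field a
variational derivative. -/
theorem variationalDeriv_mongeDensity {D : MongeData n} (hD : IsMonge D) {b : ℝ → Fin n → ℝ}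
    (hb : ContDiff ℝ ∞ b) (x : ℝ) (i : Fin n) : variationalDeriv (mongeDensity D) b x i =
      - phiB D (etaL D (b x) + x • D.ξ) (frame D (deriv b x) (Pi.single i 1)) := by
  obtain ⟨y, hy⟩ : ∃ y : Fin n → ℝ, y = Pi.single i 1 := ⟨_, rfl⟩
  have d0 := hasDerivAt_of_contDiff hb x
  have de := (etaL D).hasFDerivAt.comp_hasDerivAt x d0
  have dp := (((psiB D).flip y).hasFDerivAt (x := b x)).comp_hasDerivAt x d0
  have d1 := ((hasDerivAt_phiB D de dp).const_mul (1 / 3)).fun_add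
    (((hasDerivAt_id x).fun_mul (hasDerivAt_phiB D (hasDerivAt_const x D.ξ) dp)).const_mul (1 / 2))
  have d2 := d1.fun_neg.deriv
  simp only [Function.comp_def, id, ContinuousLinearMap.flip_apply] at d2
  have hrw : (fun x => fderiv ℝ (mongeDensity D)
      (x, fun l : Fin (0 + 2) => iteratedDeriv (l : ℕ) b x) (0, Pi.single 1 y)) =
      fun x => -(1 / 3 * phiB D (etaL D (b x)) (psiB D (b x) y)
        + 1 / 2 * (x * phiB D D.ξ (psiB D (b x) y))) := by
    funext x
    rw [fderiv_mongeDensity_one]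
    simp
  simp only [variationalDeriv, ← hy]
  rw [Fin.sum_univ_two]
  rw [show (((0 : Fin (0 + 2)) : ℕ)) = 0 from rfl, show (((1 : Fin (0 + 2)) : ℕ)) = 1 from rfl,
    iteratedDeriv_zero, iteratedDeriv_one, hrw, d2, fderiv_mongeDensity_zero]
  have k1 := hD.psi_eta (b x) (deriv b x) y
  have k2 := hD.psi_xi y (b x)
  have k3 := hD.skew y (b x)
  have k4 := hD.skew y (deriv b x)
  rw [k3] at k1 k2
  simp [frame, k4] at k1 k2 ⊢
  rw [hD.symm (psiB D (b x) (deriv b x)) (etaL D y), hD.symm _ (etaL D (b x)),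
    hD.symm _ (etaL D (deriv b x))] at k1
  rw [hD.symm _ D.ξ, hD.symm _ (etaL D y), hD.symm _ (etaL D (b x))] at k2
  linarith

/-- From $\theta_x=-\delta H/\delta b$ one gets $\mathrm{frame}(G\theta_x)=\eta b+x\xi$.
Differentiation gives $\mathrm{frame}(A\theta_x)=\eta u+\xi=\mathrm{frame}(V)$, so $A\theta_x=V$. -/
theorem isHamiltonianStructure_monge {D : MongeData n} {U : Set (Fin n → ℝ)}
    {V : (Fin n → ℝ) → Fin n → ℝ} (hU : IsConservativeSystem U V) (hD : IsMonge D)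
    (h0 : ∀ u ∈ U, (mongeMetric D u).det ≠ 0)
    (hV : ∀ u ∈ U, frame D u (V u) = etaL D u + D.ξ) :
    IsHamiltonianStructure U V (fun u => (mongeMetric D u)⁻¹) (mongeCoeff D) := by
  refine ⟨isHamiltonianOp_monge hU.isOpen hD h0, 0, mongeDensity D,
    (contDiff_mongeDensity D).contDiffOn, fun b θ hb hθ hin hvar x i => ?_⟩
  have hu : IsCurveIn U (deriv b) := ⟨contDiff_deriv hb, hin⟩
  have H := isFlatOp_monge hU.isOpen hD h0
  have hF : ∀ x, frame D (deriv b x) (opG (fun u => (mongeMetric D u)⁻¹) (deriv b x) (deriv θ x)) =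
      etaL D (b x) + x • D.ξ := by
    intro x
    apply phiB_nondegenerate hD.nondegenerate
    intro y
    obtain ⟨y, rfl⟩ := frame_surjective (h0 _ (hin x)) y
    rw [← dotL_mongeMetric, opG, linOf_apply_inv (h0 _ (hin x)), ← sub_eq_zero]
    refine eq_zero_of_single (F := fun y => dotL y (deriv θ x)
      - phiB D (frame D (deriv b x) y) (etaL D (b x) + x • D.ξ)) ?_ ?_ ?_ y
    · intros; simp; ring
    · intros; simp; ring
    intro i
    rw [dotL_single, hvar, variationalDeriv_mongeDensity hD hb, hD.symm]
    ring
  have hflux : ∀ x, opFlux (opG fun u => (mongeMetric D u)⁻¹) (opC (mongeCoeff D)) (deriv b)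
      (deriv θ) x = V (deriv b x) := by
    intro x
    have d1 := hasDerivAt_frame_opG H.toIsMetricOp (D := D)
      (fun u hu => frame_mongeSymbol hD.nondegenerate (h0 u hu)) hu (contDiff_deriv hθ) x
    simp only [hF] at d1
    have d2 := ((etaL D).hasFDerivAt.comp_hasDerivAt x (hasDerivAt_of_contDiff hb x)).fun_add
      ((hasDerivAt_id x).smul_const D.ξ)
    apply frame_injective (h0 _ (hin x))
    rw [d1.unique d2, hV _ (hin x), one_smul]
  rw [thirdOrderOp_eq]
  have hs : ContDiff ℝ ∞ fun x => V (deriv b x) := contDiff_comp_curve hU.smooth hu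
  change _ = deriv (fun y => opFlux (opG fun u => (mongeMetric D u)⁻¹) (opC (mongeCoeff D)) (deriv b)
      (deriv θ) y i) x
  simp only [hflux]
  exact congrFun (deriv_pi fun i => (contDiff_pi.1 hs i).differentiable (by simp) x) i

end

section

/-! ### Variational derivatives -/

section

variable {E : Type*} [NormedAddCommGroup E] [NormedSpace ℝ E]

theorem contDiff_iteratedDeriv {b : ℝ → E} (hb : ContDiff ℝ ∞ b) (k : ℕ) :
    ContDiff ℝ ∞ (iteratedDeriv k b) := by
  induction k with
  | zero => simpa using hb
  | succ k ih => rw [iteratedDeriv_succ]; exact contDiff_deriv ih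

theorem eventuallyEq_iteratedDeriv {b b' : ℝ → E} {x : ℝ} (h : b =ᶠ[𝓝 x] b') (k : ℕ) :
    iteratedDeriv k b =ᶠ[𝓝 x] iteratedDeriv k b' := by
  induction k with
  | zero => simpa using h
  | succ k ih => rw [iteratedDeriv_succ, iteratedDeriv_succ]; exact ih.deriv

theorem iteratedDeriv_add_smul {f g : ℝ → E} (hf : ContDiff ℝ ∞ f) (hg : ContDiff ℝ ∞ g) (a : ℝ)
    (k : ℕ) : iteratedDeriv k (fun x => f x + a • g x) =
      fun x => iteratedDeriv k f x + a • iteratedDeriv k g x := by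
  induction k with
  | zero => simp
  | succ k ih =>
    rw [iteratedDeriv_succ, ih, iteratedDeriv_succ, iteratedDeriv_succ]
    funext x
    exact ((hasDerivAt_of_contDiff (contDiff_iteratedDeriv hf k) x).fun_add
      ((hasDerivAt_of_contDiff (contDiff_iteratedDeriv hg k) x).const_smul a)).deriv

theorem iteratedDeriv_smul_vec {f : ℝ → ℝ} (hf : ContDiff ℝ ∞ f) (v : E) (k : ℕ) :
    iteratedDeriv k (fun x => f x • v) = fun x => iteratedDeriv k f x • v := by
  induction k with
  | zero => simp
  | succ k ih =>
    rw [iteratedDeriv_succ, ih, iteratedDeriv_succ]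
    funext x
    exact ((hasDerivAt_of_contDiff (contDiff_iteratedDeriv hf k) x).smul_const v).deriv

end

theorem integral_iteratedDeriv_mul {f A : ℝ → ℝ} (hf : ContDiff ℝ ∞ f) (hc : HasCompactSupport f)
    (hA : ContDiff ℝ ∞ A) (k : ℕ) :
    ∫ x, iteratedDeriv k f x * A x = (-1) ^ k * ∫ x, f x * iteratedDeriv k A x := by
  induction k generalizing f with
  | zero => simp
  | succ k ih =>
    rw [iteratedDeriv_succ', ih (contDiff_deriv hf) hc.deriv, pow_succ, iteratedDeriv_succ,
      integral_mul_deriv_eq_neg hf (contDiff_iteratedDeriv hA k) (Or.inl hc)]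
    ring

variable {n N : ℕ}

/-- The jet of the curve `b`. -/
def jet (N : ℕ) (b : ℝ → Fin n → ℝ) (x : ℝ) : ℝ × (Fin (N + 2) → Fin n → ℝ) :=
  (x, fun l => iteratedDeriv (l : ℕ) b x)

theorem contDiff_jet {b : ℝ → Fin n → ℝ} (hb : ContDiff ℝ ∞ b) : ContDiff ℝ ∞ (jet N b) :=
  contDiff_id.prodMk (contDiff_pi.2 fun l => contDiff_iteratedDeriv hb l)

theorem eventuallyEq_jet {b b' : ℝ → Fin n → ℝ} {x : ℝ} (h : b =ᶠ[𝓝 x] b') :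
    jet N b =ᶠ[𝓝 x] jet N b' := by
  have : ∀ l : Fin (N + 2), iteratedDeriv (l : ℕ) b =ᶠ[𝓝 x] iteratedDeriv (l : ℕ) b' := fun l =>
    eventuallyEq_iteratedDeriv h l
  filter_upwards [eventually_all.2 this] with y hy
  simp [jet, hy]

theorem variationalDeriv_eq (h : ℝ × (Fin (N + 2) → Fin n → ℝ) → ℝ) (b : ℝ → Fin n → ℝ) (x : ℝ)
    (i : Fin n) : variationalDeriv h b x i = ∑ k : Fin (N + 2), (-1 : ℝ) ^ (k : ℕ) *
      iteratedDeriv (k : ℕ) (fun y => fderiv ℝ h (jet N b y) (0, Pi.single k (Pi.single i 1))) x := rfl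

/-- Locality: a perturbed curve has the variational derivative of the straight one wherever the
perturbation vanishes near the point. -/
theorem variationalDeriv_congr (h : ℝ × (Fin (N + 2) → Fin n → ℝ) → ℝ) {b b' : ℝ → Fin n → ℝ}
    {x : ℝ} (hb : b =ᶠ[𝓝 x] b') : variationalDeriv h b =ᶠ[𝓝 x] variationalDeriv h b' := by
  filter_upwards [hb.eventuallyEq_nhds] with y hy
  funext i
  rw [variationalDeriv_eq, variationalDeriv_eq]
  refine Finset.sum_congr rfl fun k _ => ?_
  congr 1
  refine (eventuallyEq_iteratedDeriv ?_ k).eq_of_nhds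
  filter_upwards [eventuallyEq_jet (N := N) hy] with z hz
  rw [hz]

section

variable {U : Set (Fin n → ℝ)} {h : ℝ × (Fin (N + 2) → Fin n → ℝ) → ℝ}

theorem isOpen_jetDomain (hU : IsOpen U) :
    IsOpen {z : ℝ × (Fin (N + 2) → Fin n → ℝ) | z.2 1 ∈ U} :=
  hU.preimage (by fun_prop : Continuous fun z : ℝ × (Fin (N + 2) → Fin n → ℝ) => z.2 1)

theorem jet_mem {b : ℝ → Fin n → ℝ} (hin : ∀ x, deriv b x ∈ U) (x : ℝ) :
    jet N b x ∈ {z : ℝ × (Fin (N + 2) → Fin n → ℝ) | z.2 1 ∈ U} := by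
  have : (jet N b x).2 1 = deriv b x := by
    simp [jet, ← iteratedDeriv_one]
  rw [mem_ofPred_eq, this]
  exact hin x

theorem contDiff_fderiv_jet (hU : IsOpen U) (hs : ContDiffOn ℝ ∞ h {z | z.2 1 ∈ U})
    {b : ℝ → Fin n → ℝ} (hb : ContDiff ℝ ∞ b) (hin : ∀ x, deriv b x ∈ U)
    (v : ℝ × (Fin (N + 2) → Fin n → ℝ)) : ContDiff ℝ ∞ fun y => fderiv ℝ h (jet N b y) v := by
  have h1 := (hs.fderiv_of_isOpen (m := ∞) (isOpen_jetDomain hU) (by simp)).comp_contDiff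
    (contDiff_jet (N := N) hb) (jet_mem hin)
  exact h1.clm_apply contDiff_const

theorem contDiff_variationalDeriv (hU : IsOpen U) (hs : ContDiffOn ℝ ∞ h {z | z.2 1 ∈ U})
    {b : ℝ → Fin n → ℝ} (hb : ContDiff ℝ ∞ b) (hin : ∀ x, deriv b x ∈ U) :
    ContDiff ℝ ∞ (variationalDeriv h b) :=
  contDiff_pi.2 fun _ => ContDiff.sum fun k _ => contDiff_const.mul
    (contDiff_iteratedDeriv (contDiff_fderiv_jet hU hs hb hin _) k)

/-- The first variation formula: all derivatives of $f$ are moved off by parts, without boundary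
terms since $f$ has compact support. -/
theorem integral_fderiv_jet (hU : IsOpen U) (hs : ContDiffOn ℝ ∞ h {z | z.2 1 ∈ U})
    {b : ℝ → Fin n → ℝ} (hb : ContDiff ℝ ∞ b) (hin : ∀ x, deriv b x ∈ U) {f : ℝ → ℝ}
    (hf : ContDiff ℝ ∞ f) (hc : HasCompactSupport f) (y : Fin n → ℝ) :
    ∫ x, fderiv ℝ h (jet N b x) (0, fun l => iteratedDeriv (l : ℕ) f x • y) =
      ∫ x, f x * dotL y (variationalDeriv h b x) := by
  let A : Fin (N + 2) → Fin n → ℝ → ℝ := fun k i x =>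
    fderiv ℝ h (jet N b x) (0, Pi.single k (Pi.single i 1))
  have hA : ∀ k i, ContDiff ℝ ∞ (A k i) := fun k i => contDiff_fderiv_jet hU hs hb hin _
  have hc' : ∀ k, HasCompactSupport (iteratedDeriv k f) := by
    intro k
    induction k with
    | zero => simpa using hc
    | succ k ih => rw [iteratedDeriv_succ]; exact ih.deriv
  have e1 : ∀ x, fderiv ℝ h (jet N b x) (0, fun l => iteratedDeriv (l : ℕ) f x • y) =
      ∑ i, ∑ k : Fin (N + 2), y i * (iteratedDeriv (k : ℕ) f x * A k i x) := by
    intro x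
    have : ((0, fun l => iteratedDeriv (l : ℕ) f x • y) : ℝ × (Fin (N + 2) → Fin n → ℝ)) =
        ∑ i, ∑ k : Fin (N + 2), (y i * iteratedDeriv (k : ℕ) f x) •
          ((0, Pi.single k (Pi.single i 1)) : ℝ × (Fin (N + 2) → Fin n → ℝ)) := by
      refine Prod.ext ?_ ?_
      · simp [Prod.fst_sum]
      · funext l j
        simp [Prod.snd_sum, Finset.sum_apply, Pi.single_apply, mul_comm]
    rw [this]
    simp only [map_sum, map_smul, smul_eq_mul, A, mul_assoc]
  have e2 : ∀ x, f x * dotL y (variationalDeriv h b x) =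
      ∑ i, ∑ k : Fin (N + 2), y i * ((-1) ^ (k : ℕ) * (f x * iteratedDeriv (k : ℕ) (A k i) x)) := by
    intro x
    simp only [dotL_apply, variationalDeriv_eq, Finset.mul_sum]
    exact Finset.sum_congr rfl fun _ _ => Finset.sum_congr rfl fun _ _ => by simp only [A]; ring
  have i1 : ∀ (i : Fin n) (k : Fin (N + 2)),
      Integrable fun x => y i * (iteratedDeriv (k : ℕ) f x * A k i x) := fun i k =>
    (((contDiff_iteratedDeriv hf k).continuous.mul
      (hA k i).continuous).integrable_of_hasCompactSupport (hc' k).mul_right).const_mul _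
  have i2 : ∀ (i : Fin n) (k : Fin (N + 2)),
      Integrable fun x => y i * ((-1) ^ (k : ℕ) * (f x * iteratedDeriv (k : ℕ) (A k i) x)) :=
    fun i k => (((hf.continuous.mul (contDiff_iteratedDeriv
      (hA k i) k).continuous).integrable_of_hasCompactSupport hc.mul_right).const_mul _).const_mul _
  simp only [e1, e2]
  rw [integral_finsetSum _ fun i _ => integrable_finsetSum _ fun k _ => i1 i k,
    integral_finsetSum _ fun i _ => integrable_finsetSum _ fun k _ => i2 i k]
  refine Finset.sum_congr rfl fun i _ => ?_
  rw [integral_finsetSum _ fun k _ => i1 i k, integral_finsetSum _ fun k _ => i2 i k]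
  refine Finset.sum_congr rfl fun k _ => ?_
  rw [integral_const_mul, integral_const_mul, integral_const_mul,
    integral_iteratedDeriv_mul hf hc (hA k i)]

end

theorem exists_primitive {q : ℝ → Fin n → ℝ} (hq : ContDiff ℝ ∞ q) :
    ∃ θ : ℝ → Fin n → ℝ, ContDiff ℝ ∞ θ ∧ deriv θ = q := by
  have hd : ∀ x, HasDerivAt (fun x => ∫ t in (0 : ℝ)..x, q t) (q x) x := fun x =>
    intervalIntegral.integral_hasDerivAt_right (hq.continuous.intervalIntegrable _ _)
      hq.continuous.stronglyMeasurable.stronglyMeasurableAtFilter hq.continuous.continuousAt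
  have he : deriv (fun x => ∫ t in (0 : ℝ)..x, q t) = q := funext fun x => (hd x).deriv
  exact ⟨_, contDiff_infty_iff_deriv.2 ⟨fun x => (hd x).differentiableAt, he.symm ▸ hq⟩, he⟩

/-! ### The potential of a Hamiltonian system -/

variable {U : Set (Fin n → ℝ)} {V : (Fin n → ℝ) → Fin n → ℝ}
  {G : (Fin n → ℝ) → Matrix (Fin n) (Fin n) ℝ} {c : (Fin n → ℝ) → Fin n → Fin n → Fin n → ℝ}
  {h : ℝ × (Fin (N + 2) → Fin n → ℝ) → ℝ}
  {C : (Fin n → ℝ) → (Fin n → ℝ) →L[ℝ] (Fin n → ℝ) →L[ℝ] (Fin n → ℝ)}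
  {D : MongeData n}

/-- `h` is the density of a Hamiltonian of the system. -/
def IsDensity (U : Set (Fin n → ℝ)) (V : (Fin n → ℝ) → Fin n → ℝ)
    (G : (Fin n → ℝ) → Matrix (Fin n) (Fin n) ℝ) (c : (Fin n → ℝ) → Fin n → Fin n → Fin n → ℝ)
    (h : ℝ × (Fin (N + 2) → Fin n → ℝ) → ℝ) : Prop :=
  ContDiffOn ℝ ∞ h {z | z.2 1 ∈ U} ∧
    ∀ b θ : ℝ → Fin n → ℝ, ContDiff ℝ ∞ b → ContDiff ℝ ∞ θ → (∀ x, deriv b x ∈ U) →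
      (∀ x i, deriv θ x i = - variationalDeriv h b x i) →
      ∀ x i, deriv (fun y => V (deriv b y)) x i = thirdOrderOp G c (deriv b) θ x i

/-- The defect `κ` in the flux, which is constant along the curve. -/
def defect (V : (Fin n → ℝ) → Fin n → ℝ) (G : (Fin n → ℝ) → Matrix (Fin n) (Fin n) ℝ)
    (c : (Fin n → ℝ) → Fin n → Fin n → Fin n → ℝ) (h : ℝ × (Fin (N + 2) → Fin n → ℝ) → ℝ)
    (b : ℝ → Fin n → ℝ) (x : ℝ) : Fin n → ℝ :=
  V (deriv b x) + opFlux (opG G) (opC c) (deriv b) (variationalDeriv h b) x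

/-- The Hamiltonian form of the system equates only $x$-derivatives, so $V$ and the flux $A\theta_x$
may differ by a constant of integration. With $\theta_x=-\delta H/\delta b$ the difference is
`defect`. -/
theorem exists_defect (hU : IsConservativeSystem U V) (H : IsFlatOp U (opG G) (opC c) C)
    (hh : IsDensity U V G c h) {b : ℝ → Fin n → ℝ} (hb : ContDiff ℝ ∞ b)
    (hin : ∀ x, deriv b x ∈ U) : ∃ κ, ∀ x, defect V G c h b x = κ := by
  have hu : IsCurveIn U (deriv b) := ⟨contDiff_deriv hb, hin⟩
  have hq := contDiff_variationalDeriv hU.isOpen hh.1 hb hin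
  obtain ⟨θ, hθ, e⟩ := exists_primitive hq.neg
  have hV : ContDiff ℝ ∞ fun x => V (deriv b x) := contDiff_comp_curve hU.smooth hu
  have hK := contDiff_opFlux H.smooth_G H.smooth_c hu hq
  have hd : ContDiff ℝ ∞ (defect V G c h b) := hV.add hK
  refine ⟨defect V G c h b 0, fun x => is_const_of_deriv_eq_zero (hd.differentiable (by simp)) ?_ x 0⟩
  intro x
  have key := hh.2 b θ hb hθ hin (fun x i => by rw [e]; rfl) x
  have hneg : opFlux (opG G) (opC c) (deriv b) (deriv θ) =
      fun x => -opFlux (opG G) (opC c) (deriv b) (variationalDeriv h b) x := by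
    funext x
    have : deriv (fun x => -variationalDeriv h b x) x = -deriv (variationalDeriv h b) x :=
      (hasDerivAt_of_contDiff hq x).fun_neg.deriv
    rw [e, opFlux, opFlux]
    rw [this, map_neg, map_neg]
    abel
  funext i
  have d1 := (hasDerivAt_pi.1 ((hasDerivAt_of_contDiff hV x).add (hasDerivAt_of_contDiff hK x))) i
  have d2 := (hasDerivAt_pi.1 (hasDerivAt_of_contDiff hd x)) i
  rw [d2.unique d1, Pi.add_apply, key i, thirdOrderOp_eq]
  change deriv (fun y => opFlux (opG G) (opC c) (deriv b) (deriv θ) y i) x + _ = _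
  rw [hneg]
  have d3 := ((hasDerivAt_pi.1 (hasDerivAt_of_contDiff hK x)) i).fun_neg.deriv
  simp only [Pi.neg_apply]
  rw [d3]
  exact neg_add_cancel _

/-- The potential of `ψ^γ_k V^k` along a curve with flux defect `κ`. -/
def fluxPotential (D : MongeData n) (G : (Fin n → ℝ) → Matrix (Fin n) (Fin n) ℝ)
    (h : ℝ × (Fin (N + 2) → Fin n → ℝ) → ℝ) (κ : Fin n → ℝ) (b : ℝ → Fin n → ℝ) (x : ℝ) :
    Fin n → ℝ :=
  psiB D κ (b x) + x • omL D κ - frame D (deriv b x) (opG G (deriv b x) (variationalDeriv h b x))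

/-- The first two terms of the potential differentiate to the frame applied to $\kappa$. By
`hasDerivAt_frame_opG` the last one contributes $-\mathrm{frame}(A\,\delta H/\delta b)$, and the sum
is $\mathrm{frame}(V)$. -/
theorem hasDerivAt_fluxPotential (hU : IsConservativeSystem U V)
    (H : IsFlatOp U (opG G) (opC c) C) (hD : ∀ u ∈ U, ∀ y z, frame D u (C u y z) = psiB D y z)
    (hh : IsDensity U V G c h) {b : ℝ → Fin n → ℝ} (hb : ContDiff ℝ ∞ b)
    (hin : ∀ x, deriv b x ∈ U) {κ : Fin n → ℝ} (hκ : ∀ x, defect V G c h b x = κ) (x : ℝ) :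
    HasDerivAt (fluxPotential D G h κ b) (frame D (deriv b x) (V (deriv b x))) x := by
  have hu : IsCurveIn U (deriv b) := ⟨contDiff_deriv hb, hin⟩
  have d1 := hasDerivAt_frame_opG H.toIsMetricOp hD hu
    (contDiff_variationalDeriv hU.isOpen hh.1 hb hin) x
  have d2 := ((psiB D κ).hasFDerivAt.comp_hasDerivAt x (hasDerivAt_of_contDiff hb x)).fun_add
    ((hasDerivAt_id x).smul_const (omL D κ))
  refine (d2.fun_sub d1).congr_deriv ?_
  rw [one_smul, ← frame, ← hκ x, defect, frame_add, add_sub_cancel_right]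

theorem defect_congr {b b' : ℝ → Fin n → ℝ} {x : ℝ} (hb : b =ᶠ[𝓝 x] b') :
    defect V G c h b x = defect V G c h b' x := by
  have h1 := hb.deriv
  have h2 := variationalDeriv_congr h hb
  rw [defect, defect, opFlux, opFlux, h1.eq_of_nhds, h1.deriv_eq, h2.eq_of_nhds, h2.deriv_eq]

theorem fluxPotential_congr {κ : Fin n → ℝ} {b b' : ℝ → Fin n → ℝ} {x : ℝ} (hb : b =ᶠ[𝓝 x] b') :
    fluxPotential D G h κ b x = fluxPotential D G h κ b' x := by
  rw [fluxPotential, fluxPotential, hb.eq_of_nhds, hb.deriv.eq_of_nhds,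
    (variationalDeriv_congr h hb).eq_of_nhds]

end

section

/-! ### The fluxes of a Hamiltonian system -/

variable {n N : ℕ}

theorem hasDerivAt_bentLine (u₀ l : Fin n → ℝ) (s : ℝ → ℝ) (ε x : ℝ) :
    HasDerivAt (fun ε => bentLine u₀ l s ε x) ((Real.cos ε * s x) • l) ε :=
  (((Real.hasDerivAt_sin ε).mul_const (s x)).smul_const l).const_add u₀

theorem hasDerivAt_comp_apply {E F : Type*} [NormedAddCommGroup E] [NormedSpace ℝ E]
    [NormedAddCommGroup F] [NormedSpace ℝ F] {g : E → E →L[ℝ] F} {g' : E →L[ℝ] E →L[ℝ] F}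
    {b : ℝ → E} {b' : E} {ε : ℝ} (hg : HasFDerivAt g g' (b ε)) (hb : HasDerivAt b b' ε) (l : E) :
    HasDerivAt (fun ε => g (b ε) l) (g' b' l) ε := by
  have h1 := hg.comp_hasDerivAt ε hb
  exact (ContinuousLinearMap.apply ℝ F l).hasFDerivAt.comp_hasDerivAt ε h1

/-- A constant integral is differentiated twice in $\varepsilon$. At $\varepsilon=0$ the first-order
term dies with $\sin 0$, leaving $\int s^2$ times the second derivative of $w$ in the direction $l$.
-/
theorem fderiv_fderiv_eq_zero_of_integral {U : Set (Fin n → ℝ)} (hU : IsOpen U)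
    {w : (Fin n → ℝ) → ℝ} (hw : ContDiffOn ℝ ∞ w U) {u₀ l : Fin n → ℝ} {s : ℝ → ℝ}
    (hs : ContDiff ℝ ∞ s) (hin : ∀ ε x, bentLine u₀ l s ε x ∈ U) {a b K : ℝ}
    (hK : ∀ ε, ∫ x in a..b, w (bentLine u₀ l s ε x) = K) (h0 : ∫ x in a..b, s x * s x ≠ 0) :
    fderiv ℝ (fderiv ℝ w) u₀ l l = 0 := by
  have hw1 := contDiffOn_fderiv hU hw
  have hw2 := contDiffOn_fderiv hU hw1
  have cb := contDiff_bentLine u₀ l hs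
  have c0 : Continuous fun z : ℝ × ℝ => w (bentLine u₀ l s z.1 z.2) :=
    (hw.comp_contDiff cb fun z => hin _ _).continuous
  have c1 : Continuous fun z : ℝ × ℝ => fderiv ℝ w (bentLine u₀ l s z.1 z.2) l :=
    ((hw1.comp_contDiff cb fun z => hin _ _).clm_apply contDiff_const).continuous
  have c2 : Continuous fun z : ℝ × ℝ => fderiv ℝ (fderiv ℝ w) (bentLine u₀ l s z.1 z.2) l l :=
    (((hw2.comp_contDiff cb fun z => hin _ _).clm_apply contDiff_const).clm_apply
      contDiff_const).continuous
  have hsc := hs.continuous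
  have d1 : ∀ ε x, HasDerivAt (fun ε => w (bentLine u₀ l s ε x))
      (Real.cos ε * s x * fderiv ℝ w (bentLine u₀ l s ε x) l) ε := by
    intro ε x
    have := (hasFDerivAt_of_contDiffOn hU hw (hin ε x)).comp_hasDerivAt ε
      (hasDerivAt_bentLine u₀ l s ε x)
    exact this.congr_deriv (by simp)
  have d2 : ∀ ε x, HasDerivAt (fun ε => Real.cos ε * s x * fderiv ℝ w (bentLine u₀ l s ε x) l)
      (-Real.sin ε * s x * fderiv ℝ w (bentLine u₀ l s ε x) l + Real.cos ε * s x *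
        (Real.cos ε * s x * fderiv ℝ (fderiv ℝ w) (bentLine u₀ l s ε x) l l)) ε := by
    intro ε x
    have e1 := hasDerivAt_comp_apply (b := fun ε => bentLine u₀ l s ε x)
      (hasFDerivAt_of_contDiffOn hU hw1 (hin ε x))
      (hasDerivAt_bentLine u₀ l s ε x) l
    have e2 := ((Real.hasDerivAt_cos ε).mul_const (s x)).fun_mul e1
    exact e2.congr_deriv (by simp)
  have k1 : ∀ ε, ∫ x in a..b, Real.cos ε * s x * fderiv ℝ w (bentLine u₀ l s ε x) l = 0 := by
    intro ε
    have := hasDerivAt_intervalIntegral a b ε c0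
      (F' := fun ε x => Real.cos ε * s x * fderiv ℝ w (bentLine u₀ l s ε x) l)
      (((Real.continuous_cos.comp continuous_fst).mul (hsc.comp continuous_snd)).mul c1) d1
    simp only [hK] at this
    exact this.unique (hasDerivAt_const ε K)
  have k2 := hasDerivAt_intervalIntegral a b 0
    (F := fun ε x => Real.cos ε * s x * fderiv ℝ w (bentLine u₀ l s ε x) l)
    (F' := fun ε x => -Real.sin ε * s x * fderiv ℝ w (bentLine u₀ l s ε x) l + Real.cos ε * s x *
        (Real.cos ε * s x * fderiv ℝ (fderiv ℝ w) (bentLine u₀ l s ε x) l l))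
    (((Real.continuous_cos.comp continuous_fst).mul (hsc.comp continuous_snd)).mul c1)
    (((((Real.continuous_sin.comp continuous_fst).neg).mul (hsc.comp continuous_snd)).mul c1).add
      (((Real.continuous_cos.comp continuous_fst).mul (hsc.comp continuous_snd)).mul
        (((Real.continuous_cos.comp continuous_fst).mul (hsc.comp continuous_snd)).mul c2))) d2
  simp only [k1] at k2
  have k3 := k2.unique (hasDerivAt_const (0 : ℝ) (0 : ℝ))
  have e : ∀ x, bentLine u₀ l s 0 x = u₀ := fun x => by simp [bentLine]
  simp only [e, Real.sin_zero, Real.cos_zero, neg_zero, zero_mul, zero_add, one_mul,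
    ← mul_assoc] at k3
  rw [intervalIntegral.integral_mul_const] at k3
  exact (mul_eq_zero.1 k3).resolve_left h0

/-- The potential of `bentLine u₀ l (deriv f)`. -/
def bentPotential (u₀ l : Fin n → ℝ) (f : ℝ → ℝ) (ε x : ℝ) : Fin n → ℝ :=
  x • u₀ + (Real.sin ε * f x) • l

theorem contDiff_bentPotential (u₀ l : Fin n → ℝ) {f : ℝ → ℝ} (hf : ContDiff ℝ ∞ f) (ε : ℝ) :
    ContDiff ℝ ∞ (bentPotential u₀ l f ε) := by
  have h1 : ContDiff ℝ ∞ fun x : ℝ => x • u₀ := contDiff_id.smul contDiff_const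
  have h2 : ContDiff ℝ ∞ fun x : ℝ => (Real.sin ε * f x) • l :=
    (contDiff_const.mul hf).smul contDiff_const
  exact h1.add h2

theorem deriv_bentPotential (u₀ l : Fin n → ℝ) {f : ℝ → ℝ} (hf : ContDiff ℝ ∞ f) (ε : ℝ) :
    deriv (bentPotential u₀ l f ε) = bentLine u₀ l (deriv f) ε := by
  funext x
  have := ((hasDerivAt_id x).smul_const u₀).fun_add
    (((hasDerivAt_of_contDiff hf x).const_mul (Real.sin ε)).smul_const l)
  refine this.deriv.trans ?_
  rw [one_smul, bentLine]

theorem bentPotential_eventuallyEq (u₀ l : Fin n → ℝ) {f : ℝ → ℝ} {R : ℝ}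
    (hR : ∀ x, R ≤ |x| → f x = 0) (ε : ℝ) {x : ℝ} (hx : R < |x|) :
    bentPotential u₀ l f ε =ᶠ[𝓝 x] fun x => x • u₀ := by
  filter_upwards [(isOpen_lt continuous_const continuous_abs).mem_nhds hx] with y hy
  simp [bentPotential, hR y (le_of_lt hy)]

variable {U : Set (Fin n → ℝ)} {V : (Fin n → ℝ) → Fin n → ℝ}
  {G : (Fin n → ℝ) → Matrix (Fin n) (Fin n) ℝ} {c : (Fin n → ℝ) → Fin n → Fin n → Fin n → ℝ}
  {h : ℝ × (Fin (N + 2) → Fin n → ℝ) → ℝ}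
  {C : (Fin n → ℝ) → (Fin n → ℝ) →L[ℝ] (Fin n → ℝ) →L[ℝ] (Fin n → ℝ)}
  {D : MongeData n}

theorem exists_defect_line (hU : IsConservativeSystem U V) (H : IsFlatOp U (opG G) (opC c) C)
    (hh : IsDensity U V G c h) {u₀ : Fin n → ℝ} (hu : u₀ ∈ U) :
    ∃ κ, ∀ x, defect V G c h (fun x => x • u₀) x = κ := by
  refine exists_defect hU H hh (contDiff_id.smul contDiff_const) fun x => ?_
  have : deriv (fun x : ℝ => x • u₀) x = u₀ := by
    simpa using ((hasDerivAt_id x).smul_const u₀).deriv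
  rwa [this]

/-- Beyond the support of $f$ the bent curve is the straight one, so the constants of integration
agree there and hence everywhere. In particular $\kappa$ does not depend on $\varepsilon$. -/
theorem defect_bentPotential (hU : IsConservativeSystem U V) (H : IsFlatOp U (opG G) (opC c) C)
    (hh : IsDensity U V G c h) {u₀ l κ : Fin n → ℝ}
    (hκ : ∀ x, defect V G c h (fun x => x • u₀) x = κ) {f : ℝ → ℝ} (hf : ContDiff ℝ ∞ f)
    {R : ℝ} (h0 : 0 < R) (hR : ∀ x, R ≤ |x| → f x = 0)
    (hin : ∀ ε x, bentLine u₀ l (deriv f) ε x ∈ U) (ε x : ℝ) :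
    defect V G c h (bentPotential u₀ l f ε) x = κ := by
  obtain ⟨κ', h'⟩ := exists_defect hU H hh (contDiff_bentPotential u₀ l hf ε) fun x => by
    rw [deriv_bentPotential u₀ l hf]; exact hin ε x
  rw [h', ← h' (R + 1), defect_congr (bentPotential_eventuallyEq u₀ l hR ε
    (by rw [abs_of_pos (by linarith)]; linarith)), hκ]

/-- The integral of $\mathrm{frame}(V)$ is the difference of `fluxPotential` at the two ends. There
the curve is straight, so the difference does not depend on $\varepsilon$. -/
theorem fderiv_fderiv_flux (hU : IsConservativeSystem U V)
    (H : IsFlatOp U (opG G) (opC c) C) (hD : ∀ u ∈ U, ∀ y z, frame D u (C u y z) = psiB D y z)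
    (hh : IsDensity U V G c h) {u₀ : Fin n → ℝ} (hu : u₀ ∈ U) (v : Fin n → ℝ) (i : Fin n) :
    fderiv ℝ (fderiv ℝ fun u => frame D u (V u) i) u₀ v v = 0 := by
  obtain ⟨f, hf, hfc, hf0⟩ := exists_bump
  obtain ⟨R, h0, hR⟩ := exists_interval_of_hasCompactSupport hfc
  obtain ⟨t, ht, hin⟩ := exists_bentLine_mem hU.isOpen hu v (contDiff_deriv hf) hfc.deriv
  obtain ⟨κ, hκ⟩ := exists_defect_line hU H hh hu
  have hdef := defect_bentPotential hU H hh hκ hf h0 hR hin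
  have hwv : ContDiffOn ℝ ∞ (fun u => frame D u (V u)) U :=
    (contDiff_frameL (D := D)).contDiffOn.clm_apply hU.smooth
  have hw : ContDiffOn ℝ ∞ (fun u => frame D u (V u) i) U := contDiffOn_pi.1 hwv i
  -- At $|x|=R$ there need be no neighbourhood on which $f$ is known to vanish. That case is set
  -- aside, and the interval ends at $R+1$.
  have hd : ∀ x, R ≤ |x| → deriv f x = 0 ∨ |x| = R := by
    intro x hx
    rcases hx.lt_or_eq with hx | hx
    · left
      have : f =ᶠ[𝓝 x] fun _ => 0 := by
        filter_upwards [(isOpen_lt continuous_const continuous_abs).mem_nhds hx] with y hy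
        exact hR y (le_of_lt hy)
      rw [this.deriv_eq, deriv_const]
    · exact Or.inr hx.symm
  have key : fderiv ℝ (fderiv ℝ fun u => frame D u (V u) i) u₀ (t • v) (t • v) = 0 := by
    refine fderiv_fderiv_eq_zero_of_integral hU.isOpen hw (contDiff_deriv hf) hin
      (a := -(R + 1)) (b := R + 1)
      (K := fluxPotential D G h κ (fun x => x • u₀) (R + 1) i
        - fluxPotential D G h κ (fun x => x • u₀) (-(R + 1)) i) (fun ε => ?_) ?_
    · rw [← fluxPotential_congr (bentPotential_eventuallyEq u₀ (t • v) hR ε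
        (show R < |R + 1| by rw [abs_of_pos (by linarith)]; linarith)),
        ← fluxPotential_congr (bentPotential_eventuallyEq u₀ (t • v) hR ε
        (show R < |-(R + 1)| by rw [abs_neg, abs_of_pos (by linarith)]; linarith))]
      refine intervalIntegral.integral_eq_sub_of_hasDerivAt (E := ℝ)
        (f := fun x => fluxPotential D G h κ (bentPotential u₀ (t • v) f ε) x i) (fun x _ => ?_) ?_
      · have := hasDerivAt_fluxPotential hU H hD hh (contDiff_bentPotential u₀ (t • v) hf ε)
          (fun x => by rw [deriv_bentPotential u₀ _ hf]; exact hin ε x) (hdef ε) x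
        rw [deriv_bentPotential u₀ _ hf] at this
        exact hasDerivAt_pi.1 this i
      · exact (contDiff_comp_curve hw (isCurveIn_bentLine (contDiff_deriv hf) hin
          ε)).continuous.intervalIntegrable _ _
    · have hpos := integral_sq_pos (contDiff_deriv hf).continuous hfc.deriv
        (deriv_ne_zero_of_hasCompactSupport (hf.differentiable (by simp)) hfc hf0)
      rw [integral_eq_intervalIntegral (R := R + 1) (by linarith)] at hpos
      · exact hpos.ne'
      · intro x hx
        rcases hd x (by linarith) with h1 | h1
        · simp [h1]
        · linarith
  simp only [map_smul, smul_apply, smul_eq_mul] at key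
  exact ((mul_eq_zero.1 ((mul_eq_zero.1 key).resolve_left ht.ne')).resolve_left ht.ne')

/-- Polarization and symmetry of the second derivative turn vanishing on the diagonal into
vanishing; two integrations over the connected set follow. -/
theorem exists_affine_of_fderiv_fderiv (hU : IsOpen U) (hc : IsConnected U) {W : (Fin n → ℝ) → Fin n → ℝ}
    (hW : ContDiffOn ℝ ∞ W U)
    (h2 : ∀ u ∈ U, ∀ v i, fderiv ℝ (fderiv ℝ fun u => W u i) u v v = 0) :
    ∃ (L : (Fin n → ℝ) →L[ℝ] (Fin n → ℝ)) (ξ : Fin n → ℝ), ∀ u ∈ U, W u = L u + ξ := by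
  obtain ⟨w, hw⟩ := hc.nonempty
  have key : ∀ i, ∃ (L : (Fin n → ℝ) →L[ℝ] ℝ) (ξ : ℝ), ∀ u ∈ U, W u i = L u + ξ := by
    intro i
    have hWi : ContDiffOn ℝ ∞ (fun u => W u i) U := contDiffOn_pi.1 hW i
    have hWd := contDiffOn_fderiv hU hWi
    have hzero : ∀ u ∈ U, fderiv ℝ (fderiv ℝ fun u => W u i) u = 0 := by
      intro u hu
      have hsym : IsSymmSndFDerivAt ℝ (fun u => W u i) u :=
        ((hWi.contDiffAt (hU.mem_nhds hu)).of_le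
          (ENat.LEInfty.out : (2 : WithTop ℕ∞) ≤ ∞)).isSymmSndFDerivAt (by simp)
      ext1 y
      ext1 z
      have e1 := h2 u hu (y + z) i
      simp only [map_add, add_apply, h2 u hu] at e1
      have e2 := hsym y z
      simp only [zero_apply]
      linarith
    have hconst : ∀ u ∈ U, fderiv ℝ (fun u => W u i) u = fderiv ℝ (fun u => W u i) w := fun u hu =>
      hU.is_const_of_fderiv_eq_zero hc.isPreconnected
        (fun u hu => (hasFDerivAt_of_contDiffOn hU hWd hu).differentiableAt.differentiableWithinAt)
        (fun u hu => hzero u hu) hu hw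
    obtain ⟨L, hL⟩ : ∃ L, L = fderiv ℝ (fun u => W u i) w := ⟨_, rfl⟩
    have hd : ∀ u ∈ U, HasFDerivAt (fun u => W u i - L u) (0 : (Fin n → ℝ) →L[ℝ] ℝ) u := by
      intro u hu
      refine ((hasFDerivAt_of_contDiffOn hU hWi hu).sub L.hasFDerivAt).congr_fderiv ?_
      rw [hconst u hu, hL, sub_self]
    refine ⟨L, W w i - L w, fun u hu => ?_⟩
    have := hU.is_const_of_fderiv_eq_zero hc.isPreconnected
      (fun u hu => (hd u hu).differentiableAt.differentiableWithinAt)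
      (fun u hu => (hd u hu).fderiv) hu hw
    linarith
  choose L ξ hLξ using key
  refine ⟨ContinuousLinearMap.pi L, ξ, fun u hu => ?_⟩
  funext i
  simpa using hLξ i u hu

theorem exists_flux_affine (hU : IsConservativeSystem U V)
    (H : IsFlatOp U (opG G) (opC c) C) (hD : ∀ u ∈ U, ∀ y z, frame D u (C u y z) = psiB D y z)
    (hh : IsDensity U V G c h) :
    ∃ (L : (Fin n → ℝ) →L[ℝ] (Fin n → ℝ)) (ξ : Fin n → ℝ), ∀ u ∈ U, frame D u (V u) = L u + ξ :=
  exists_affine_of_fderiv_fderiv hU.isOpen hU.isConnected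
    ((contDiff_frameL (D := D)).contDiffOn.clm_apply hU.smooth)
    fun _ hu v i => fderiv_fderiv_flux hU H hD hh hu v i

end

section

/-! ### The second variation of the Hamiltonian -/

variable {n N : ℕ}

/-- The variation of the jet in the direction of `f • y`. -/
def jetDir (N : ℕ) (f : ℝ → ℝ) (y : Fin n → ℝ) (x : ℝ) : ℝ × (Fin (N + 2) → Fin n → ℝ) :=
  (0, fun l => iteratedDeriv (l : ℕ) f x • y)

theorem contDiff_jetDir {f : ℝ → ℝ} (hf : ContDiff ℝ ∞ f) (y : Fin n → ℝ) :
    ContDiff ℝ ∞ (jetDir N f y) := by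
  refine contDiff_const.prodMk (contDiff_pi.2 fun l => ?_)
  have := contDiff_iteratedDeriv hf l
  exact this.smul contDiff_const

theorem jet_bentPotential (u₀ l : Fin n → ℝ) {f : ℝ → ℝ} (hf : ContDiff ℝ ∞ f) (ε x : ℝ) :
    jet N (bentPotential u₀ l f ε) x =
      jet N (fun x : ℝ => x • u₀) x + Real.sin ε • jetDir N f l x := by
  have h1 : ContDiff ℝ ∞ fun x : ℝ => x • u₀ := contDiff_id.smul contDiff_const
  have h2 : ContDiff ℝ ∞ fun x : ℝ => f x • l := hf.smul contDiff_const
  have e : bentPotential u₀ l f ε = fun x => x • u₀ + Real.sin ε • (f x • l) := by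
    funext x
    rw [bentPotential, mul_smul]
  rw [e]
  refine Prod.ext ?_ ?_
  · simp [jet, jetDir]
  · funext k
    simp only [jet, jetDir, iteratedDeriv_add_smul h1 h2, iteratedDeriv_smul_vec hf]
    rfl

variable {U : Set (Fin n → ℝ)} {V : (Fin n → ℝ) → Fin n → ℝ}
  {G : (Fin n → ℝ) → Matrix (Fin n) (Fin n) ℝ} {c : (Fin n → ℝ) → Fin n → Fin n → Fin n → ℝ}
  {h : ℝ × (Fin (N + 2) → Fin n → ℝ) → ℝ}
  {C : (Fin n → ℝ) → (Fin n → ℝ) →L[ℝ] (Fin n → ℝ) →L[ℝ] (Fin n → ℝ)}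
  {D : MongeData n}

theorem hasDerivAt_integral_fderiv_jet (hU : IsOpen U) (hs : ContDiffOn ℝ ∞ h {z | z.2 1 ∈ U})
    {u₀ l : Fin n → ℝ} {f : ℝ → ℝ} (hf : ContDiff ℝ ∞ f)
    (hin : ∀ ε x, bentLine u₀ l (deriv f) ε x ∈ U) (y : Fin n → ℝ) (a b : ℝ) :
    HasDerivAt (fun ε => ∫ x in a..b,
        fderiv ℝ h (jet N (bentPotential u₀ l f ε) x) (jetDir N f y x))
      (∫ x in a..b, fderiv ℝ (fderiv ℝ h) (jet N (fun x : ℝ => x • u₀) x) (jetDir N f l x)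
        (jetDir N f y x)) 0 := by
  have hO := isOpen_jetDomain (N := N) hU
  have s1 := hs.fderiv_of_isOpen (m := ∞) hO (by simp)
  have s2 := s1.fderiv_of_isOpen (m := ∞) hO (by simp)
  have hmem : ∀ ε x, jet N (bentPotential u₀ l f ε) x ∈
      {z : ℝ × (Fin (N + 2) → Fin n → ℝ) | z.2 1 ∈ U} := fun ε x =>
    jet_mem (fun x => by rw [deriv_bentPotential u₀ l hf]; exact hin ε x) x
  have hlin : ContDiff ℝ ∞ fun x : ℝ => x • u₀ := contDiff_id.smul contDiff_const
  have cj : ContDiff ℝ ∞ fun z : ℝ × ℝ => jet N (bentPotential u₀ l f z.1) z.2 := by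
    simp only [jet_bentPotential u₀ l hf]
    exact ((contDiff_jet hlin).comp contDiff_snd).add
      ((Real.contDiff_sin.comp contDiff_fst).smul ((contDiff_jetDir hf l).comp contDiff_snd))
  have cl : Continuous fun z : ℝ × ℝ => jetDir N f l z.2 :=
    (contDiff_jetDir hf l).continuous.comp continuous_snd
  have cy : Continuous fun z : ℝ × ℝ => jetDir N f y z.2 :=
    (contDiff_jetDir hf y).continuous.comp continuous_snd
  have c1 := (s1.comp_contDiff cj fun z => hmem _ _).continuous
  have c2 := (s2.comp_contDiff cj fun z => hmem _ _).continuous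
  have c3 : Continuous fun z : ℝ × ℝ => Real.cos z.1 *
      fderiv ℝ (fderiv ℝ h) (jet N (bentPotential u₀ l f z.1) z.2) (jetDir N f l z.2)
        (jetDir N f y z.2) :=
    (Real.continuous_cos.comp continuous_fst).mul ((c2.clm_apply cl).clm_apply cy)
  have key := hasDerivAt_intervalIntegral a b 0
    (F := fun ε x => fderiv ℝ h (jet N (bentPotential u₀ l f ε) x) (jetDir N f y x))
    (F' := fun ε x => Real.cos ε * fderiv ℝ (fderiv ℝ h) (jet N (bentPotential u₀ l f ε) x)
      (jetDir N f l x) (jetDir N f y x)) (c1.clm_apply cy) c3 (fun ε x => ?_)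
  · have e0 : bentPotential u₀ l f 0 = fun x => x • u₀ := by
      funext x
      simp [bentPotential]
    simpa only [Real.cos_zero, one_mul, e0] using key
  · have hd : HasDerivAt (fun ε => jet N (bentPotential u₀ l f ε) x)
        (Real.cos ε • jetDir N f l x) ε := by
      simp only [jet_bentPotential u₀ l hf]
      exact ((Real.hasDerivAt_sin ε).smul_const _).const_add _
    have hfd : HasFDerivAt (fderiv ℝ h) (fderiv ℝ (fderiv ℝ h) (jet N (bentPotential u₀ l f ε) x))
        (jet N (bentPotential u₀ l f ε) x) :=
      ((s1.contDiffAt (hO.mem_nhds (hmem ε x))).differentiableAt (by simp)).hasFDerivAt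
    exact (hasDerivAt_comp_apply (b := fun ε => jet N (bentPotential u₀ l f ε) x) hfd hd
      (jetDir N f y x)).congr_deriv (by rw [map_smul, smul_apply, smul_eq_mul])

/-- The definition of `fluxPotential` solved for $\delta H/\delta b$, with the metric written in the
frame. -/
theorem dotL_variationalDeriv (hD : IsFlatFrame D U (fun u => linOf (G u)⁻¹) C)
    (hG : ∀ u ∈ U, (G u).det ≠ 0) {b : ℝ → Fin n → ℝ} (hin : ∀ x, deriv b x ∈ U) (κ y : Fin n → ℝ)
    (x : ℝ) : dotL y (variationalDeriv h b x) = phiB D (frame D (deriv b x) y)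
      (psiB D κ (b x) + x • omL D κ - fluxPotential D G h κ b x) := by
  rw [fluxPotential, sub_sub_cancel, ← hD.metric _ (hin x), opG, linOf_inv_apply (hG _ (hin x))]

/-- Both sides have derivative $\mathrm{frame}(V)=\eta b_x+\xi$ along the curve. -/
theorem exists_fluxPotential_line (hU : IsConservativeSystem U V)
    (H : IsFlatOp U (opG G) (opC c) C) (hD : ∀ u ∈ U, ∀ y z, frame D u (C u y z) = psiB D y z)
    (hh : IsDensity U V G c h) (hW : ∀ u ∈ U, frame D u (V u) = etaL D u + D.ξ)
    {b : ℝ → Fin n → ℝ} (hb : ContDiff ℝ ∞ b) (hin : ∀ x, deriv b x ∈ U) {κ : Fin n → ℝ}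
    (hκ : ∀ x, defect V G c h b x = κ) :
    ∃ ζ, ∀ x, fluxPotential D G h κ b x = etaL D (b x) + x • D.ξ + ζ := by
  have hd : ∀ x, HasDerivAt (fun x => fluxPotential D G h κ b x - (etaL D (b x) + x • D.ξ)) 0 x := by
    intro x
    have d1 := hasDerivAt_fluxPotential hU H hD hh hb hin hκ x
    have d2 := ((etaL D).hasFDerivAt.comp_hasDerivAt x (hasDerivAt_of_contDiff hb x)).fun_add
      ((hasDerivAt_id x).smul_const D.ξ)
    refine (d1.fun_sub d2).congr_deriv ?_
    rw [hW _ (hin x), one_smul, sub_self]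
  refine ⟨fluxPotential D G h κ b 0 - (etaL D (b 0) + (0 : ℝ) • D.ξ), fun x => ?_⟩
  have := is_const_of_deriv_eq_zero (fun x => (hd x).differentiableAt) (fun x => (hd x).deriv) x 0
  rw [← this]
  abel

/-- Along the bent curves $\delta H/\delta b$ is known explicitly, because $\kappa$ and $\zeta$ are
those of the straight line. Differentiating the first variation at $\varepsilon=0$ gives the Hessian
of $h$ in the directions $f\,l$ and $f\,y$. -/
theorem second_variation (hU : IsConservativeSystem U V) (H : IsFlatOp U (opG G) (opC c) C)
    (hD : IsFlatFrame D U (fun u => linOf (G u)⁻¹) C) (hG : ∀ u ∈ U, (G u).det ≠ 0)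
    (hh : IsDensity U V G c h) (hW : ∀ u ∈ U, frame D u (V u) = etaL D u + D.ξ)
    {u₀ l κ ζ : Fin n → ℝ} (hκ : ∀ x, defect V G c h (fun x => x • u₀) x = κ)
    (hζ : ∀ x, fluxPotential D G h κ (fun x => x • u₀) x = etaL D (x • u₀) + x • D.ξ + ζ)
    {f : ℝ → ℝ} (hf : ContDiff ℝ ∞ f) (hfc : HasCompactSupport f) {R : ℝ} (h0 : 0 < R)
    (hR : ∀ x, R ≤ |x| → f x = 0) (hin : ∀ ε x, bentLine u₀ l (deriv f) ε x ∈ U) (y : Fin n → ℝ) :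
    ∫ x in -(R + 1)..(R + 1), fderiv ℝ (fderiv ℝ h) (jet N (fun x : ℝ => x • u₀) x)
        (jetDir N f l x) (jetDir N f y x) =
      -(∫ x in -(R + 1)..(R + 1), f x * f x) * (phiB D (frame D u₀ y) (etaL D l - psiB D κ l)
        - 1 / 2 * phiB D (psiB D y l) (etaL D u₀ - psiB D κ u₀ + (D.ξ - omL D κ))) := by
  have hloc : ∀ x, R < |x| → f =ᶠ[𝓝 x] fun _ => 0 := by
    intro x hx
    filter_upwards [(isOpen_lt continuous_const continuous_abs).mem_nhds hx] with z hz
    exact hR z (le_of_lt hz)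
  have hdir : ∀ x, R + 1 ≤ |x| → jetDir N f y x = 0 := by
    intro x hx
    refine Prod.ext rfl (funext fun k => ?_)
    show iteratedDeriv (k : ℕ) f x • y = 0
    rw [(eventuallyEq_iteratedDeriv (hloc x (by linarith)) k).eq_of_nhds]
    simp
  have hinb : ∀ ε x, deriv (bentPotential u₀ l f ε) x ∈ U := fun ε x => by
    rw [deriv_bentPotential u₀ l hf]; exact hin ε x
  have hdef := defect_bentPotential hU H hh hκ hf h0 hR hin
  have hpot : ∀ ε x, fluxPotential D G h κ (bentPotential u₀ l f ε) x =
      etaL D (bentPotential u₀ l f ε x) + x • D.ξ + ζ := by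
    intro ε x
    obtain ⟨ζ', h'⟩ := exists_fluxPotential_line hU H hD.frame_torsion hh hW
      (contDiff_bentPotential u₀ l hf ε) (hinb ε) (hdef ε)
    have hX : R < |R + 1| := by rw [abs_of_pos (by linarith)]; linarith
    have e1 := h' (R + 1)
    have e2 := bentPotential_eventuallyEq u₀ l hR ε hX
    rw [fluxPotential_congr e2, hζ, e2.eq_of_nhds] at e1
    rw [h' x, add_left_cancel e1]
  obtain ⟨P, hP⟩ : ∃ P, P = etaL D u₀ - psiB D κ u₀ + (D.ξ - omL D κ) := ⟨_, rfl⟩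
  obtain ⟨e, he⟩ : ∃ e, e = etaL D l - psiB D κ l := ⟨_, rfl⟩
  -- The first variation is a quadratic polynomial in $\sin\varepsilon$, and only its linear
  -- coefficient matters at $\varepsilon=0$.
  have hI : ∀ ε, ∫ x in -(R + 1)..(R + 1),
      fderiv ℝ h (jet N (bentPotential u₀ l f ε) x) (jetDir N f y x) =
      (∫ x in -(R + 1)..(R + 1), -(f x * phiB D (frame D u₀ y) (x • P + ζ)))
        + Real.sin ε * (∫ x in -(R + 1)..(R + 1), -(f x * f x * phiB D (frame D u₀ y) e
          + f x * deriv f x * phiB D (psiB D y l) (x • P + ζ)))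
        + Real.sin ε ^ 2 * ∫ x in -(R + 1)..(R + 1),
          -(f x * f x * deriv f x * phiB D (psiB D y l) e) := by
    intro ε
    have hfc' := hf.continuous
    have hfd := (contDiff_deriv hf).continuous
    rw [← integral_eq_intervalIntegral (by linarith) fun x hx => by rw [hdir x hx, map_zero]]
    have := integral_fderiv_jet hU.isOpen hh.1 (contDiff_bentPotential u₀ l hf ε) (hinb ε) hf hfc y
    rw [show (∫ x, fderiv ℝ h (jet N (bentPotential u₀ l f ε) x) (jetDir N f y x)) = _ from this,
      integral_eq_intervalIntegral (R := R + 1) (by linarith)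
        fun x hx => by rw [hR x (by linarith), zero_mul]]
    have c1 : Continuous fun x : ℝ => -(f x * phiB D (frame D u₀ y) (x • P + ζ)) := by
      simp only [phiB_add_right, phiB_smul_right]
      fun_prop
    have c2 : Continuous fun x : ℝ => -(f x * f x * phiB D (frame D u₀ y) e
          + f x * deriv f x * phiB D (psiB D y l) (x • P + ζ)) := by
      simp only [phiB_add_right, phiB_smul_right]
      fun_prop
    have c3 : Continuous fun x : ℝ => -(f x * f x * deriv f x * phiB D (psiB D y l) e) := by
      fun_prop
    have c4 := c1.fun_add (c2.const_mul (Real.sin ε))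
    rw [← intervalIntegral.integral_const_mul, ← intervalIntegral.integral_const_mul,
      ← intervalIntegral.integral_add (c1.intervalIntegrable _ _)
        ((c2.const_mul _).intervalIntegrable _ _), ← intervalIntegral.integral_add
        (c4.intervalIntegrable _ _) ((c3.const_mul _).intervalIntegrable _ _)]
    congr 1
    funext x
    rw [dotL_variationalDeriv hD hG (hinb ε) κ, hpot, deriv_bentPotential u₀ l hf, bentLine,
      bentPotential, hP, he]
    simp [frame]
    ring
  have d1 := hasDerivAt_integral_fderiv_jet hU.isOpen hh.1 hf hin y (-(R + 1)) (R + 1)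
  simp only [hI] at d1
  have d2 := (((Real.hasDerivAt_sin 0).mul_const (∫ x in -(R + 1)..(R + 1),
    -(f x * f x * phiB D (frame D u₀ y) e
      + f x * deriv f x * phiB D (psiB D y l) (x • P + ζ)))).const_add
    (∫ x in -(R + 1)..(R + 1), -(f x * phiB D (frame D u₀ y) (x • P + ζ)))).fun_add
    (((Real.hasDerivAt_sin 0).fun_pow 2).mul_const (∫ x in -(R + 1)..(R + 1),
          -(f x * f x * deriv f x * phiB D (psiB D y l) e)))
  rw [d1.unique d2, ← hP, ← he]
  simp only [Real.cos_zero, Real.sin_zero, one_mul]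
  have hfc' := hf.continuous
  have hfd := (contDiff_deriv hf).continuous
  -- A total derivative vanishing at both ends trades the integral with $f f'$ for $-\tfrac12\int
  -- f^2$ times $\phi(\psi(y,l),P)$.
  have hb := intervalIntegral.integral_eq_sub_of_hasDerivAt (a := -(R + 1)) (b := R + 1)
    (f := fun x => f x * f x * phiB D (psiB D y l) (x • P + ζ))
    (f' := fun x => 2 * (f x * deriv f x * phiB D (psiB D y l) (x • P + ζ))
      + f x * f x * phiB D (psiB D y l) P) (fun x _ => by
        simp only [phiB_add_right, phiB_smul_right]
        have := ((hasDerivAt_of_contDiff hf x).fun_mul (hasDerivAt_of_contDiff hf x)).fun_mul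
          (((hasDerivAt_id x).mul_const (phiB D (psiB D y l) P)).add_const
            (phiB D (psiB D y l) ζ))
        refine this.congr_deriv ?_
        simp only [id]
        ring) (by
        refine Continuous.intervalIntegrable ?_ _ _
        simp only [phiB_add_right, phiB_smul_right]
        fun_prop)
  rw [hR (R + 1) (by rw [abs_of_pos (by linarith)]; linarith),
    hR (-(R + 1)) (by rw [abs_neg, abs_of_pos (by linarith)]; linarith)] at hb
  have c2 : Continuous fun x : ℝ => f x * deriv f x * phiB D (psiB D y l) (x • P + ζ) := by
    simp only [phiB_add_right, phiB_smul_right]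
    fun_prop
  have c1 : Continuous fun x : ℝ => f x * f x := by fun_prop
  rw [intervalIntegral.integral_add ((c2.const_mul 2).intervalIntegrable _ _)
    ((c1.mul_const _).intervalIntegrable _ _), intervalIntegral.integral_const_mul,
    intervalIntegral.integral_mul_const] at hb
  rw [intervalIntegral.integral_neg, intervalIntegral.integral_add
    ((c1.mul_const _).intervalIntegrable _ _) (c2.intervalIntegrable _ _),
    intervalIntegral.integral_mul_const]
  linear_combination (-1 / 2 : ℝ) * hb

/-- The Hessian of $h$ is symmetric, and the two directions use the same $f$. Exchanging them and
cancelling $\int f^2$ gives the relation up to terms in the unknown $\kappa$. -/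
theorem eta_relation (hU : IsConservativeSystem U V) (H : IsFlatOp U (opG G) (opC c) C)
    (hD : IsFlatFrame D U (fun u => linOf (G u)⁻¹) C) (hG : ∀ u ∈ U, (G u).det ≠ 0)
    (hh : IsDensity U V G c h) (hW : ∀ u ∈ U, frame D u (V u) = etaL D u + D.ξ)
    {u₀ : Fin n → ℝ} (hu : u₀ ∈ U) (y z : Fin n → ℝ) :
    phiB D (frame D u₀ y) (etaL D z) - phiB D (frame D u₀ z) (etaL D y)
      - phiB D (psiB D y z) (etaL D u₀ + D.ξ) = 0 := by
  obtain ⟨f, hf, hfc, hf0⟩ := exists_bump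
  obtain ⟨R, h0, hR⟩ := exists_interval_of_hasCompactSupport hfc
  obtain ⟨t, ht, hy⟩ := exists_bentLine_mem hU.isOpen hu y (contDiff_deriv hf) hfc.deriv
  obtain ⟨s, hs, hz⟩ := exists_bentLine_mem hU.isOpen hu z (contDiff_deriv hf) hfc.deriv
  obtain ⟨κ, hκ⟩ := exists_defect_line hU H hh hu
  have hdl : ∀ x, deriv (fun x : ℝ => x • u₀) x = u₀ := fun x => by
    simpa using ((hasDerivAt_id x).smul_const u₀).deriv
  have hlin : ContDiff ℝ ∞ fun x : ℝ => x • u₀ := contDiff_id.smul contDiff_const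
  have hinl : ∀ x, deriv (fun x : ℝ => x • u₀) x ∈ U := fun x => by rwa [hdl]
  obtain ⟨ζ, hζ⟩ := exists_fluxPotential_line hU H hD.frame_torsion hh hW hlin hinl hκ
  have e1 := second_variation hU H hD hG hh hW hκ hζ hf hfc h0 hR hy (s • z)
  have e2 := second_variation hU H hD hG hh hW hκ hζ hf hfc h0 hR hz (t • y)
  have hsym : ∀ x, fderiv ℝ (fderiv ℝ h) (jet N (fun x : ℝ => x • u₀) x) (jetDir N f (t • y) x)
      (jetDir N f (s • z) x) = fderiv ℝ (fderiv ℝ h) (jet N (fun x : ℝ => x • u₀) x)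
        (jetDir N f (s • z) x) (jetDir N f (t • y) x) := by
    intro x
    have : IsSymmSndFDerivAt ℝ h (jet N (fun x : ℝ => x • u₀) x) :=
      ((hh.1.contDiffAt ((isOpen_jetDomain hU.isOpen).mem_nhds (jet_mem hinl x))).of_le
        (ENat.LEInfty.out : (2 : WithTop ℕ∞) ≤ ∞)).isSymmSndFDerivAt (by simp)
    exact this _ _
  simp only [hsym] at e1
  have hpos := integral_sq_pos hf.continuous hfc hf0
  rw [integral_eq_intervalIntegral (R := R + 1) (by linarith)
    fun x hx => by rw [hR x (by linarith), zero_mul]] at hpos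
  have e3 := mul_left_cancel₀ (neg_ne_zero.2 hpos.ne') (e1.symm.trans e2)
  have hts : s * t ≠ 0 := (mul_pos hs ht).ne'
  simp only [map_smul, smul_apply, frame_smul, phiB_smul_left, phiB_smul_right, ← smul_sub] at e3
  have e4 : (s * t) * (phiB D (frame D u₀ y) (etaL D z - psiB D κ z)
      - phiB D (frame D u₀ z) (etaL D y - psiB D κ y) - 1 / 2 * phiB D (psiB D y z)
        (etaL D u₀ - psiB D κ u₀ + (D.ξ - omL D κ)) + 1 / 2 * phiB D (psiB D z y)
        (etaL D u₀ - psiB D κ u₀ + (D.ξ - omL D κ))) = 0 := by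
    linear_combination -e3
  have e5 := (mul_eq_zero.1 e4).resolve_left hts
  -- The terms in $\kappa$ cancel by the quadratic relations for $\psi$ and $\omega$.
  have k1 := hD.psi_psi y z κ u₀
  have k2 := hD.omega_psi y z κ
  rw [hD.skew z y] at e5
  rw [hD.skew z κ] at k1 k2
  rw [hD.symm (psiB D κ u₀)] at k1
  rw [hD.symm (omL D κ)] at k2
  simp only [frame, phiB_add_left, phiB_add_right, phiB_sub_right, phiB_neg_left,
    phiB_neg_right] at e5 k1 k2 ⊢
  linarith

/-- The relation of `eta_relation` is affine in the base point: its linear part is `psi_eta`, its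
constant part `psi_xi`. -/
theorem isMonge_of_hamiltonian (hU : IsConservativeSystem U V) (H : IsFlatOp U (opG G) (opC c) C)
    (hD : IsFlatFrame D U (fun u => linOf (G u)⁻¹) C) (hG : ∀ u ∈ U, (G u).det ≠ 0)
    (hh : IsDensity U V G c h) (hW : ∀ u ∈ U, frame D u (V u) = etaL D u + D.ξ) : IsMonge D := by
  obtain ⟨u₀, hu₀⟩ := hU.isConnected.nonempty
  have key : ∀ y z, (∀ t, phiB D (psiB D y t) (etaL D z) - phiB D (psiB D z t) (etaL D y)
      - phiB D (psiB D y z) (etaL D t) = 0) ∧ phiB D (omL D y) (etaL D z)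
      - phiB D (omL D z) (etaL D y) - phiB D (psiB D y z) D.ξ = 0 := by
    intro y z
    refine affine_eq_zero hU.isOpen hu₀
      (A := fun t => phiB D (psiB D y t) (etaL D z) - phiB D (psiB D z t) (etaL D y)
      - phiB D (psiB D y z) (etaL D t)) ?_ ?_ fun w hw => ?_
    · intros; simp; ring
    · intros; simp; ring
    · have := eta_relation hU H hD hG hh hW hw y z
      simp only [frame, phiB_add_left, phiB_add_right] at this
      linarith
  refine ⟨hD.symm, hD.nondegenerate, hD.skew, hD.psi_psi, hD.omega_psi, fun y z w => ?_,
    fun y z => ?_⟩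
  · have := (key y z).1 w
    rw [hD.skew w y, phiB_neg_left]
    linarith
  · have := (key y z).2
    linarith

theorem exists_describes (hU : IsConservativeSystem U V) (hP : IsHamiltonianStructure U V G c) :
    ∃ D : MongeData n, D.Describes U V fun u => (G u)⁻¹ := by
  obtain ⟨hop, N, h, hh⟩ := hP
  have H := isFlatOp_of_isHamiltonianOp hU.isOpen hop
  obtain ⟨D, hD⟩ := exists_flatFrame hU.isConnected hop.smooth_G hop.nondegenerate H
  obtain ⟨L, ξ, hL⟩ := exists_flux_affine hU H hD.frame_torsion hh
  -- The frame comes first, then the flux relation in it, so $\eta$ and $\xi$ are filled in only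
  -- now.
  let D' : MongeData n := ⟨D.φ, D.ψ, D.om, fun i j => L (Pi.single j 1) i, ξ⟩
  have hL' : etaL D' = L := linOf_coeff L
  have hD' : IsFlatFrame D' U (fun u => linOf (G u)⁻¹) (opH G c) :=
    ⟨hD.symm, hD.nondegenerate, hD.skew, hD.psi_psi, hD.omega_psi, hD.metric, hD.frame_torsion⟩
  have hW : ∀ u ∈ U, frame D' u (V u) = etaL D' u + D'.ξ := fun u hu => by
    rw [hL']
    exact hL u hu
  exact ⟨D', (describes_iff D').2
    ⟨isMonge_of_hamiltonian hU H hD' hop.nondegenerate hh hW, hD'.metric, hW⟩⟩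

end

section

/-! ### Reciprocal transformations -/

section

variable {E : Type*} [NormedAddCommGroup E] [NormedSpace ℝ E] [FiniteDimensional ℝ E]

theorem isOpen_image_of_det_ne_zero {U : Set E} {T : E → E} (hU : IsOpen U)
    (hT : ContDiffOn ℝ ∞ T U) (hd : ∀ u ∈ U, (fderiv ℝ T u).det ≠ 0) : IsOpen (T '' U) := by
  have := FiniteDimensional.complete ℝ E
  rw [isOpen_iff_mem_nhds]
  rintro _ ⟨u, hu, rfl⟩
  have hc := hT.contDiffAt (hU.mem_nhds hu)
  have hs : HasStrictFDerivAt T (((fderiv ℝ T u).toContinuousLinearEquivOfDetNeZero (hd u hu) :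
      E ≃L[ℝ] E) : E →L[ℝ] E) u := by
    rw [ContinuousLinearMap.coe_toContinuousLinearEquivOfDetNeZero]
    exact hc.hasStrictFDerivAt (by simp)
  rw [← hs.map_nhds_eq_of_equiv]
  exact image_mem_map (hU.mem_nhds hu)

theorem contDiffOn_leftInverse {U : Set E} {T S : E → E} (hU : IsOpen U)
    (hT : ContDiffOn ℝ ∞ T U) (hd : ∀ u ∈ U, (fderiv ℝ T u).det ≠ 0) (hS : ∀ u ∈ U, S (T u) = u) :
    ContDiffOn ℝ ∞ S (T '' U) := by
  have := FiniteDimensional.complete ℝ E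
  rintro _ ⟨u, hu, rfl⟩
  have hc := hT.contDiffAt (hU.mem_nhds hu)
  have h0 : (∞ : WithTop ℕ∞) ≠ 0 := by simp
  have hf : HasFDerivAt T (((fderiv ℝ T u).toContinuousLinearEquivOfDetNeZero (hd u hu) :
      E ≃L[ℝ] E) : E →L[ℝ] E) u := by
    rw [ContinuousLinearMap.coe_toContinuousLinearEquivOfDetNeZero]
    exact (hc.differentiableAt h0).hasFDerivAt
  have h1 := (hc.hasStrictFDerivAt' hf h0).localInverse_unique (g := S)
    (by filter_upwards [hU.mem_nhds hu] with w hw using hS w hw)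
  have h2 := hc.to_localInverse hf h0
  exact (h2.congr_of_eventuallyEq h1).contDiffWithinAt

theorem det_ne_zero_of_injective {L : E →L[ℝ] E} (h : Function.Injective L) : L.det ≠ 0 := by
  have h1 : LinearMap.ker (L : E →ₗ[ℝ] E) = ⊥ := LinearMap.ker_eq_bot.2 h
  intro h0
  have := LinearMap.bot_lt_ker_of_det_eq_zero (f := (L : E →ₗ[ℝ] E)) h0
  rw [h1] at this
  exact lt_irrefl _ this

theorem injective_of_det_ne_zero {L : E →L[ℝ] E} (h : L.det ≠ 0) : Function.Injective L :=
  (L.toContinuousLinearEquivOfDetNeZero h).injective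

end

variable {n : ℕ} {R : Reciprocal n} {U U₁ : Set (Fin n → ℝ)}
  {V V₁ : (Fin n → ℝ) → (Fin n → ℝ)}

theorem Xx_eq (R : Reciprocal n) (u : Fin n → ℝ) : R.Xx u = dotL R.α u + R.a := by
  rw [Reciprocal.Xx, dotL_apply]

theorem Xt_eq (R : Reciprocal n) (u : Fin n → ℝ) : R.Xt u = dotL R.α u + R.b := by
  rw [Reciprocal.Xt, dotL_apply]

theorem Tx_eq (R : Reciprocal n) (u : Fin n → ℝ) : R.Tx u = dotL R.β u + R.c := by
  rw [Reciprocal.Tx, dotL_apply]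

theorem Tt_eq (R : Reciprocal n) (u : Fin n → ℝ) : R.Tt u = dotL R.β u + R.d := by
  rw [Reciprocal.Tt, dotL_apply]

theorem density_eq (R : Reciprocal n) {u v : Fin n → ℝ} (h : R.jac u v ≠ 0) :
    u = R.Xx u • R.newDensity u v + R.Tx u • R.newFlux u v := by
  funext i
  have := (R.form_eq u v h i).1
  simp only [Pi.add_apply, Pi.smul_apply, smul_eq_mul]
  linarith

theorem flux_eq (R : Reciprocal n) {u v : Fin n → ℝ} (h : R.jac u v ≠ 0) :
    v = R.Xt v • R.newDensity u v + R.Tt v • R.newFlux u v := by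
  funext i
  have := (R.form_eq u v h i).2
  simp only [Pi.add_apply, Pi.smul_apply, smul_eq_mul]
  linarith

/-! ### Derivatives of the new densities and fluxes. -/

section

variable (hU : IsConservativeSystem U V) (hj : ∀ u ∈ U, R.jac u (V u) ≠ 0)

include hU

omit hU in
theorem contDiffOn_affine (α : Fin n → ℝ) (a : ℝ) {W : (Fin n → ℝ) → (Fin n → ℝ)}
    (hW : ContDiffOn ℝ ∞ W U) : ContDiffOn ℝ ∞ (fun u => dotL α (W u) + a) U :=
  ((dotL α).contDiff.comp_contDiffOn hW).add contDiffOn_const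

theorem contDiffOn_jac : ContDiffOn ℝ ∞ (fun u => R.jac u (V u)) U := by
  simp only [Reciprocal.jac, Xx_eq, Xt_eq, Tx_eq, Tt_eq]
  exact ((contDiffOn_affine _ _ contDiffOn_id).mul (contDiffOn_affine _ _ hU.smooth)).sub
    ((contDiffOn_affine _ _ hU.smooth).mul (contDiffOn_affine _ _ contDiffOn_id))

include hj

theorem contDiffOn_newDensity : ContDiffOn ℝ ∞ (fun u => R.newDensity u (V u)) U := by
  refine contDiffOn_pi.2 fun i => ?_
  refine ContDiffOn.div ?_ (contDiffOn_jac hU) hj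
  simp only [Tx_eq, Tt_eq]
  exact ((contDiffOn_affine _ _ hU.smooth).mul (contDiffOn_pi.1 contDiffOn_id i)).sub
    ((contDiffOn_affine _ _ contDiffOn_id).mul (contDiffOn_pi.1 hU.smooth i))

theorem contDiffOn_newFlux : ContDiffOn ℝ ∞ (fun u => R.newFlux u (V u)) U := by
  refine contDiffOn_pi.2 fun i => ?_
  refine ContDiffOn.div ?_ (contDiffOn_jac hU) hj
  simp only [Xx_eq, Xt_eq]
  exact ((contDiffOn_affine _ _ contDiffOn_id).mul (contDiffOn_pi.1 hU.smooth i)).sub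
    ((contDiffOn_affine _ _ hU.smooth).mul (contDiffOn_pi.1 contDiffOn_id i))

/-- The derivative of $u=X_x\tilde u+T_x\tilde V$, which holds near $u$ because $U$ is open. -/
theorem fderiv_density (z : Fin n → ℝ) {u : Fin n → ℝ} (hu : u ∈ U) :
    z = R.Xx u • fderiv ℝ (fun u => R.newDensity u (V u)) u z
      + R.Tx u • fderiv ℝ (fun u => R.newFlux u (V u)) u z
      + dotL R.α z • R.newDensity u (V u) + dotL R.β z • R.newFlux u (V u) := by
  have dT := hasDerivAt_add_smul (hasFDerivAt_of_contDiffOn hU.isOpen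
    (contDiffOn_newDensity (R := R) hU hj) hu) z
  have dF := hasDerivAt_add_smul (hasFDerivAt_of_contDiffOn hU.isOpen
    (contDiffOn_newFlux (R := R) hU hj) hu) z
  have dX := (hasDerivAt_add_smul (dotL R.α).hasFDerivAt (u := u) z).add_const R.a
  have dY := (hasDerivAt_add_smul (dotL R.β).hasFDerivAt (u := u) z).add_const R.c
  have d1 := (dX.smul dT).fun_add (dY.smul dF)
  have d2 := hasDerivAt_add_smul (hasFDerivAt_id u) z
  have hev : (fun ε : ℝ => id (u + ε • z)) =ᶠ[𝓝 0] fun ε : ℝ =>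
      (dotL R.α (u + ε • z) + R.a) • R.newDensity (u + ε • z) (V (u + ε • z))
        + (dotL R.β (u + ε • z) + R.c) • R.newFlux (u + ε • z) (V (u + ε • z)) := by
    filter_upwards [eventually_add_smul_mem hU.isOpen hu z] with ε hε
    rw [← Xx_eq, ← Tx_eq]
    exact density_eq R (hj _ hε)
  have := d2.unique (d1.congr_of_eventuallyEq hev)
  simp only [ContinuousLinearMap.id_apply, zero_smul, add_zero] at this
  rw [← Xx_eq, ← Tx_eq] at this
  conv_lhs => rw [this]
  abel

theorem fderiv_flux (z : Fin n → ℝ) {u : Fin n → ℝ} (hu : u ∈ U) :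
    fderiv ℝ V u z = R.Xt (V u) • fderiv ℝ (fun u => R.newDensity u (V u)) u z
      + R.Tt (V u) • fderiv ℝ (fun u => R.newFlux u (V u)) u z
      + dotL R.α (fderiv ℝ V u z) • R.newDensity u (V u)
      + dotL R.β (fderiv ℝ V u z) • R.newFlux u (V u) := by
  have dT := hasDerivAt_add_smul (hasFDerivAt_of_contDiffOn hU.isOpen
    (contDiffOn_newDensity (R := R) hU hj) hu) z
  have dF := hasDerivAt_add_smul (hasFDerivAt_of_contDiffOn hU.isOpen
    (contDiffOn_newFlux (R := R) hU hj) hu) z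
  have dV := hasDerivAt_add_smul (hasFDerivAt_of_contDiffOn hU.isOpen hU.smooth hu) z
  have dX := ((dotL R.α).hasFDerivAt.comp_hasDerivAt (0 : ℝ) dV).add_const R.b
  have dY := ((dotL R.β).hasFDerivAt.comp_hasDerivAt (0 : ℝ) dV).add_const R.d
  have d1 := (dX.smul dT).fun_add (dY.smul dF)
  have hev : (fun ε : ℝ => V (u + ε • z)) =ᶠ[𝓝 0] fun ε : ℝ =>
      (dotL R.α (V (u + ε • z)) + R.b) • R.newDensity (u + ε • z) (V (u + ε • z))
        + (dotL R.β (V (u + ε • z)) + R.d) • R.newFlux (u + ε • z) (V (u + ε • z)) := by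
    filter_upwards [eventually_add_smul_mem hU.isOpen hu z] with ε hε
    rw [← Xt_eq, ← Tt_eq]
    exact flux_eq R (hj _ hε)
  have := dV.unique (d1.congr_of_eventuallyEq hev)
  simp only [Function.comp_apply, zero_smul, add_zero] at this
  rw [← Xt_eq, ← Tt_eq] at this
  conv_lhs => rw [this]
  abel

end

section

variable (hU : IsConservativeSystem U V) (hR : R.Transforms U V U₁ V₁)

include hU hR

theorem transforms_isConservativeSystem : IsConservativeSystem U₁ V₁ := by
  have hT := contDiffOn_newDensity hU hR.jac_ne_zero
  have hF := contDiffOn_newFlux hU hR.jac_ne_zero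
  obtain ⟨T, hTd⟩ : ∃ T, T = fun u => R.newDensity u (V u) := ⟨_, rfl⟩
  have hreg := hR.regular
  have hinj := hR.injOn
  have hran := hR.range_eq
  have hfl := hR.flux_eq
  have hfl' : ∀ u ∈ U, V₁ (T u) = R.newFlux u (V u) := by rw [hTd]; exact hfl
  rw [← hTd] at hT hreg hinj hran
  have hS : ∀ u ∈ U, Function.invFunOn T U (T u) = u := fun u hu => hinj.leftInvOn_invFunOn hu
  refine ⟨hran ▸ isOpen_image_of_det_ne_zero hU.isOpen hT hreg,
    hran ▸ hU.isConnected.image T hT.continuousOn, ?_⟩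
  rw [hran]
  have h1 := hF.comp (contDiffOn_leftInverse hU.isOpen hT hreg hS) (by
    rintro _ ⟨u, hu, rfl⟩
    show Function.invFunOn T U (T u) ∈ U
    rw [hS u hu]
    exact hu)
  refine h1.congr ?_
  rintro _ ⟨u, hu, rfl⟩
  rw [hfl' u hu, Function.comp_apply, hS u hu]

theorem fderiv_newFlux (z : Fin n → ℝ) {u : Fin n → ℝ} (hu : u ∈ U) :
    fderiv ℝ V₁ (R.newDensity u (V u)) (fderiv ℝ (fun u => R.newDensity u (V u)) u z) =
      fderiv ℝ (fun u => R.newFlux u (V u)) u z := by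
  have hU₁ := transforms_isConservativeSystem hU hR
  have hm : R.newDensity u (V u) ∈ U₁ := hR.range_eq ▸ mem_image_of_mem _ hu
  have dT := hasFDerivAt_of_contDiffOn hU.isOpen (contDiffOn_newDensity hU hR.jac_ne_zero) hu
  have dF := hasFDerivAt_of_contDiffOn hU.isOpen (contDiffOn_newFlux hU hR.jac_ne_zero) hu
  have dV := hasFDerivAt_of_contDiffOn hU₁.isOpen hU₁.smooth hm
  have d1 := dV.comp u dT
  have hev : (V₁ ∘ fun u => R.newDensity u (V u)) =ᶠ[𝓝 u] fun u => R.newFlux u (V u) := by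
    filter_upwards [hU.isOpen.mem_nhds hu] with w hw using hR.flux_eq w hw
  have := (d1.congr_of_eventuallyEq hev.symm).unique dF
  exact DFunLike.congr_fun this z

/-- Let $z$ be an eigenvector of $\partial V$ for $\lambda$. Subtracting $\lambda$ times
`fderiv_density` from `fderiv_flux` cancels the terms in $\alpha$ and $\beta$. So $d\tilde u(z)$ is
an eigenvector of the new Jacobian for the Möbius image of $\lambda$, and the Möbius map is
injective because its determinant is `jac`. -/
theorem transforms_isStrictlyHyperbolic (hV : IsStrictlyHyperbolic U V) :
    IsStrictlyHyperbolic U₁ V₁ := by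
  rw [IsStrictlyHyperbolic, hR.range_eq]
  rintro _ ⟨u, hu, rfl⟩
  obtain ⟨ev, hinj, hev⟩ := hV u hu
  have hj := hR.jac_ne_zero u hu
  have hj' := hj
  rw [Reciprocal.jac] at hj'
  have key : ∀ i, R.Tt (V u) - ev i * R.Tx u ≠ 0 ∧ Module.End.HasEigenvalue
      ((fderiv ℝ V₁ (R.newDensity u (V u)) : (Fin n → ℝ) →L[ℝ] (Fin n → ℝ)) :
        (Fin n → ℝ) →ₗ[ℝ] (Fin n → ℝ))
      ((ev i * R.Xx u - R.Xt (V u)) / (R.Tt (V u) - ev i * R.Tx u)) := by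
    intro i
    obtain ⟨z, hz⟩ := (hev i).exists_hasEigenvector
    have hz1 : fderiv ℝ V u z = ev i • z := hz.apply_eq_smul
    have hz0 : z ≠ 0 := hz.2
    have e1 := fderiv_density hU hR.jac_ne_zero z hu
    have e2 := fderiv_flux hU hR.jac_ne_zero z hu
    have e3 := fderiv_newFlux hU hR z hu
    obtain ⟨p, hp⟩ : ∃ p, p = fderiv ℝ (fun u => R.newDensity u (V u)) u z := ⟨_, rfl⟩
    have hp0 : p ≠ 0 := by
      intro h
      apply hz0
      apply injective_of_det_ne_zero (hR.regular u hu)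
      rw [map_zero, ← hp, h]
    rw [← hp] at e1 e2 e3
    rw [hz1] at e2
    simp only [map_smul, smul_eq_mul, mul_smul] at e2
    have e4 : (ev i * R.Xx u - R.Xt (V u)) • p =
        (R.Tt (V u) - ev i * R.Tx u) • fderiv ℝ (fun u => R.newFlux u (V u)) u z := by
      have e5 := congrArg (fun w => ev i • w) e1
      rw [e2] at e5
      rw [← sub_eq_zero] at e5 ⊢
      rw [← neg_eq_zero, ← e5]
      module
    -- If the denominator vanished, so would the numerator, as $p\ne0$. Then `jac` would be zero.
    have hne : R.Tt (V u) - ev i * R.Tx u ≠ 0 := by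
      intro h
      rw [h, zero_smul] at e4
      have := (smul_eq_zero.1 e4).resolve_right hp0
      apply hj'
      linear_combination R.Xx u * h - R.Tx u * -this
    refine ⟨hne, Module.End.hasEigenvalue_of_hasEigenvector (x := p)
      ⟨Module.End.mem_eigenspace_iff.2 ?_, hp0⟩⟩
    show fderiv ℝ V₁ _ p = _
    rw [e3, div_eq_inv_mul, mul_smul, e4, smul_smul, inv_mul_cancel₀ hne, one_smul]
  refine ⟨fun i => (ev i * R.Xx u - R.Xt (V u)) / (R.Tt (V u) - ev i * R.Tx u), ?_,
    fun i => (key i).2⟩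
  intro i j hij
  simp only at hij
  rw [div_eq_div_iff (key i).1 (key j).1] at hij
  apply hinj
  have : (ev i - ev j) * (R.Xx u * R.Tt (V u) - R.Xt (V u) * R.Tx u) = 0 := by
    linear_combination hij
  exact sub_eq_zero.1 ((mul_eq_zero.1 this).resolve_right hj')

/-- A left null vector $(s,t)$ of the matrix of $a,b,c,d$ gives a covector $\ell=s\alpha+t\beta$
with $\ell\cdot\tilde u=s$ and $\ell\cdot\tilde V=t$ identically. The densities $\tilde u$ fill an
open set, so $\ell\cdot{}$ is zero and $s=0$; then $t=0$ as well. -/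
theorem det_ne_zero_of_transforms : R.a * R.d - R.b * R.c ≠ 0 := by
  intro h0
  have hU₁ := transforms_isConservativeSystem hU hR
  obtain ⟨u, hu⟩ := hU.isConnected.nonempty
  obtain ⟨s, t, hst, h1, h2⟩ : ∃ s t : ℝ, ¬ (s = 0 ∧ t = 0) ∧ s * R.a + t * R.c = 0 ∧
      s * R.b + t * R.d = 0 := by
    by_cases hac : R.c = 0 ∧ R.a = 0
    · by_cases hbd : R.d = 0 ∧ R.b = 0
      · exact ⟨1, 0, by simp, by simp [hac], by simp [hbd]⟩
      · exact ⟨R.d, -R.b, by simpa using hbd, by simp [hac], by ring⟩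
    · exact ⟨R.c, -R.a, by simpa using hac, by ring, by linear_combination -h0⟩
  obtain ⟨ℓ, hℓ⟩ : ∃ ℓ, ℓ = s • R.α + t • R.β := ⟨_, rfl⟩
  have key : ∀ u ∈ U, dotL ℓ (R.newDensity u (V u)) = s ∧ dotL ℓ (R.newFlux u (V u)) = t := by
    intro u hu
    have hj := hR.jac_ne_zero u hu
    have e1 := congrArg (dotL ℓ) (density_eq R hj)
    have e2 := congrArg (dotL ℓ) (flux_eq R hj)
    rw [map_add, map_smul, map_smul, smul_eq_mul, smul_eq_mul] at e1 e2
    obtain ⟨p, hp⟩ : ∃ p, p = dotL ℓ (R.newDensity u (V u)) := ⟨_, rfl⟩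
    obtain ⟨q, hq⟩ : ∃ q, q = dotL ℓ (R.newFlux u (V u)) := ⟨_, rfl⟩
    have f1 : dotL ℓ u = s * R.Xx u + t * R.Tx u := by
      rw [hℓ, Xx_eq, Tx_eq]
      simp only [map_add, map_smul, add_apply, smul_apply, smul_eq_mul]
      linear_combination -h1
    have f2 : dotL ℓ (V u) = s * R.Xt (V u) + t * R.Tt (V u) := by
      rw [hℓ, Xt_eq, Tt_eq]
      simp only [map_add, map_smul, add_apply, smul_apply, smul_eq_mul]
      linear_combination -h2
    rw [← hp, ← hq] at e1 e2 ⊢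
    rw [f1] at e1
    rw [f2] at e2
    rw [Reciprocal.jac] at hj
    constructor
    · apply mul_right_cancel₀ hj
      linear_combination -R.Tt (V u) * e1 + R.Tx u * e2
    · apply mul_right_cancel₀ hj
      linear_combination R.Xt (V u) * e1 - R.Xx u * e2
  have hm : R.newDensity u (V u) ∈ U₁ := hR.range_eq ▸ mem_image_of_mem _ hu
  have h3 := affine_eq_zero hU₁.isOpen hm (A := fun w => dotL ℓ w) (B := -s)
    (by intros; simp) (by intros; simp) (by
      rw [hR.range_eq]
      rintro _ ⟨w, hw, rfl⟩
      simp only [(key w hw).1, add_neg_cancel])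
  have h4 := (key u hu).2
  have h5 := h3.2
  rw [h3.1] at h4
  exact hst ⟨by linarith, h4.symm⟩

end

/-- The inverse reciprocal transformation. -/
def invReciprocal (R : Reciprocal n) : Reciprocal n where
  α := (R.a * R.d - R.b * R.c)⁻¹ • (R.b • R.β - R.d • R.α)
  β := (R.a * R.d - R.b * R.c)⁻¹ • (R.c • R.α - R.a • R.β)
  a := (R.a * R.d - R.b * R.c)⁻¹ * R.d
  b := -((R.a * R.d - R.b * R.c)⁻¹ * R.b)
  c := -((R.a * R.d - R.b * R.c)⁻¹ * R.c)
  d := (R.a * R.d - R.b * R.c)⁻¹ * R.a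

section

variable (h0 : R.a * R.d - R.b * R.c ≠ 0) {u v : Fin n → ℝ} (hj : R.jac u v ≠ 0)

include h0 hj

/-- These are the coefficients of $dx,dt$ expressed through $d\tilde x,d\tilde t$, that is, the
inverse of the $2\times2$ matrix of the change of variables. The constants themselves come from
inverting a block triangular matrix. -/
theorem invReciprocal_coeff :
    (invReciprocal R).Xx (R.newDensity u v) = R.Tt v / R.jac u v ∧
    (invReciprocal R).Tx (R.newDensity u v) = -R.Tx u / R.jac u v ∧
    (invReciprocal R).Xt (R.newFlux u v) = -R.Xt v / R.jac u v ∧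
    (invReciprocal R).Tt (R.newFlux u v) = R.Xx u / R.jac u v := by
  have e1 := congrArg (dotL R.α) (density_eq R hj)
  have e2 := congrArg (dotL R.β) (density_eq R hj)
  have e3 := congrArg (dotL R.α) (flux_eq R hj)
  have e4 := congrArg (dotL R.β) (flux_eq R hj)
  simp only [map_add, map_smul, smul_eq_mul] at e1 e2 e3 e4
  obtain ⟨p, hp⟩ : ∃ p, p = R.newDensity u v := ⟨_, rfl⟩
  obtain ⟨q, hq⟩ : ∃ q, q = R.newFlux u v := ⟨_, rfl⟩
  rw [← hp, ← hq] at e1 e2 e3 e4 ⊢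
  have hjac : R.jac u v = R.Xx u * R.Tt v - R.Xt v * R.Tx u := rfl
  have a1 := Xx_eq R u
  have a2 := Tx_eq R u
  have a3 := Xt_eq R v
  have a4 := Tt_eq R v
  rw [e1] at a1
  rw [e2] at a2
  rw [e3] at a3
  rw [e4] at a4
  have k : ∀ w x y : ℝ, x * R.jac u v = y * (R.a * R.d - R.b * R.c) →
      w = (R.a * R.d - R.b * R.c)⁻¹ * x → w = y / R.jac u v := fun w x y h hw => by
    rw [eq_div_iff hj, hw, mul_assoc, h, mul_comm, mul_assoc, mul_inv_cancel₀ h0, mul_one]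
  -- The constants are recovered from $X_x=\alpha\cdot u+a$ and its analogues by writing $u,v$ in
  -- terms of $p,q$. The claims then become polynomial identities.
  have ha : R.a = R.Xx u * (1 - dotL R.α p) - R.Tx u * dotL R.α q := by linarith
  have hb : R.b = R.Xt v * (1 - dotL R.α p) - R.Tt v * dotL R.α q := by linarith
  have hc : R.c = R.Tx u * (1 - dotL R.β q) - R.Xx u * dotL R.β p := by linarith
  have hd : R.d = R.Tt v * (1 - dotL R.β q) - R.Xt v * dotL R.β p := by linarith
  refine ⟨k _ (R.b * dotL R.β p - R.d * dotL R.α p + R.d) _ (by rw [hjac, ha, hb, hc, hd]; ring) ?_,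
    k _ (R.c * dotL R.α p - R.a * dotL R.β p - R.c) _ (by rw [hjac, ha, hb, hc, hd]; ring) ?_,
    k _ (R.b * dotL R.β q - R.d * dotL R.α q - R.b) _ (by rw [hjac, ha, hb, hc, hd]; ring) ?_,
    k _ (R.c * dotL R.α q - R.a * dotL R.β q + R.a) _ (by rw [hjac, ha, hb, hc, hd]; ring) ?_⟩
  · rw [Xx_eq]
    simp only [invReciprocal, map_smul, map_sub, smul_apply, sub_apply, smul_eq_mul]
    ring
  · rw [Tx_eq]
    simp only [invReciprocal, map_smul, map_sub, smul_apply, sub_apply, smul_eq_mul]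
    ring
  · rw [Xt_eq]
    simp only [invReciprocal, map_smul, map_sub, smul_apply, sub_apply, smul_eq_mul]
    ring
  · rw [Tt_eq]
    simp only [invReciprocal, map_smul, map_sub, smul_apply, sub_apply, smul_eq_mul]
    ring

theorem jac_invReciprocal :
    (invReciprocal R).jac (R.newDensity u v) (R.newFlux u v) = (R.jac u v)⁻¹ := by
  obtain ⟨h1, h2, h3, h4⟩ := invReciprocal_coeff h0 hj
  rw [Reciprocal.jac, h1, h2, h3, h4]
  have : R.Xx u * R.Tt v - R.Xt v * R.Tx u = R.jac u v := rfl
  field_simp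
  linear_combination this

theorem newDensity_invReciprocal :
    (invReciprocal R).newDensity (R.newDensity u v) (R.newFlux u v) = u := by
  obtain ⟨h1, h2, h3, h4⟩ := invReciprocal_coeff h0 hj
  have h5 := jac_invReciprocal h0 hj
  funext i
  have e := (R.form_eq u v hj i).1
  rw [Reciprocal.newDensity, h2, h4, h5]
  field_simp
  linear_combination -e

theorem newFlux_invReciprocal :
    (invReciprocal R).newFlux (R.newDensity u v) (R.newFlux u v) = v := by
  obtain ⟨h1, h2, h3, h4⟩ := invReciprocal_coeff h0 hj
  have h5 := jac_invReciprocal h0 hj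
  funext i
  have e := (R.form_eq u v hj i).2
  rw [Reciprocal.newFlux, h1, h3, h5]
  field_simp
  linear_combination -e

end

theorem transforms_invReciprocal (hU : IsConservativeSystem U V) (hR : R.Transforms U V U₁ V₁) :
    (invReciprocal R).Transforms U₁ V₁ U V := by
  have h0 := det_ne_zero_of_transforms hU hR
  have hU₁ := transforms_isConservativeSystem hU hR
  have hd : ∀ u ∈ U, (invReciprocal R).newDensity (R.newDensity u (V u))
      (V₁ (R.newDensity u (V u))) = u := fun u hu => by
    rw [hR.flux_eq u hu, newDensity_invReciprocal h0 (hR.jac_ne_zero u hu)]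
  have hj : ∀ u ∈ U₁, (invReciprocal R).jac u (V₁ u) ≠ 0 := by
    rw [hR.range_eq]
    rintro _ ⟨u, hu, rfl⟩
    simp only [hR.flux_eq u hu]
    rw [jac_invReciprocal h0 (hR.jac_ne_zero u hu)]
    exact inv_ne_zero (hR.jac_ne_zero u hu)
  refine ⟨hj, ?_, ?_, ?_, ?_⟩
  · rw [hR.range_eq]
    rintro _ ⟨u, hu, rfl⟩ _ ⟨w, hw, rfl⟩ h
    simp only [hd u hu, hd w hw] at h
    rw [h]
  · intro x hx
    have hS := hasFDerivAt_of_contDiffOn hU₁.isOpen (contDiffOn_newDensity hU₁ hj) hx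
    rw [hR.range_eq] at hx
    obtain ⟨u, hu, rfl⟩ := hx
    have hT := hasFDerivAt_of_contDiffOn hU.isOpen (contDiffOn_newDensity hU hR.jac_ne_zero) hu
    have h1 := hS.comp u hT
    have hev : (fun w => (invReciprocal R).newDensity w (V₁ w)) ∘ (fun u => R.newDensity u (V u))
        =ᶠ[𝓝 u] id := by
      filter_upwards [hU.isOpen.mem_nhds hu] with w hw using hd w hw
    have h2 := h1.unique ((hasFDerivAt_id u).congr_of_eventuallyEq hev)
    -- The composition of the two density maps is the identity, so the derivative of the outer one
    -- is onto, hence injective in finite dimension.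
    have h3 : Function.Surjective (fderiv ℝ (fun w => (invReciprocal R).newDensity w (V₁ w))
        (R.newDensity u (V u))) := fun y => ⟨_, DFunLike.congr_fun h2 y⟩
    exact det_ne_zero_of_injective (LinearMap.injective_iff_surjective
      (f := ((fderiv ℝ (fun w => (invReciprocal R).newDensity w (V₁ w)) (R.newDensity u (V u)) :
        (Fin n → ℝ) →L[ℝ] (Fin n → ℝ)) : (Fin n → ℝ) →ₗ[ℝ] (Fin n → ℝ))).2 h3)
  · rw [hR.range_eq]
    ext u
    constructor
    · intro hu
      exact ⟨_, mem_image_of_mem _ hu, hd u hu⟩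
    · rintro ⟨_, ⟨w, hw, rfl⟩, rfl⟩
      simp only [hd w hw, hw]
  · rw [hR.range_eq]
    rintro _ ⟨u, hu, rfl⟩
    simp only [hd u hu]
    rw [hR.flux_eq u hu, newFlux_invReciprocal h0 (hR.jac_ne_zero u hu)]

end

section

/-! ### Monge data as alternating forms in homogeneous coordinates -/

variable {n : ℕ}

/-- The alternating form on homogeneous coordinates `(y, s, t)` given by Monge data. -/
def hatB (D : MongeData n) (y : Fin n → ℝ) (s t : ℝ) (z : Fin n → ℝ) (s' t' : ℝ) : Fin n → ℝ :=
  psiB D y z + (s' • omL D y - s • omL D z) + (t' • etaL D y - t • etaL D z)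
    + (s * t' - t * s') • D.ξ

theorem hatB_density (D : MongeData n) (y u : Fin n → ℝ) :
    hatB D y 0 0 u 1 0 = frame D u y := by
  simp [hatB, frame]

/-- This is the vanishing of the $4$-form $\phi_{\beta\gamma}B^\beta\wedge B^\gamma$. Sorted by how
often the two extra coordinates occur, its components are `psi_psi`, then `omega_psi` and `psi_eta`,
then `psi_xi`. -/
theorem hatB_cyclic {D : MongeData n} (hD : IsMonge D) (a b c d : Fin n → ℝ)
    (a₁ a₂ b₁ b₂ c₁ c₂ d₁ d₂ : ℝ) :
    phiB D (hatB D a a₁ a₂ b b₁ b₂) (hatB D c c₁ c₂ d d₁ d₂)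
      + phiB D (hatB D b b₁ b₂ c c₁ c₂) (hatB D a a₁ a₂ d d₁ d₂)
      + phiB D (hatB D c c₁ c₂ a a₁ a₂) (hatB D b b₁ b₂ d d₁ d₂) = 0 := by
  have p := hD.psi_psi a b c d
  have o1 := hD.omega_psi a b c
  have o2 := hD.omega_psi a b d
  have o3 := hD.omega_psi a c d
  have o4 := hD.omega_psi b c d
  have e1 := hD.psi_eta a b c
  have e2 := hD.psi_eta a b d
  have e3 := hD.psi_eta a c d
  have e4 := hD.psi_eta b c d
  have x1 := hD.psi_xi a b
  have x2 := hD.psi_xi a c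
  have x3 := hD.psi_xi a d
  have x4 := hD.psi_xi b c
  have x5 := hD.psi_xi b d
  have x6 := hD.psi_xi c d
  have k2 := hD.skew c a
  have k3 := hD.skew d a
  have k5 := hD.skew d b
  simp only [hatB, k2, k3, k5, phiB_add_left, phiB_add_right, phiB_sub_left,
    phiB_sub_right, phiB_smul_left, phiB_smul_right, phiB_neg_left, phiB_neg_right]
    at p o1 o2 o3 o4 e1 e2 e3 e4 x1 x2 x3 x4 x5 x6 ⊢
  -- Symmetry is applied as an ordered rewriting, which brings every product into one normal form.
  simp only [hD.symm] at p o1 o2 o3 o4 e1 e2 e3 e4 x1 x2 x3 x4 x5 x6 ⊢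
  linear_combination p + d₁ * o1 - c₁ * o2 + b₁ * o3 - a₁ * o4 + d₂ * e1 - c₂ * e2 + b₂ * e3
    - a₂ * e4 + (c₁ * d₂ - c₂ * d₁) * x1 - (b₁ * d₂ - b₂ * d₁) * x2 + (b₁ * c₂ - b₂ * c₁) * x3
    + (a₁ * d₂ - a₂ * d₁) * x4 - (a₁ * c₂ - a₂ * c₁) * x5 + (a₁ * b₂ - a₂ * b₁) * x6

theorem hatB_skew {D : MongeData n} (hD : IsMonge D) (y z : Fin n → ℝ) (s t s' t' : ℝ) :
    hatB D y s t z s' t' = - hatB D z s' t' y s t := by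
  rw [hatB, hatB, hD.skew y z]
  module

theorem hatB_combination_right (D : MongeData n) (r r' : ℝ) (y z z' : Fin n → ℝ)
    (s t s₁ t₁ s' t' : ℝ) :
    hatB D y s' t' (r • z + r' • z') (r * s + r' * s₁) (r * t + r' * t₁) =
      r • hatB D y s' t' z s t + r' • hatB D y s' t' z' s₁ t₁ := by
  simp only [hatB, map_add, map_smul]
  module

theorem hatB_self {D : MongeData n} (hD : IsMonge D) (y : Fin n → ℝ) (s t : ℝ) :
    hatB D y s t y s t = 0 := by
  have := hatB_skew hD y y s t s t
  have h2 : (2 : ℝ) • hatB D y s t y s t = 0 := by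
    rw [two_smul]
    nth_rw 1 [this]
    exact neg_add_cancel _
  exact (smul_eq_zero.1 h2).resolve_left two_ne_zero

/-- The vectors $(u,1,0)$ and $(V,0,1)$ span the plane of the congruence line, so the flux relation
says that this plane is isotropic for each form. -/
theorem hatB_flux {D : MongeData n} {u v : Fin n → ℝ} :
    hatB D v 0 1 u 1 0 = 0 ↔ frame D u v = etaL D u + D.ξ := by
  rw [← sub_eq_zero (a := frame D u v)]
  have : hatB D v 0 1 u 1 0 = frame D u v - (etaL D u + D.ξ) := by
    rw [hatB, frame]
    module
  rw [this]

/-- The Monge data of the pullback of the alternating form by a reciprocal transformation. -/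
def pullback (D : MongeData n) (R : Reciprocal n) : MongeData n where
  φ := D.φ
  ψ γ k m := hatB D (Pi.single k 1) (R.α k) (R.β k) (Pi.single m 1) (R.α m) (R.β m) γ
  om γ k := hatB D (Pi.single k 1) (R.α k) (R.β k) 0 R.a R.c γ
  η γ k := hatB D (Pi.single k 1) (R.α k) (R.β k) 0 R.b R.d γ
  ξ := hatB D 0 R.a R.c 0 R.b R.d

theorem phiB_pullback (D : MongeData n) (R : Reciprocal n) : phiB (pullback D R) = phiB D := rfl

theorem dotL_single_right (y : Fin n → ℝ) (i : Fin n) : dotL y (Pi.single i 1) = y i := by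
  rw [dotL_comm, dotL_single]

theorem psiB_pullback (D : MongeData n) (R : Reciprocal n) (y z : Fin n → ℝ) :
    psiB (pullback D R) y z =
      hatB D y (dotL R.α y) (dotL R.β y) z (dotL R.α z) (dotL R.β z) := by
  funext γ
  rw [← sub_eq_zero]
  refine eq_zero_of_single (F := fun y => psiB (pullback D R) y z γ -
    hatB D y (dotL R.α y) (dotL R.β y) z (dotL R.α z) (dotL R.β z) γ) ?_ ?_ ?_ y
  · intros; simp [hatB]; ring
  · intros; simp [hatB]; ring
  intro k
  refine eq_zero_of_single (F := fun z => psiB (pullback D R) (Pi.single k 1) z γ -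
    hatB D (Pi.single k 1) (dotL R.α (Pi.single k 1)) (dotL R.β (Pi.single k 1)) z (dotL R.α z)
      (dotL R.β z) γ) ?_ ?_ ?_ z
  · intros; simp [hatB]; ring
  · intros; simp [hatB]; ring
  intro m
  simp only [psiB_single, dotL_single_right]
  exact sub_self _

theorem omL_pullback (D : MongeData n) (R : Reciprocal n) (y : Fin n → ℝ) :
    omL (pullback D R) y = hatB D y (dotL R.α y) (dotL R.β y) 0 R.a R.c := by
  funext γ
  rw [← sub_eq_zero]
  refine eq_zero_of_single (F := fun y => omL (pullback D R) y γ -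
    hatB D y (dotL R.α y) (dotL R.β y) 0 R.a R.c γ) ?_ ?_ ?_ y
  · intros; simp [hatB]; ring
  · intros; simp [hatB]; ring
  intro k
  simp only [omL_single, dotL_single_right]
  exact sub_self _

theorem etaL_pullback (D : MongeData n) (R : Reciprocal n) (y : Fin n → ℝ) :
    etaL (pullback D R) y = hatB D y (dotL R.α y) (dotL R.β y) 0 R.b R.d := by
  funext γ
  rw [← sub_eq_zero]
  refine eq_zero_of_single (F := fun y => etaL (pullback D R) y γ -
    hatB D y (dotL R.α y) (dotL R.β y) 0 R.b R.d γ) ?_ ?_ ?_ y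
  · intros; simp [hatB]; ring
  · intros; simp [hatB]; ring
  intro k
  simp only [etaL_single, dotL_single_right]
  exact sub_self _

/-- The constants of `pullback` record values on basis vectors; this identifies the resulting form
as the full pullback along the map of `projMap`. -/
theorem hatB_pullback (D : MongeData n) (R : Reciprocal n) (y z : Fin n → ℝ)
    (s t s' t' : ℝ) : hatB (pullback D R) y s t z s' t' =
      hatB D y (dotL R.α y + R.a * s + R.b * t) (dotL R.β y + R.c * s + R.d * t)
        z (dotL R.α z + R.a * s' + R.b * t') (dotL R.β z + R.c * s' + R.d * t') := by
  rw [hatB, psiB_pullback, omL_pullback, omL_pullback, etaL_pullback, etaL_pullback,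
    show (pullback D R).ξ = hatB D 0 R.a R.c 0 R.b R.d from rfl]
  simp only [hatB, map_zero, smul_zero, sub_zero]
  module

/-- Each relation is `hatB_cyclic` at images of coordinate vectors. No invertibility of the linear
map is needed here. -/
theorem isMonge_pullback {D : MongeData n} (hD : IsMonge D) (R : Reciprocal n) :
    IsMonge (pullback D R) where
  symm := hD.symm
  nondegenerate := hD.nondegenerate
  skew y z := by rw [psiB_pullback, psiB_pullback, hatB_skew hD]
  psi_psi y z w t := by
    simp only [psiB_pullback, phiB_pullback]
    have := hatB_cyclic hD y z w t (dotL R.α y) (dotL R.β y) (dotL R.α z) (dotL R.β z)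
      (dotL R.α w) (dotL R.β w) (dotL R.α t) (dotL R.β t)
    rw [hD.symm (hatB D y _ _ z _ _), hD.symm (hatB D z _ _ w _ _),
      hD.symm (hatB D w _ _ y _ _)] at this
    linarith
  omega_psi y z w := by
    simp only [psiB_pullback, phiB_pullback, omL_pullback]
    have := hatB_cyclic hD y z w 0 (dotL R.α y) (dotL R.β y) (dotL R.α z) (dotL R.β z)
      (dotL R.α w) (dotL R.β w) R.a R.c
    rw [hD.symm (hatB D y _ _ z _ _), hD.symm (hatB D z _ _ w _ _),
      hD.symm (hatB D w _ _ y _ _)] at this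
    linarith
  psi_eta y z w := by
    simp only [psiB_pullback, phiB_pullback, etaL_pullback]
    exact hatB_cyclic hD y z w 0 (dotL R.α y) (dotL R.β y) (dotL R.α z) (dotL R.β z)
      (dotL R.α w) (dotL R.β w) R.b R.d
  psi_xi y z := by
    simp only [psiB_pullback, phiB_pullback, omL_pullback, etaL_pullback,
      show (pullback D R).ξ = hatB D 0 R.a R.c 0 R.b R.d from rfl]
    have := hatB_cyclic hD y z 0 0 (dotL R.α y) (dotL R.β y) (dotL R.α z) (dotL R.β z)
      R.a R.c R.b R.d
    rw [hatB_skew hD 0 y R.a R.c, phiB_neg_left] at this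
    linarith

theorem det_mongeMetric_ne_zero {D : MongeData n} (hD : D.φ.det ≠ 0) {u : Fin n → ℝ}
    (hinj : ∀ y, frame D u y = 0 → y = 0) : (mongeMetric D u).det ≠ 0 := by
  have hi : Function.Injective (frameL D u) := (injective_iff_map_eq_zero _).2 hinj
  have hs : Function.Surjective (frame D u) :=
    LinearMap.surjective_of_injective (f := (frameL D u : (Fin n → ℝ) →ₗ[ℝ] (Fin n → ℝ))) hi
  intro h0
  obtain ⟨y, hy, hMy⟩ := Matrix.exists_mulVec_eq_zero_iff.2 h0
  apply hy
  apply hinj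
  apply phiB_nondegenerate hD
  intro x
  obtain ⟨x, rfl⟩ := hs x
  rw [← dotL_mongeMetric, linOf_eq_mulVec, hMy, map_zero, phiB_zero_right]

theorem frame_eq_zero {D : MongeData n} {u : Fin n → ℝ} (h0 : (mongeMetric D u).det ≠ 0)
    {y : Fin n → ℝ} (hy : frame D u y = 0) : y = 0 := by
  apply frame_injective h0
  rw [hy]
  exact (map_zero (frameL D u)).symm

/-- The flux relation differentiated along $z$. Skew-symmetry turns the derivative of the frame into
the pairing of $(z,0,0)$ with $(V,0,1)$. -/
theorem frame_fderiv_flux {D : MongeData n} {U : Set (Fin n → ℝ)} {V : (Fin n → ℝ) → Fin n → ℝ}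
    (hD : IsMonge D) (hU : IsConservativeSystem U V)
    (hV : ∀ u ∈ U, frame D u (V u) = etaL D u + D.ξ) {u : Fin n → ℝ} (hu : u ∈ U)
    (z : Fin n → ℝ) : frame D u (fderiv ℝ V u z) = hatB D z 0 0 (V u) 0 1 := by
  have dV := hasDerivAt_add_smul (hasFDerivAt_of_contDiffOn hU.isOpen hU.smooth hu) z
  have d1 := (hasDerivAt_add_smul (hasFDerivAt_frameL (D := D) u) z).clm_apply dV
  have d2 := (hasDerivAt_add_smul (etaL D).hasFDerivAt (u := u) z).add_const D.ξ
  have hev : (fun ε : ℝ => frameL D (u + ε • z) (V (u + ε • z))) =ᶠ[𝓝 0]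
      fun ε : ℝ => etaL D (u + ε • z) + D.ξ := by
    filter_upwards [eventually_add_smul_mem hU.isOpen hu z] with ε hε using hV _ hε
  have := d1.unique (d2.congr_of_eventuallyEq hev)
  simp only [zero_smul, add_zero, ContinuousLinearMap.flip_apply, frameL_apply] at this
  have h2 : hatB D z 0 0 (V u) 0 1 = psiB D z (V u) + etaL D z := by
    rw [hatB]
    module
  rw [h2, ← this, hD.skew z]
  abel

/-! ### Pulling back constants of the transformed system. -/

section

variable {R : Reciprocal n} {U U₁ : Set (Fin n → ℝ)} {V V₁ : (Fin n → ℝ) → (Fin n → ℝ)}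

/-- The hypothesis places $(z,\alpha\cdot z,\beta\cdot z)$, the image of $(z,0,0)$, in the plane of
the new congruence line. The invertible map comes from the old plane, and $(z,0,0)$ lies in that
only for $z=0$. Algebraically, the determinant of the system for $\alpha\cdot z,\beta\cdot z$ times
`jac` is $ad-bc$. -/
theorem eq_zero_of_combination (h0 : R.a * R.d - R.b * R.c ≠ 0) {u v : Fin n → ℝ}
    (hj : R.jac u v ≠ 0) {z : Fin n → ℝ}
    (hz : z = dotL R.α z • R.newDensity u v + dotL R.β z • R.newFlux u v) : z = 0 := by
  have e1 := congrArg (dotL R.α) (density_eq R hj)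
  have e2 := congrArg (dotL R.β) (density_eq R hj)
  have e3 := congrArg (dotL R.α) (flux_eq R hj)
  have e4 := congrArg (dotL R.β) (flux_eq R hj)
  have z1 := congrArg (dotL R.α) hz
  have z2 := congrArg (dotL R.β) hz
  simp only [map_add, map_smul, smul_eq_mul] at e1 e2 e3 e4 z1 z2
  obtain ⟨p, hp⟩ : ∃ p, p = R.newDensity u v := ⟨_, rfl⟩
  obtain ⟨q, hq⟩ : ∃ q, q = R.newFlux u v := ⟨_, rfl⟩
  rw [← hp, ← hq] at e1 e2 e3 e4 z1 z2 hz
  have a1 := Xx_eq R u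
  have a2 := Tx_eq R u
  have a3 := Xt_eq R v
  have a4 := Tt_eq R v
  rw [e1] at a1
  rw [e2] at a2
  rw [e3] at a3
  rw [e4] at a4
  have ha : R.a = R.Xx u * (1 - dotL R.α p) - R.Tx u * dotL R.α q := by linarith
  have hb : R.b = R.Xt v * (1 - dotL R.α p) - R.Tt v * dotL R.α q := by linarith
  have hc : R.c = R.Tx u * (1 - dotL R.β q) - R.Xx u * dotL R.β p := by linarith
  have hd : R.d = R.Tt v * (1 - dotL R.β q) - R.Xt v * dotL R.β p := by linarith
  have hN : (1 - dotL R.α p) * (1 - dotL R.β q) - dotL R.α q * dotL R.β p ≠ 0 := by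
    intro h
    apply h0
    rw [ha, hb, hc, hd]
    linear_combination (R.Xx u * R.Tt v - R.Xt v * R.Tx u) * h
  have s0 : dotL R.α z = 0 := by
    apply mul_left_cancel₀ hN
    linear_combination (1 - dotL R.β q) * z1 + dotL R.α q * z2
  have t0 : dotL R.β z = 0 := by
    apply mul_left_cancel₀ hN
    linear_combination (1 - dotL R.α p) * z2 + dotL R.β p * z1
  rw [hz, s0, t0]
  simp

theorem hatB_density_right (D : MongeData n) {u v : Fin n → ℝ} (hj : R.jac u v ≠ 0)
    (y : Fin n → ℝ) (s t : ℝ) : hatB D y s t u (R.Xx u) (R.Tx u) =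
      R.Xx u • hatB D y s t (R.newDensity u v) 1 0 + R.Tx u • hatB D y s t (R.newFlux u v) 0 1 := by
  have := hatB_combination_right D (R.Xx u) (R.Tx u) y (R.newDensity u v) (R.newFlux u v) 1 0 0 1 s t
  rw [← density_eq R hj] at this
  simpa using this

theorem hatB_flux_right (D : MongeData n) {u v : Fin n → ℝ} (hj : R.jac u v ≠ 0)
    (y : Fin n → ℝ) (s t : ℝ) : hatB D y s t v (R.Xt v) (R.Tt v) =
      R.Xt v • hatB D y s t (R.newDensity u v) 1 0 + R.Tt v • hatB D y s t (R.newFlux u v) 0 1 := by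
  have := hatB_combination_right D (R.Xt v) (R.Tt v) y (R.newDensity u v) (R.newFlux u v) 1 0 0 1 s t
  rw [← flux_eq R hj] at this
  simpa using this

/-- Subtracting vectors of the plane spanned by $(p,1,0)$ and $(q,0,1)$ makes the last two
coordinates of the first argument zero. -/
theorem hatB_reduce (D : MongeData n) (y p q z : Fin n → ℝ) (s t s' t' : ℝ) :
    hatB D y s t z s' t' = hatB D (y - s • p - t • q) 0 0 z s' t'
      + s • hatB D p 1 0 z s' t' + t • hatB D q 0 1 z s' t' := by
  simp only [hatB, map_sub, map_smul, sub_apply, smul_apply]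
  module

variable (hU : IsConservativeSystem U V) (hR : R.Transforms U V U₁ V₁) {D : MongeData n}
  (hD : IsMonge D) (hV : ∀ u ∈ U₁, frame D u (V₁ u) = etaL D u + D.ξ)

include hU hR hD hV

omit hU hD in
theorem hatB_pair {u : Fin n → ℝ} (hu : u ∈ U) :
    hatB D (R.newFlux u (V u)) 0 1 (R.newDensity u (V u)) 1 0 = 0 := by
  have hm : R.newDensity u (V u) ∈ U₁ := hR.range_eq ▸ mem_image_of_mem _ hu
  rw [hatB_flux, ← hR.flux_eq u hu]
  exact hV _ hm

omit hU in
-- The linear map carries the old plane into the new one, on which the forms vanish.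
theorem pullback_flux {u : Fin n → ℝ} (hu : u ∈ U) :
    frame (pullback D R) u (V u) = etaL (pullback D R) u + (pullback D R).ξ := by
  have hj := hR.jac_ne_zero u hu
  have k1 := hatB_pair hR hV hu
  have k2 := hatB_skew hD (R.newDensity u (V u)) (R.newFlux u (V u)) 1 0 0 1
  rw [k1, neg_zero] at k2
  rw [← hatB_flux, hatB_pullback]
  have c1 : dotL R.α (V u) + R.a * 0 + R.b * 1 = R.Xt (V u) := by
    rw [Xt_eq]; ring
  have c2 : dotL R.β (V u) + R.c * 0 + R.d * 1 = R.Tt (V u) := by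
    rw [Tt_eq]; ring
  have c3 : dotL R.α u + R.a * 1 + R.b * 0 = R.Xx u := by
    rw [Xx_eq]; ring
  have c4 : dotL R.β u + R.c * 1 + R.d * 0 = R.Tx u := by
    rw [Tx_eq]; ring
  rw [c1, c2, c3, c4, hatB_density_right D hj, hatB_skew hD (V u), hatB_skew hD (V u),
    hatB_flux_right D hj, hatB_flux_right D hj, k1, k2, hatB_self hD, hatB_self hD]
  simp

/-- Modulo the isotropic plane the image of $(y,0,0)$ is $(w,0,0)$. By `frame_fderiv_flux` the
hypothesis becomes the vanishing of the frame on $X_xw+T_x\,dV_1(w)$, hence of that vector. Writing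
$w=d\tilde u(z)$, `fderiv_density` and `eq_zero_of_combination` give $z=0$, so $w=0$, and a second
use gives $y=0$. -/
theorem pullback_injective (h0 : ∀ u ∈ U₁, (mongeMetric D u).det ≠ 0) {u : Fin n → ℝ} (hu : u ∈ U)
    {y : Fin n → ℝ} (hy : frame (pullback D R) u y = 0) : y = 0 := by
  have hΔ := det_ne_zero_of_transforms hU hR
  have hU₁ := transforms_isConservativeSystem hU hR
  have hj := hR.jac_ne_zero u hu
  have hm : R.newDensity u (V u) ∈ U₁ := hR.range_eq ▸ mem_image_of_mem _ hu
  have k1 := hatB_pair hR hV hu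
  have k2 := hatB_skew hD (R.newDensity u (V u)) (R.newFlux u (V u)) 1 0 0 1
  rw [k1, neg_zero] at k2
  obtain ⟨w, hw⟩ : ∃ w, w = y - dotL R.α y • R.newDensity u (V u)
    - dotL R.β y • R.newFlux u (V u) := ⟨_, rfl⟩
  have c1 : dotL R.α y + R.a * 0 + R.b * 0 = dotL R.α y := by ring
  have c2 : dotL R.β y + R.c * 0 + R.d * 0 = dotL R.β y := by ring
  have c3 : dotL R.α u + R.a * 1 + R.b * 0 = R.Xx u := by
    rw [Xx_eq]; ring
  have c4 : dotL R.β u + R.c * 1 + R.d * 0 = R.Tx u := by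
    rw [Tx_eq]; ring
  rw [← hatB_density, hatB_pullback, c1, c2, c3, c4, hatB_density_right D hj,
    hatB_reduce D y (R.newDensity u (V u)) (R.newFlux u (V u)),
    hatB_reduce D y (R.newDensity u (V u)) (R.newFlux u (V u)), k1, k2, hatB_self hD,
    hatB_self hD, ← hw, hatB_density, ← hR.flux_eq u hu, ← frame_fderiv_flux hD hU₁ hV hm] at hy
  simp only [smul_zero, add_zero] at hy
  obtain ⟨z, hz⟩ := (LinearMap.injective_iff_surjective
    (f := ((fderiv ℝ (fun u => R.newDensity u (V u)) u : (Fin n → ℝ) →L[ℝ] (Fin n → ℝ)) :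
      (Fin n → ℝ) →ₗ[ℝ] (Fin n → ℝ)))).1 (injective_of_det_ne_zero (hR.regular u hu)) w
  have hz' : fderiv ℝ (fun u => R.newDensity u (V u)) u z = w := hz
  have e1 := fderiv_newFlux hU hR z hu
  have e2 := fderiv_density hU hR.jac_ne_zero z hu
  rw [← e1, hz', add_assoc] at e2
  rw [← frame_smul, ← frame_smul, ← frame_add] at hy
  have hw0 := frame_eq_zero (h0 _ hm) hy
  rw [hw0, zero_add] at e2
  have hz0 := eq_zero_of_combination hΔ hj e2
  rw [hz0, map_zero] at hz'
  rw [← hz', eq_comm, sub_sub, sub_eq_zero] at hw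
  exact eq_zero_of_combination hΔ hj hw

end

theorem isThirdOrderHamiltonian_iff {U : Set (Fin n → ℝ)} {V : (Fin n → ℝ) → (Fin n → ℝ)}
    (hU : IsConservativeSystem U V) : IsThirdOrderHamiltonian U V ↔
      ∃ D : MongeData n, IsMonge D ∧ (∀ u ∈ U, (mongeMetric D u).det ≠ 0) ∧
        ∀ u ∈ U, frame D u (V u) = etaL D u + D.ξ := by
  constructor
  · rintro ⟨G, c, hP⟩
    obtain ⟨D, hD⟩ := exists_describes hU hP
    obtain ⟨h1, -, h3⟩ := (describes_iff D).1 hD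
    refine ⟨D, h1, fun u hu => ?_, h3⟩
    have : mongeMetric D u = (G u)⁻¹ := by
      ext i j
      rw [hD.metric_eq u hu i j]
      rfl
    rw [this]
    exact (Matrix.isUnit_nonsing_inv_det _ (isUnit_iff_ne_zero.2
      (hP.1.nondegenerate u hu))).ne_zero
  · rintro ⟨D, h1, h2, h3⟩
    exact ⟨_, _, isHamiltonianStructure_monge hU h1 h2 h3⟩

theorem isThirdOrderHamiltonian_of_transforms {R : Reciprocal n} {U U₁ : Set (Fin n → ℝ)}
    {V V₁ : (Fin n → ℝ) → (Fin n → ℝ)} (hU : IsConservativeSystem U V)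
    (hR : R.Transforms U V U₁ V₁) (h : IsThirdOrderHamiltonian U₁ V₁) :
    IsThirdOrderHamiltonian U V := by
  obtain ⟨D, hD, h0, hV⟩ :=
    (isThirdOrderHamiltonian_iff (transforms_isConservativeSystem hU hR)).1 h
  have hD' := isMonge_pullback hD R
  exact (isThirdOrderHamiltonian_iff hU).2 ⟨pullback D R, hD',
    fun u hu => det_mongeMetric_ne_zero hD'.nondegenerate
      fun y hy => pullback_injective hU hR hD hV h0 hu hy,
    fun u hu => pullback_flux hR hD hV hu⟩

end

section

/-! ### The projective transformation -/

variable {n : ℕ}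

theorem projMap_inl (R : Reciprocal n) (y : Fin n ⊕ Fin 2 → ℝ) (i : Fin n) :
    R.projMap y (Sum.inl i) = y (Sum.inl i) := by
  simp [Reciprocal.projMap, Matrix.toLin'_apply, Matrix.fromBlocks_mulVec]

theorem projMap_inr_zero (R : Reciprocal n) (y : Fin n ⊕ Fin 2 → ℝ) :
    R.projMap y (Sum.inr 0) = dotL R.α (fun i => y (Sum.inl i)) + R.a * y (Sum.inr 0)
      + R.b * y (Sum.inr 1) := by
  simp [Reciprocal.projMap, Matrix.toLin'_apply, Matrix.mulVec, dotProduct, dotL_apply, Fin.sum_univ_two, add_assoc]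

theorem projMap_inr_one (R : Reciprocal n) (y : Fin n ⊕ Fin 2 → ℝ) :
    R.projMap y (Sum.inr 1) = dotL R.β (fun i => y (Sum.inl i)) + R.c * y (Sum.inr 0)
      + R.d * y (Sum.inr 1) := by
  simp [Reciprocal.projMap, Matrix.toLin'_apply, Matrix.mulVec, dotProduct, dotL_apply, Fin.sum_univ_two, add_assoc]

theorem det_smul_projMap (R : Reciprocal n) (s : ℝ) :
    LinearMap.det (s • R.projMap) = s ^ (n + 2) * (R.a * R.d - R.b * R.c) := by
  rw [LinearMap.det_smul, Reciprocal.projMap, LinearMap.det_toLin', Matrix.det_fromBlocks_zero₁₂,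
    Matrix.det_one, Matrix.det_fin_two_of, one_mul]
  simp

/-- For odd $n$ the power $n+2$ is odd, so the sign of $s$ can absorb the sign of $\delta$. -/
theorem exists_scale {δ : ℝ} (hδ : δ ≠ 0) (n : ℕ) :
    ∃ s : ℝ, s ≠ 0 ∧ |s ^ (n + 2) * δ| = 1 ∧ (Odd n → s ^ (n + 2) * δ = 1) := by
  obtain ⟨r, hr, hrn⟩ : ∃ r : ℝ, 0 < r ∧ r ^ (n + 2) = |δ|⁻¹ :=
    ⟨|δ|⁻¹ ^ (((n + 2 : ℕ) : ℝ)⁻¹), by positivity,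
      Real.rpow_inv_natCast_pow (by positivity) (by omega)⟩
  rcases hδ.lt_or_gt with h | h
  · refine ⟨-r, by simpa using hr.ne', ?_, fun hn => ?_⟩
    · rw [abs_mul, abs_pow, abs_neg, abs_of_pos hr, hrn, inv_mul_cancel₀ (abs_ne_zero.2 hδ)]
    · rw [Odd.neg_pow (hn.add_even even_two), hrn, abs_of_neg h]
      field_simp
  · refine ⟨r, hr.ne', ?_, fun hn => ?_⟩
    · rw [abs_mul, abs_pow, abs_of_pos hr, hrn, inv_mul_cancel₀ (abs_ne_zero.2 hδ)]
    · rw [hrn, abs_of_pos h, inv_mul_cancel₀ hδ]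

theorem map_congruenceLine (R : Reciprocal n) {u v : Fin n → ℝ} (hj : R.jac u v ≠ 0) {s : ℝ}
    (hs : s ≠ 0) : (congruenceLine u v).map (s • R.projMap) =
      congruenceLine (R.newDensity u v) (R.newFlux u v) := by
  have hjac : R.jac u v = R.Xx u * R.Tt v - R.Xt v * R.Tx u := rfl
  have key : ∀ y : Fin n ⊕ Fin 2 → ℝ, y ∈ congruenceLine u v →
      R.projMap y (Sum.inr 0) = R.Xx u * y (Sum.inr 0) + R.Xt v * y (Sum.inr 1) ∧
      R.projMap y (Sum.inr 1) = R.Tx u * y (Sum.inr 0) + R.Tt v * y (Sum.inr 1) := by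
    intro y hy
    have e : (fun i => y (Sum.inl i)) = y (Sum.inr 0) • u + y (Sum.inr 1) • v := by
      funext i
      rw [hy i]
      simp [mul_comm]
    rw [projMap_inr_zero, projMap_inr_one, e, Xx_eq, Xt_eq, Tx_eq, Tt_eq]
    simp only [map_add, map_smul, smul_eq_mul]
    constructor <;> ring
  ext w
  constructor
  · rintro ⟨y, hy, rfl⟩
    intro i
    obtain ⟨k0, k1⟩ := key y hy
    obtain ⟨f1, f2⟩ := R.form_eq u v hj i
    simp only [LinearMap.smul_apply, Pi.smul_apply, smul_eq_mul, projMap_inl, k0, k1]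
    rw [hy i]
    linear_combination s * y (Sum.inr 0) * f1 + s * y (Sum.inr 1) * f2
  · intro hw
    -- The preimage on the old line, by Cramer's rule: on a congruence line the map acts through the
    -- $2\times2$ matrix with determinant `jac`.
    obtain ⟨p, hp⟩ : ∃ p, p = (s * R.jac u v)⁻¹ * (R.Tt v * w (Sum.inr 0) - R.Xt v * w (Sum.inr 1)) :=
      ⟨_, rfl⟩
    obtain ⟨q, hq⟩ : ∃ q, q = (s * R.jac u v)⁻¹ * (R.Xx u * w (Sum.inr 1) - R.Tx u * w (Sum.inr 0)) :=
      ⟨_, rfl⟩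
    have e0 : s * (R.Xx u * p + R.Xt v * q) = w (Sum.inr 0) := by
      rw [hp, hq]
      field_simp
      rw [hjac]
      ring
    have e1 : s * (R.Tx u * p + R.Tt v * q) = w (Sum.inr 1) := by
      rw [hp, hq]
      field_simp
      rw [hjac]
      ring
    obtain ⟨y, hy⟩ : ∃ y : Fin n ⊕ Fin 2 → ℝ, y = Sum.elim (fun i => u i * p + v i * q) ![p, q] :=
      ⟨_, rfl⟩
    have y0 : y (Sum.inr 0) = p := by rw [hy]; rfl
    have y1 : y (Sum.inr 1) = q := by rw [hy]; rfl
    have yi : ∀ i, y (Sum.inl i) = u i * p + v i * q := fun i => by rw [hy]; rfl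
    have hmem : y ∈ congruenceLine u v := fun i => by rw [yi, y0, y1]
    obtain ⟨k0, k1⟩ := key y hmem
    rw [y0, y1] at k0 k1
    refine ⟨y, hmem, ?_⟩
    funext j
    simp only [LinearMap.smul_apply, Pi.smul_apply, smul_eq_mul]
    rcases j with i | j
    · obtain ⟨f1, f2⟩ := R.form_eq u v hj i
      rw [projMap_inl, yi, hw i, ← e0, ← e1]
      linear_combination s * p * f1 + s * q * f2
    · fin_cases j
      · exact (congrArg (s * ·) k0).trans e0
      · exact (congrArg (s * ·) k1).trans e1

theorem exists_scale_map_congruenceLine {R : Reciprocal n} {U U₁ : Set (Fin n → ℝ)}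
    {V V₁ : (Fin n → ℝ) → (Fin n → ℝ)} (hU : IsConservativeSystem U V)
    (hR : R.Transforms U V U₁ V₁) : ∃ s : ℝ, |LinearMap.det (s • R.projMap)| = 1 ∧
      (Odd n → LinearMap.det (s • R.projMap) = 1) ∧
        ∀ u ∈ U, (congruenceLine u (V u)).map (s • R.projMap) =
          congruenceLine (R.newDensity u (V u)) (V₁ (R.newDensity u (V u))) := by
  obtain ⟨s, hs, h1, h2⟩ := exists_scale (det_ne_zero_of_transforms hU hR) n
  refine ⟨s, ?_, ?_, fun u hu => ?_⟩
  · rwa [det_smul_projMap]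
  · rwa [det_smul_projMap]
  · rw [hR.flux_eq u hu, map_congruenceLine R (hR.jac_ne_zero u hu) hs]

/-! ### The inversion -/

theorem newDensity_inversion (u v : Fin n → ℝ) : (Reciprocal.inversion n).newDensity u v = v := by
  funext i
  simp [Reciprocal.newDensity, Reciprocal.inversion, Reciprocal.jac, Reciprocal.Xx, Reciprocal.Xt,
    Reciprocal.Tx, Reciprocal.Tt]

theorem newFlux_inversion (u v : Fin n → ℝ) : (Reciprocal.inversion n).newFlux u v = u := by
  funext i
  simp [Reciprocal.newFlux, Reciprocal.inversion, Reciprocal.jac, Reciprocal.Xx, Reciprocal.Xt,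
    Reciprocal.Tx, Reciprocal.Tt]

theorem omL_swap (D : MongeData n) : omL D.swap = etaL D := rfl

theorem etaL_swap (D : MongeData n) : etaL D.swap = omL D := rfl

theorem psiB_swap (D : MongeData n) : psiB D.swap = psiB D := rfl

theorem phiB_swap (D : MongeData n) : phiB D.swap = phiB D := rfl

theorem frame_swap (D : MongeData n) (v y : Fin n → ℝ) :
    frame D.swap v y = hatB D y 0 0 v 0 1 := by
  rw [frame, psiB_swap, omL_swap, hatB]
  module

/-- Exchanging the two extra coordinates interchanges `omega_psi` with `psi_eta`; `psi_xi` maps to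
itself because $\xi$ changes sign. -/
theorem isMonge_swap {D : MongeData n} (hD : IsMonge D) : IsMonge D.swap where
  symm := hD.symm
  nondegenerate := hD.nondegenerate
  skew := hD.skew
  psi_psi := hD.psi_psi
  omega_psi y z w := by
    rw [omL_swap, psiB_swap, phiB_swap, hD.symm (etaL D y), hD.symm (etaL D z), hD.symm (etaL D w)]
    linarith [hD.psi_eta y z w]
  psi_eta y z w := by
    rw [etaL_swap, psiB_swap, phiB_swap, hD.symm _ (omL D y), hD.symm _ (omL D z),
      hD.symm _ (omL D w)]
    linarith [hD.omega_psi y z w]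
  psi_xi y z := by
    rw [etaL_swap, omL_swap, psiB_swap, phiB_swap, hD.symm (etaL D z), hD.symm (etaL D y)]
    have := hD.psi_xi y z
    have e : D.swap.ξ = -D.ξ := rfl
    rw [e, phiB_neg_right]
    linarith

theorem frame_swap_flux {D : MongeData n} (hD : IsMonge D) {u v : Fin n → ℝ}
    (h : frame D u v = etaL D u + D.ξ) : frame D.swap v u = etaL D.swap v + D.swap.ξ := by
  have e : D.swap.ξ = -D.ξ := rfl
  rw [frame] at h
  rw [frame, psiB_swap, omL_swap, etaL_swap, e, hD.skew u v, ← sub_eq_zero]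
  rw [← sub_eq_zero] at h
  rw [← neg_eq_zero, ← h]
  module

theorem linOf_jacobianMatrix (V : (Fin n → ℝ) → (Fin n → ℝ)) (u y : Fin n → ℝ) :
    linOf (jacobianMatrix V u) y = fderiv ℝ V u y := by
  rw [linOf_eq_mulVec, jacobianMatrix, LinearMap.toMatrix'_mulVec]
  rfl

theorem dotL_linOf_transpose (M : Matrix (Fin n) (Fin n) ℝ) (y z : Fin n → ℝ) :
    dotL y (linOf M.transpose z) = dotL (linOf M y) z := by
  rw [linOf_eq_mulVec, linOf_eq_mulVec, dotL_apply, dotL_apply]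
  change y ⬝ᵥ (M.transpose.mulVec z) = M.mulVec y ⬝ᵥ z
  rw [Matrix.mulVec_transpose, dotProduct_comm y, ← Matrix.dotProduct_mulVec, dotProduct_comm]

theorem eq_of_dotL_linOf {A B : Matrix (Fin n) (Fin n) ℝ}
    (h : ∀ y z, dotL y (linOf A z) = dotL y (linOf B z)) : A = B := by
  ext i j
  have := h (Pi.single i 1) (Pi.single j 1)
  simpa [dotL_single, linOf_apply, Pi.single_apply] using this

/-- For an inversion, the metric of the swapped Monge data is the pullback of the metric. -/
theorem mongeMetric_swap {D : MongeData n} {U : Set (Fin n → ℝ)} {V : (Fin n → ℝ) → Fin n → ℝ}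
    {g : (Fin n → ℝ) → Matrix (Fin n) (Fin n) ℝ} (hU : IsConservativeSystem U V)
    (hD : D.Describes U V g) {u : Fin n → ℝ} (hu : u ∈ U) :
    mongeMetric D.swap (V u) =
      (jacobianMatrix V u).transpose * g u * jacobianMatrix V u := by
  obtain ⟨h1, h2, h3⟩ := (describes_iff D).1 hD
  apply eq_of_dotL_linOf
  intro y z
  rw [dotL_mongeMetric, mul_assoc, linOf_mul, linOf_mul, dotL_linOf_transpose, linOf_jacobianMatrix,
    linOf_jacobianMatrix, h2 u hu, frame_fderiv_flux h1 hU h3 hu, frame_fderiv_flux h1 hU h3 hu,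
    frame_swap, frame_swap, phiB_swap]

/-- One choice of constants yields the new structure. Any other choice is compatible with it,
because `mongeMetric_swap` expresses the swapped metric through $g$ and $\partial V$ alone. -/
theorem inversion_hamiltonian {U U₁ : Set (Fin n → ℝ)} {V V₁ : (Fin n → ℝ) → (Fin n → ℝ)}
    {G : (Fin n → ℝ) → Matrix (Fin n) (Fin n) ℝ} {c : (Fin n → ℝ) → Fin n → Fin n → Fin n → ℝ}
    (hU : IsConservativeSystem U V) (hR : (Reciprocal.inversion n).Transforms U V U₁ V₁)
    (hP : IsHamiltonianStructure U V G c) :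
    ∃ (G₁ : (Fin n → ℝ) → Matrix (Fin n) (Fin n) ℝ)
      (c₁ : (Fin n → ℝ) → Fin n → Fin n → Fin n → ℝ),
      IsHamiltonianStructure U₁ V₁ G₁ c₁ ∧
      (∀ u ∈ U, (G₁ (V u))⁻¹ =
        (jacobianMatrix V u).transpose * (G u)⁻¹ * jacobianMatrix V u) ∧
      (∃ D : MongeData n, D.Describes U V (fun u => (G u)⁻¹)) ∧
      ∀ D : MongeData n, D.Describes U V (fun u => (G u)⁻¹) →
        D.swap.Describes U₁ V₁ (fun u => (G₁ u)⁻¹) := by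
  have hU₁ := transforms_isConservativeSystem hU hR
  have hran : U₁ = V '' U := by
    have := hR.range_eq
    simpa only [newDensity_inversion] using this
  have hfl : ∀ u ∈ U, V₁ (V u) = u := by
    have := hR.flux_eq
    simpa only [newDensity_inversion, newFlux_inversion] using this
  have hreg : ∀ u ∈ U, (fderiv ℝ V u).det ≠ 0 := by
    have := hR.regular
    simpa only [newDensity_inversion] using this
  have hJ : ∀ u ∈ U, (jacobianMatrix V u).det ≠ 0 := fun u hu => by
    rw [jacobianMatrix, LinearMap.det_toMatrix']
    exact hreg u hu
  obtain ⟨D, hD⟩ := exists_describes hU hP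
  obtain ⟨hM, -, hV⟩ := (describes_iff D).1 hD
  have hg : ∀ u ∈ U, (mongeMetric D.swap (V u)).det ≠ 0 := by
    intro u hu
    rw [mongeMetric_swap hU hD hu, Matrix.det_mul, Matrix.det_mul, Matrix.det_transpose]
    exact mul_ne_zero (mul_ne_zero (hJ u hu) (Matrix.isUnit_nonsing_inv_det _
      (isUnit_iff_ne_zero.2 (hP.1.nondegenerate u hu))).ne_zero) (hJ u hu)
  have hg₁ : ∀ v ∈ U₁, (mongeMetric D.swap v).det ≠ 0 := by
    rw [hran]
    rintro _ ⟨u, hu, rfl⟩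
    exact hg u hu
  have hswap : ∀ D : MongeData n, IsMonge D → (∀ u ∈ U, frame D u (V u) = etaL D u + D.ξ) →
      ∀ v ∈ U₁, frame D.swap v (V₁ v) = etaL D.swap v + D.swap.ξ := by
    intro D hM hV
    rw [hran]
    rintro _ ⟨u, hu, rfl⟩
    rw [hfl u hu]
    exact frame_swap_flux hM (hV u hu)
  refine ⟨_, _, isHamiltonianStructure_monge hU₁ (isMonge_swap hM) hg₁ (hswap D hM hV), fun u hu => ?_,
    ⟨D, hD⟩, fun D' hD' => ?_⟩
  · rw [Matrix.nonsing_inv_nonsing_inv _ (isUnit_iff_ne_zero.2 (hg u hu)), mongeMetric_swap hU hD hu]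
  · obtain ⟨hM', -, hV'⟩ := (describes_iff D').1 hD'
    refine (describes_iff _).2 ⟨isMonge_swap hM', ?_, hswap D' hM' hV'⟩
    rw [hran]
    rintro _ ⟨u, hu, rfl⟩ y z
    rw [Matrix.nonsing_inv_nonsing_inv _ (isUnit_iff_ne_zero.2 (hg u hu)),
      mongeMetric_swap hU hD hu, ← mongeMetric_swap hU hD' hu, dotL_mongeMetric]

end

end ThirdOrder

end

theorem theorem4 (n : ℕ) :
    -- invariance under all reciprocal transformations, which act by projective transformations
    (∀ (R : Reciprocal n) (U U₁ : Set (Fin n → ℝ)) (V V₁ : (Fin n → ℝ) → (Fin n → ℝ)),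
      IsConservativeSystem U V → R.Transforms U V U₁ V₁ →
        IsConservativeSystem U₁ V₁ ∧
        (IsStrictlyHyperbolic U V ↔ IsStrictlyHyperbolic U₁ V₁) ∧
        (IsThirdOrderHamiltonian U V ↔ IsThirdOrderHamiltonian U₁ V₁) ∧
        ∃ s : ℝ, |LinearMap.det (s • R.projMap)| = 1 ∧
          (Odd n → LinearMap.det (s • R.projMap) = 1) ∧
          ∀ u ∈ U, (congruenceLine u (V u)).map (s • R.projMap) =
            congruenceLine (R.newDensity u (V u)) (V₁ (R.newDensity u (V u)))) ∧
    -- the inversion: for every Hamiltonian structure of the system, with metric `g = G⁻¹`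
    (∀ (U U₁ : Set (Fin n → ℝ)) (V V₁ : (Fin n → ℝ) → (Fin n → ℝ))
      (G : (Fin n → ℝ) → Matrix (Fin n) (Fin n) ℝ)
      (c : (Fin n → ℝ) → Fin n → Fin n → Fin n → ℝ),
      IsConservativeSystem U V → (Reciprocal.inversion n).Transforms U V U₁ V₁ →
      IsHamiltonianStructure U V G c →
        ∃ (G₁ : (Fin n → ℝ) → Matrix (Fin n) (Fin n) ℝ)
          (c₁ : (Fin n → ℝ) → Fin n → Fin n → Fin n → ℝ),
          IsHamiltonianStructure U₁ V₁ G₁ c₁ ∧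
          (∀ u ∈ U, (G₁ (V u))⁻¹ =
            (jacobianMatrix V u).transpose * (G u)⁻¹ * jacobianMatrix V u) ∧
          (∃ D : MongeData n, D.Describes U V (fun u => (G u)⁻¹)) ∧
          ∀ D : MongeData n, D.Describes U V (fun u => (G u)⁻¹) →
            D.swap.Describes U₁ V₁ (fun u => (G₁ u)⁻¹)) := by
  refine ⟨fun R U U₁ V V₁ hU hR => ?_, fun U U₁ V V₁ G c hU hR hP =>
    ThirdOrder.inversion_hamiltonian hU hR hP⟩
  have hU₁ := ThirdOrder.transforms_isConservativeSystem hU hR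
  have hR' := ThirdOrder.transforms_invReciprocal hU hR
  exact ⟨hU₁, ⟨ThirdOrder.transforms_isStrictlyHyperbolic hU hR,
      ThirdOrder.transforms_isStrictlyHyperbolic hU₁ hR'⟩,
    ⟨ThirdOrder.isThirdOrderHamiltonian_of_transforms hU₁ hR',
      ThirdOrder.isThirdOrderHamiltonian_of_transforms hU hR⟩,
    ThirdOrder.exists_scale_map_congruenceLine hU hR⟩
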